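/- Let $K$ be a field of characteristic $0$ (for example $\mathbb C$ or $\mathbb C(q)$) and let $q\in K^\times$ not be a root of unity. **Notation.** For every size $n$ let $$R(u,v)=(u-v)\sum_{i\ne j}E_{ii}\otimes E_{jj}+(q^{-1}u-qv)\sum_iE_{ii}\otimes E_{ii}+(q^{-1}-q)u\sum_{i>j}E_{ij}\otimes E_{ji}+(q^{-1}-q)v\sum_{i<j}E_{ij}\otimes E_{ji},$$ put $R(x)=R(x,1)$ and $\overline R(x)=R(x,1)/(x-1)$, and let ${}^t$ denote the transpose in the first tensor factor. Let $\mathrm Y_q^{\mathrm{tw}}(\mathfrak o_n)$ be the unital associative $K$-algebra generated by $s_{ij}^{(r)}$, $1\le i,j\le n$, $r\ge 0$, with relations $$R(u/v)S_1(u)R^t(1/uv)S_2(v)=S_2(v)R^t(1/uv)S_1(u)R(u/v),\qquad S(u)=\Big(\sum_{r\ge0}s_{ij}^{(r)}u^{-r}\Big)_{i,j},$$ and $s_{ij}^{(0)}=0$ for $i<j$, $s_{ii}^{(0)}=1$. For even $n$ let $\mathrm Y_q^{\mathrm{tw}}(\mathfrak{sp}_n)$ be the unital associative $K$-algebra generated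 by $s_{ij}^{(r)}$ and $(s_{ii'}^{(0)})^{-1}$, $i=1,3,\dots,n-1$, where $i'=i+1$, with the same reflection relation and $s^{(0)}_{ij}=0$ for $i<j$ unless $i$ is odd and $j=i+1$; $s^{(0)}_{i'i'}s^{(0)}_{ii}-q^2s^{(0)}_{i'i}s^{(0)}_{ii'}=q^3$ and $s_{ii'}^{(0)}(s_{ii'}^{(0)})^{-1}=(s_{ii'}^{(0)})^{-1}s_{ii'}^{(0)}=1$ for $i=1,3,\dots,n-1$. For an $n\times n$ matrix $Z(u)$ whose entries are power series in $u^{-1}$ over a $K$-algebra, put $u_i=q^{-2i+2}u$, $\overline R^t_{ij}=\overline R^t_{ij}(u_i^{-1}u_j^{-1})$ (expanded in powers of $u^{-1}$) and $$\langle Z_1,\dots,Z_n\rangle=Z_1(u_1)(\overline R^t_{12}\cdots\overline R^t_{1n})Z_2(u_2)(\overline R^t_{23}\cdots\overline R^t_{2n})\cdots Z_n(u_n).$$ The Sklyanin determinant $(\mathrm{sdet}_q Z)(u)$, a power series in $u^{-1}$, is $n!$ times the coefficient of $E_{11}\otimes\cdots\otimes E_{nn}$ in $A_n^q\langle Z_1,\dots,Z_n\rangle$.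 Here $A_n^q=\frac1{n!}\sum_{\sigma\in\mathfrak S_n}\operatorname{sgn}(\sigma)P_\sigma^q$, and $\sigma\mapsto P^q_\sigma$ is the action of $\mathfrak S_n$ on $(K^n)^{\otimes n}$ in which the transposition $(i,i+1)$ acts on the factors $i,i+1$ by $P^q=\sum_iE_{ii}\otimes E_{ii}+q\sum_{i>j}E_{ij}\otimes E_{ji}+q^{-1}\sum_{i<j}E_{ij}\otimes E_{ji}$. **Theorem.** Let $S(u)$ be the generator matrix of $\mathrm Y_q^{\mathrm{tw}}(\mathfrak o_{N+M})$, or, if $N$ and $M$ are both even, of $\mathrm Y_q^{\mathrm{tw}}(\mathfrak{sp}_{N+M})$, and write $$S(u)=\begin{pmatrix}S_{11}(u)&S_{12}(u)\\S_{21}(u)&S_{22}(u)\end{pmatrix}$$ with $S_{11}$ of size $N\times N$ and $S_{22}$ of size $M\times M$. Then $S_{11}(u)$ and $S_{22}(u)$ are invertible matrices of power series in $u^{-1}$. Put $$Z^{(2)}(u)=\big(S_{22}-S_{21}S_{11}^{-1}S_{12}\big)(q^{-N}u),\qquad Z^{(1)}(u)=\big(S_{11}-S_{12}S_{22}^{-1}S_{21}\big)(q^{-M}u).$$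 Then $$(\mathrm{sdet}_qS)(u)=(\mathrm{sdet}_qS_{11})(u)\cdot(\mathrm{sdet}_qZ^{(2)})(q^{-N}u)=(\mathrm{sdet}_qS_{22})(u)\cdot(\mathrm{sdet}_qZ^{(1)})(q^{-M}u).$$ (In these formulas the matrix under the second Sklyanin determinant is $Z^{(2)}(q^{-N}u)=(S_{22}-S_{21}S_{11}^{-1}S_{12})(q^{-2N}u)$, respectively $Z^{(1)}(q^{-M}u)=(S_{11}-S_{12}S_{22}^{-1}S_{21})(q^{-2M}u)$.) -/

import Mathlib

noncomputable section

namespace TwistedQYangian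

/-! ### R-matrices

The tensor product `End(K^ι) ⊗ End(K^ι)` is the matrix algebra on `ι × ι`: the entry at
`((i, k), (j, l))` is the coefficient of `E_ij ⊗ E_kl`. -/

/-- The trigonometric R-matrix
`R(u,v) = (u - v) ∑_{i ≠ j} E_ii ⊗ E_jj + (q⁻¹ u - q v) ∑_i E_ii ⊗ E_ii`
`  + (q⁻¹ - q) u ∑_{i > j} E_ij ⊗ E_ji + (q⁻¹ - q) v ∑_{i < j} E_ij ⊗ E_ji`. -/
def rMatrix {K B ι : Type*} [Field K] [CommRing B] [Algebra K B] [LinearOrder ι]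
    (q : K) (u v : B) : Matrix (ι × ι) (ι × ι) B :=
  fun a b =>
    if a.1 = b.1 ∧ a.2 = b.2 then
      (if a.1 = a.2 then q⁻¹ • u - q • v else u - v)
    else if a.1 = b.2 ∧ a.2 = b.1 then
      (q⁻¹ - q) • (if b.1 < a.1 then u else v)
    else 0

/-- Partial transpose in the first tensor factor. -/
def partialTranspose {B ι : Type*} (T : Matrix (ι × ι) (ι × ι) B) :
    Matrix (ι × ι) (ι × ι) B :=
  fun a b => T (b.1, a.2) (a.1, b.2)

/-! ### The reflection equation

A series in `u⁻¹` with coefficients in `A` is an element of `PowerSeries A`, the variable `X`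
standing for `u⁻¹`. A series in `u⁻¹` and `v⁻¹` is an element of `MvPowerSeries (Fin 2) A`, with
`X 0 = u⁻¹` and `X 1 = v⁻¹`. -/

/-- The series `f(u)` (for `k = 0`) or `f(v)` (for `k = 1`) as a series in `u⁻¹, v⁻¹`. -/
def inVar {A : Type*} [Semiring A] (k : Fin 2) (f : PowerSeries A) : MvPowerSeries (Fin 2) A :=
  fun d => if d = Finsupp.single k (d k) then PowerSeries.coeff (d k) f else 0

/-- `R(u/v)` up to a scalar factor, which cancels in the reflection equation: as `R(u,v)` is
homogeneous of degree one, `u⁻¹ R(u/v, 1) = R(v⁻¹, u⁻¹)`. -/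
def reflR {K ι : Type*} [Field K] [LinearOrder ι] (A : Type*) [Ring A] [Algebra K A] (q : K) :
    Matrix (ι × ι) (ι × ι) (MvPowerSeries (Fin 2) A) :=
  (rMatrix q (MvPowerSeries.X 1 : MvPowerSeries (Fin 2) K) (MvPowerSeries.X 0)).map
    (MvPowerSeries.map (algebraMap K A))

/-- `R^t(1/(uv))` up to a scalar factor, which cancels in the reflection equation:
the partial transpose of `R(u⁻¹ v⁻¹, 1)`. -/
def reflRt {K ι : Type*} [Field K] [LinearOrder ι] (A : Type*) [Ring A] [Algebra K A] (q : K) :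
    Matrix (ι × ι) (ι × ι) (MvPowerSeries (Fin 2) A) :=
  (partialTranspose (rMatrix q
    (MvPowerSeries.X 0 * MvPowerSeries.X 1 : MvPowerSeries (Fin 2) K) 1)).map
    (MvPowerSeries.map (algebraMap K A))

/-- `S₁(u) = S(u) ⊗ 1`. -/
def reflS1 {ι A : Type*} [LinearOrder ι] [Ring A] (S : Matrix ι ι (PowerSeries A)) :
    Matrix (ι × ι) (ι × ι) (MvPowerSeries (Fin 2) A) :=
  Matrix.kronecker (S.map (inVar 0)) 1

/-- `S₂(v) = 1 ⊗ S(v)`. -/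
def reflS2 {ι A : Type*} [LinearOrder ι] [Ring A] (S : Matrix ι ι (PowerSeries A)) :
    Matrix (ι × ι) (ι × ι) (MvPowerSeries (Fin 2) A) :=
  Matrix.kronecker 1 (S.map (inVar 1))

/-- `R(u/v) S₁(u) R^t(1/(uv)) S₂(v)`. -/
def reflLHS {K ι A : Type*} [Field K] [LinearOrder ι] [Fintype ι] [Ring A] [Algebra K A]
    (q : K) (S : Matrix ι ι (PowerSeries A)) :
    Matrix (ι × ι) (ι × ι) (MvPowerSeries (Fin 2) A) :=
  reflR A q * reflS1 S * reflRt A q * reflS2 S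

/-- `S₂(v) R^t(1/(uv)) S₁(u) R(u/v)`. -/
def reflRHS {K ι A : Type*} [Field K] [LinearOrder ι] [Fintype ι] [Ring A] [Algebra K A]
    (q : K) (S : Matrix ι ι (PowerSeries A)) :
    Matrix (ι × ι) (ι × ι) (MvPowerSeries (Fin 2) A) :=
  reflS2 S * reflRt A q * reflS1 S * reflR A q

/-! ### The orthogonal twisted q-Yangian -/

/-- Generators `s_ij^(r)`. -/
inductive OrthGen (n : ℕ) : Type
  | s (i j : Fin n) (r : ℕ) : OrthGen n

/-- `S(u)` over the free algebra. -/
def orthFreeS (K : Type*) [Field K] (n : ℕ) :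
    Matrix (Fin n) (Fin n) (PowerSeries (FreeAlgebra K (OrthGen n))) :=
  fun i j => PowerSeries.mk fun r => FreeAlgebra.ι K (OrthGen.s i j r)

/-- Defining relations of the orthogonal twisted q-Yangian. -/
inductive OrthRel (K : Type*) [Field K] (n : ℕ) (q : K) :
    FreeAlgebra K (OrthGen n) → FreeAlgebra K (OrthGen n) → Prop
  | upper (i j : Fin n) (hij : i < j) :
      OrthRel K n q (FreeAlgebra.ι K (OrthGen.s i j 0)) 0
  | diag (i : Fin n) :
      OrthRel K n q (FreeAlgebra.ι K (OrthGen.s i i 0)) 1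
  | reflection (a b : Fin n × Fin n) (d : Fin 2 →₀ ℕ) :
      OrthRel K n q (MvPowerSeries.coeff d (reflLHS q (orthFreeS K n) a b))
        (MvPowerSeries.coeff d (reflRHS q (orthFreeS K n) a b))

/-- The twisted q-Yangian `Y_q^tw(o_n)`. -/
abbrev OrthYangian (K : Type*) [Field K] (n : ℕ) (q : K) : Type _ :=
  RingQuot (OrthRel K n q)

/-- The matrix `S(u)` of generating series of `Y_q^tw(o_n)`. -/
def orthS (K : Type*) [Field K] (n : ℕ) (q : K) :
    Matrix (Fin n) (Fin n) (PowerSeries (OrthYangian K n q)) :=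
  fun i j => PowerSeries.mk fun r =>
    RingQuot.mkAlgHom K (OrthRel K n q) (FreeAlgebra.ι K (OrthGen.s i j r))

/-! ### The symplectic twisted q-Yangian

Indices run over `0, …, n - 1` with `n` even, so the pairs `(i, i')` with `i = 1, 3, …` become the
pairs `(i, i + 1)` with `i` even. -/

/-- Generators `s_ij^(r)` and `(s_ii'^(0))⁻¹`. -/
inductive SpGen (n : ℕ) : Type
  | s (i j : Fin n) (r : ℕ) : SpGen n
  | sInv (i : Fin n) (hi : Even (i : ℕ)) : SpGen n

/-- `S(u)` over the free algebra. -/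
def spFreeS (K : Type*) [Field K] (n : ℕ) :
    Matrix (Fin n) (Fin n) (PowerSeries (FreeAlgebra K (SpGen n))) :=
  fun i j => PowerSeries.mk fun r => FreeAlgebra.ι K (SpGen.s i j r)

/-- Defining relations of the symplectic twisted q-Yangian. -/
inductive SpRel (K : Type*) [Field K] (n : ℕ) (q : K) :
    FreeAlgebra K (SpGen n) → FreeAlgebra K (SpGen n) → Prop
  | upper (i j : Fin n) (hij : i < j) (hpair : ¬ (Even (i : ℕ) ∧ (j : ℕ) = i + 1)) :
      SpRel K n q (FreeAlgebra.ι K (SpGen.s i j 0)) 0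
  | block (i i' : Fin n) (hi : Even (i : ℕ)) (hi' : (i' : ℕ) = i + 1) :
      SpRel K n q
        (FreeAlgebra.ι K (SpGen.s i' i' 0) * FreeAlgebra.ι K (SpGen.s i i 0)
          - q ^ 2 • (FreeAlgebra.ι K (SpGen.s i' i 0) * FreeAlgebra.ι K (SpGen.s i i' 0)))
        (algebraMap K _ (q ^ 3))
  | mul_inv (i i' : Fin n) (hi : Even (i : ℕ)) (hi' : (i' : ℕ) = i + 1) :
      SpRel K n q (FreeAlgebra.ι K (SpGen.s i i' 0) * FreeAlgebra.ι K (SpGen.sInv i hi)) 1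
  | inv_mul (i i' : Fin n) (hi : Even (i : ℕ)) (hi' : (i' : ℕ) = i + 1) :
      SpRel K n q (FreeAlgebra.ι K (SpGen.sInv i hi) * FreeAlgebra.ι K (SpGen.s i i' 0)) 1
  | reflection (a b : Fin n × Fin n) (d : Fin 2 →₀ ℕ) :
      SpRel K n q (MvPowerSeries.coeff d (reflLHS q (spFreeS K n) a b))
        (MvPowerSeries.coeff d (reflRHS q (spFreeS K n) a b))

/-- The twisted q-Yangian `Y_q^tw(sp_n)`, for even `n`. -/
abbrev SpYangian (K : Type*) [Field K] (n : ℕ) (q : K) : Type _ :=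
  RingQuot (SpRel K n q)

/-- The matrix `S(u)` of generating series of `Y_q^tw(sp_n)`. -/
def spS (K : Type*) [Field K] (n : ℕ) (q : K) :
    Matrix (Fin n) (Fin n) (PowerSeries (SpYangian K n q)) :=
  fun i j => PowerSeries.mk fun r =>
    RingQuot.mkAlgHom K (SpRel K n q) (FreeAlgebra.ι K (SpGen.s i j r))

/-! ### The q-antisymmetrizer

`End(K^ι)^{⊗ m}` is the matrix algebra on `Fin m → ι`. -/

/-- The operator `T` acting on the tensor factor `a`. -/
def onSite {B ι : Type*} [Zero B] [DecidableEq ι] {m : ℕ} (a : Fin m) (T : Matrix ι ι B) :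
    Matrix (Fin m → ι) (Fin m → ι) B :=
  fun I J => if ∀ k, k ≠ a → I k = J k then T (I a) (J a) else 0

/-- The operator `T` acting on the tensor factors `a` and `b` (in this order). -/
def onPair {B ι : Type*} [Zero B] [DecidableEq ι] {m : ℕ} (a b : Fin m)
    (T : Matrix (ι × ι) (ι × ι) B) : Matrix (Fin m → ι) (Fin m → ι) B :=
  fun I J => if ∀ k, k ≠ a → k ≠ b → I k = J k then T (I a, I b) (J a, J b) else 0

/-- The number of inversions of a sequence. -/
def inversions {ι : Type*} [LinearOrder ι] {m : ℕ} (I : Fin m → ι) : ℕ :=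
  (Finset.univ.filter fun p : Fin m × Fin m => p.1 < p.2 ∧ I p.2 < I p.1).card

/-- The q-permutation operator
`P^q = ∑_i E_ii ⊗ E_ii + q ∑_{i > j} E_ij ⊗ E_ji + q⁻¹ ∑_{i < j} E_ij ⊗ E_ji`. -/
def qSwap {K ι : Type*} [Field K] [LinearOrder ι] (q : K) : Matrix (ι × ι) (ι × ι) K :=
  fun a b =>
    if a.1 = b.2 ∧ a.2 = b.1 then
      (if a.1 = a.2 then 1 else if a.2 < a.1 then q else q⁻¹)
    else 0

/-- The action `σ ↦ P_σ^q` of the symmetric group on `(K^ι)^{⊗ m}` in closed form. It is the action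
in which the adjacent transposition `s_k` acts as `P^q` on the factors `k, k + 1`: see `qPerm_mul`
and `qPerm_swap` below. -/
def qPerm {K ι : Type*} [Field K] [LinearOrder ι] {m : ℕ} (q : K) (σ : Equiv.Perm (Fin m)) :
    Matrix (Fin m → ι) (Fin m → ι) K :=
  fun I J => if I = J ∘ σ.symm then q ^ ((inversions I : ℤ) - (inversions J : ℤ)) else 0

theorem qPerm_mul {K ι : Type*} [Field K] [LinearOrder ι] [Fintype ι] {m : ℕ} {q : K}
    (hq : q ≠ 0) (σ τ : Equiv.Perm (Fin m)) :
    qPerm (ι := ι) q (σ * τ) = qPerm q σ * qPerm q τ := by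
  ext I J
  rw [Matrix.mul_apply, Finset.sum_eq_single (J ∘ τ.symm)]
  · have h : J ∘ (σ * τ).symm = (J ∘ τ.symm) ∘ σ.symm := rfl
    by_cases hI : I = J ∘ (σ * τ).symm
    · simp only [qPerm, h ▸ hI, if_true]
      rw [if_pos h.symm, ← zpow_add₀ hq]
      congr 1
      ring
    · simp only [qPerm, if_neg hI, if_neg (h ▸ hI), zero_mul]
  · intro L _ hL
    simp [qPerm, hL]
  · simp

theorem inversions_swap {ι : Type*} [LinearOrder ι] {m : ℕ} (J : Fin m → ι) (k l : Fin m)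
    (hkl : (l : ℕ) = k + 1) :
    inversions (J ∘ Equiv.swap k l) + (if J l < J k then 1 else 0)
      = inversions J + (if J k < J l then 1 else 0) := by
  have hmono : ∀ a b : Fin m, a < b → (a, b) ≠ (k, l) →
      Equiv.swap k l a < Equiv.swap k l b := by
    intro a b hab hne
    have hne' : ¬ (a = k ∧ b = l) := by simpa using hne
    simp only [Equiv.swap_apply_def]
    simp only [Fin.ext_iff] at hne' ⊢
    rw [Fin.lt_def] at hab ⊢
    split_ifs <;> omega
  have hne : ∀ a b : Fin m, a < b → (a, b) ≠ (k, l) →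
      (Equiv.swap k l a, Equiv.swap k l b) ≠ (k, l) := by
    intro a b hab _ h
    simp only [Prod.mk.injEq] at h
    have h1 : a = l := by rw [← Equiv.swap_apply_self k l a, h.1, Equiv.swap_apply_left]
    have h2 : b = k := by rw [← Equiv.swap_apply_self k l b, h.2, Equiv.swap_apply_right]
    subst h1 h2
    rw [Fin.lt_def] at hab
    omega
  have hlt : k < l := by rw [Fin.lt_def]; omega
  have key : ∀ L : Fin m → ι, inversions L =
      (Finset.univ.filter fun p : Fin m × Fin m =>
        p ≠ (k, l) ∧ p.1 < p.2 ∧ L p.2 < L p.1).card + (if L l < L k then 1 else 0) := by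
    intro L
    unfold inversions
    rw [← Finset.card_filter_add_card_filter_not (fun p : Fin m × Fin m => p ≠ (k, l)),
      Finset.filter_filter, Finset.filter_filter]
    congr 1
    · congr 1
      ext p
      simp only [Finset.mem_filter, Finset.mem_univ, true_and]
      tauto
    · split_ifs with h
      · rw [Finset.card_eq_one]
        refine ⟨(k, l), ?_⟩
        ext p
        simp only [Finset.mem_filter, Finset.mem_univ, true_and, Finset.mem_singleton, not_not]
        constructor
        · exact fun hp => hp.2
        · rintro rfl
          exact ⟨⟨hlt, h⟩, rfl⟩
      · rw [Finset.card_eq_zero, Finset.filter_eq_empty_iff]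
        rintro p _ ⟨⟨_, hp⟩, hp'⟩
        rw [not_not] at hp'
        subst hp'
        exact h hp
  have hcard : (Finset.univ.filter fun p : Fin m × Fin m =>
        p ≠ (k, l) ∧ p.1 < p.2 ∧ (J ∘ Equiv.swap k l) p.2 < (J ∘ Equiv.swap k l) p.1).card
      = (Finset.univ.filter fun p : Fin m × Fin m =>
        p ≠ (k, l) ∧ p.1 < p.2 ∧ J p.2 < J p.1).card := by
    refine Finset.card_bij' (fun p _ => (Equiv.swap k l p.1, Equiv.swap k l p.2))
      (fun p _ => (Equiv.swap k l p.1, Equiv.swap k l p.2)) ?_ ?_ ?_ ?_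
    · rintro ⟨a, b⟩ hp
      simp only [Finset.mem_filter, Finset.mem_univ, true_and] at hp ⊢
      exact ⟨hne a b hp.2.1 hp.1, hmono a b hp.2.1 hp.1, hp.2.2⟩
    · rintro ⟨a, b⟩ hp
      simp only [Finset.mem_filter, Finset.mem_univ, true_and] at hp ⊢
      refine ⟨hne a b hp.2.1 hp.1, hmono a b hp.2.1 hp.1, ?_⟩
      simpa using hp.2.2
    · rintro ⟨a, b⟩ _
      simp
    · rintro ⟨a, b⟩ _
      simp
  rw [key (J ∘ Equiv.swap k l), key J, hcard]
  simp only [Function.comp, Equiv.swap_apply_left, Equiv.swap_apply_right]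
  omega

theorem qPerm_swap {K ι : Type*} [Field K] [LinearOrder ι] {m : ℕ} (q : K)
    (k l : Fin m) (hkl : (l : ℕ) = k + 1) :
    qPerm (ι := ι) q (Equiv.swap k l) = onPair k l (qSwap q) := by
  have hne : k ≠ l := by
    intro h
    rw [h] at hkl
    omega
  ext I J
  simp only [qPerm, onPair, qSwap]
  by_cases hI : I = J ∘ (Equiv.swap k l).symm
  · have h := inversions_swap J k l hkl
    rw [Equiv.symm_swap] at hI
    rw [← hI] at h
    have hk : I k = J l := by simp [hI]
    have hl : I l = J k := by simp [hI]
    have hrest : ∀ j, j ≠ k → j ≠ l → I j = J j := by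
      intro j h1 h2
      simp [hI, Equiv.swap_apply_of_ne_of_ne h1 h2]
    rw [if_pos (by rw [Equiv.symm_swap]; exact hI), if_pos hrest, if_pos ⟨hk, hl⟩]
    simp only [hk, hl]
    rcases lt_trichotomy (J k) (J l) with hlt | heq | hgt
    · rw [if_neg hlt.ne', if_pos hlt]
      simp only [hlt, not_lt_of_gt hlt, if_true, if_false] at h
      have : (inversions I : ℤ) - inversions J = 1 := by omega
      rw [this, zpow_one]
    · rw [if_pos heq.symm]
      simp only [heq, lt_irrefl, if_false] at h
      have : (inversions I : ℤ) - inversions J = 0 := by omega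
      rw [this, zpow_zero]
    · rw [if_neg hgt.ne, if_neg (not_lt_of_gt hgt)]
      simp only [hgt, not_lt_of_gt hgt, if_true, if_false] at h
      have : (inversions I : ℤ) - inversions J = -1 := by omega
      rw [this, zpow_neg_one]
  · rw [if_neg hI]
    split_ifs with h1 h2 <;> try rfl
    all_goals
      exfalso
      apply hI
      funext j
      by_cases hjk : j = k
      · subst hjk
        simpa using h2.1
      · by_cases hjl : j = l
        · subst hjl
          simpa using h2.2
        · simpa [Equiv.swap_apply_of_ne_of_ne hjk hjl] using h1 j hjk hjl

/-- The q-antisymmetrizer `A_m^q = (1/m!) ∑_σ sgn(σ) P_σ^q`. -/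
def qAntisymmetrizer {K : Type*} [Field K] (ι : Type*) [LinearOrder ι] (q : K) (m : ℕ) :
    Matrix (Fin m → ι) (Fin m → ι) K :=
  ((m.factorial : K)⁻¹) •
    ∑ σ : Equiv.Perm (Fin m), ((Equiv.Perm.sign σ : ℤ) : K) • qPerm q σ

/-! ### Sklyanin minors and determinants -/

/-- The series `f(c u)`, for a series `f(u)` in `u⁻¹`. -/
def rescaleArg {K A : Type*} [Field K] [Ring A] [Algebra K A] (c : K) (f : PowerSeries A) :
    PowerSeries A :=
  PowerSeries.mk fun r => (c⁻¹) ^ r • PowerSeries.coeff r f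

/-- The partial transpose of `R(x, 1) / (x - 1)`, for a power series `x` in `u⁻¹` without constant
term. -/
def rBarT {K ι : Type*} [Field K] [LinearOrder ι] (q : K) (x : PowerSeries K) :
    Matrix (ι × ι) (ι × ι) (PowerSeries K) :=
  (x - 1)⁻¹ • partialTranspose (rMatrix q x 1)

/-- With `u_a = q^(-2a) u`, `a = 0, …, m - 1`, the element
`⟨S₁, …, S_m⟩ = S₁(u₁) (R̄ᵗ₁₂ ⋯ R̄ᵗ₁ₘ) S₂(u₂) (R̄ᵗ₂₃ ⋯ R̄ᵗ₂ₘ) ⋯ Sₘ(uₘ)`,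
where `R̄ᵗ_ab` is taken at `u_a⁻¹ u_b⁻¹ = q^(2(a+b)) u⁻²`. -/
def sklyaninBracket {K ι A : Type*} [Field K] [LinearOrder ι] [Fintype ι] [Ring A] [Algebra K A]
    (q : K) (m : ℕ) (S : Matrix ι ι (PowerSeries A)) :
    Matrix (Fin m → ι) (Fin m → ι) (PowerSeries A) :=
  ((List.finRange m).map fun a =>
    onSite a (S.map (rescaleArg (q ^ (-2 * (a : ℤ))))) *
      (((List.finRange m).filter fun b => a < b).map fun b =>
        onPair a b ((rBarT q
          (PowerSeries.C (q ^ (2 * ((a : ℕ) + (b : ℕ)))) * PowerSeries.X ^ 2)).map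
            (PowerSeries.map (algebraMap K A)))).prod).prod

/-- The Sklyanin minor `s^{I}_{J}(u)`: `m!` times the coefficient of `E_{i₁j₁} ⊗ ⋯ ⊗ E_{iₘjₘ}` in
`A_m^q ⟨S₁, …, S_m⟩`. -/
def sklyaninMinor {K ι A : Type*} [Field K] [LinearOrder ι] [Fintype ι] [Ring A] [Algebra K A]
    (q : K) {m : ℕ} (S : Matrix ι ι (PowerSeries A)) (I J : Fin m → ι) : PowerSeries A :=
  m.factorial •
    (((qAntisymmetrizer ι q m).map fun c => PowerSeries.C (algebraMap K A c)) *
      sklyaninBracket q m S) I J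

/-- The Sklyanin determinant `sdet_q S(u)`, a series in `u⁻¹`: the Sklyanin minor with rows
`1, …, n` and columns `1, …, n`. -/
def sdet {K A : Type*} [Field K] [Ring A] [Algebra K A] (q : K) {n : ℕ}
    (S : Matrix (Fin n) (Fin n) (PowerSeries A)) : PowerSeries A :=
  sklyaninMinor q S id id

/-! ### Blocks -/

/-- The upper left block `S₁₁(u)`, of size `N × N`. -/
def block11 {B : Type*} {N M : ℕ} (S : Matrix (Fin (N + M)) (Fin (N + M)) B) :
    Matrix (Fin N) (Fin N) B :=
  S.submatrix (Fin.castAdd M) (Fin.castAdd M)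

/-- The upper right block `S₁₂(u)`, of size `N × M`. -/
def block12 {B : Type*} {N M : ℕ} (S : Matrix (Fin (N + M)) (Fin (N + M)) B) :
    Matrix (Fin N) (Fin M) B :=
  S.submatrix (Fin.castAdd M) (Fin.natAdd N)

/-- The lower left block `S₂₁(u)`, of size `M × N`. -/
def block21 {B : Type*} {N M : ℕ} (S : Matrix (Fin (N + M)) (Fin (N + M)) B) :
    Matrix (Fin M) (Fin N) B :=
  S.submatrix (Fin.natAdd N) (Fin.castAdd M)

/-- The lower right block `S₂₂(u)`, of size `M × M`. -/
def block22 {B : Type*} {N M : ℕ} (S : Matrix (Fin (N + M)) (Fin (N + M)) B) :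
    Matrix (Fin M) (Fin M) B :=
  S.submatrix (Fin.natAdd N) (Fin.natAdd N)

/-- `S₂₂(u) - S₂₁(u) S₁₁(u)⁻¹ S₁₂(u)` (meaningful when `S₁₁(u)` is invertible). -/
def schur22 {B : Type*} [Ring B] {N M : ℕ} (S : Matrix (Fin (N + M)) (Fin (N + M)) B) :
    Matrix (Fin M) (Fin M) B :=
  block22 S - block21 S * Ring.inverse (block11 S) * block12 S

/-- `S₁₁(u) - S₁₂(u) S₂₂(u)⁻¹ S₂₁(u)` (meaningful when `S₂₂(u)` is invertible). -/
def schur11 {B : Type*} [Ring B] {N M : ℕ} (S : Matrix (Fin (N + M)) (Fin (N + M)) B) :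
    Matrix (Fin N) (Fin N) B :=
  block11 S - block12 S * Ring.inverse (block22 S) * block21 S

end TwistedQYangian

end

open TwistedQYangian

noncomputable section

namespace TwistedQYangian

set_option linter.unusedSectionVars false

/-! ### Ordered products over lists of sites -/

section ListBracket

variable {M N κ κ' : Type*} [Monoid M] [Monoid N]

/-! Let `η` be the row vector `qEta`: the row of `n! A_n^q` with index `(1, …, n)`. On `n` tensor
factors of dimension `n`, a row vector `w` with `w P = -w` for every adjacent q-permutation operator
`P` is determined by its entry at `id`, hence is a multiple of `η` (`IsQAntisymm.eq_mul_qEta`). At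
`u/v = q²` the R-matrix is proportional to `1 - P`; the reflection equation there
(`reflection_core`) and a Yang-Baxter equation for `R̄ᵗ` (`yangBaxter_siteT`) give `(1 - P) ⟨S⟩ = X'
(1 - P)` for some `X'`. So `η ⟨S⟩` is again antisymmetric, and `η ⟨S⟩ = sdet S · η`.

Let `f`, `g` list the indices of the two diagonal blocks, of sizes `a` and `b`. Cutting the bracket
after the first `a` sites gives `⟨S⟩ = X₁ C X₂`, where `C` collects the `R̄ᵗ` between the two groups
of sites, so `η X₁ C = sdet S · η X₂⁻¹`. Now compare the entries in the column `(f, g)`. There `C`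
acts trivially, since `R̄ᵗ` fixes `e_i ⊗ e_j` for `i ≠ j`, and the left side becomes `η_(f,g) · sdet
S_ff`. On the right only the block of `X₂⁻¹` over the indices `g` is seen. The exchange relation
passes from the bracket to its inverse and then to this block (`restrict_siteBracketInv_swap`), so
the block acts on the small `η` by a scalar `g₀`, and `sdet S_ff = sdet S · g₀`. The reflection
equation for the Schur complement is never needed.

It remains to identify `g₀`. The block of a product is the product of the blocks here, because of
the sparsity of `R̄ᵗ` and of its inverse (`CornerData`, `cornerData`). The matrix factors of the
block of `X₂⁻¹` are values of `(S⁻¹)_gg`, a left inverse of the Schur complement `Z`. The inverse of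
the `n`-dimensional `R̄ᵗ(x)` is given by a formula in `w = q^(-2n) x` that does not otherwise
involve `n` and is invariant under translation of the indices. Its restriction to `b` consecutive
indices is therefore the inverse of the `b`-dimensional `R̄ᵗ(q^(2b) w) = R̄ᵗ(q^(-2a) x)`. Thus the
block is inverse to a bracket with `Z` taken at `q^(-2(a+i)) u` but `R̄ᵗ` at `q^(2(a+i+j)) u⁻²`,
which is the bracket of `Z(q^(-a) ·)` in the variable `q^(-a) u`. Hence `g₀` is a left inverse of
the second factor, and the product formula follows (`sdet_eq_mul_sdet_schur`).

Invertibility is a matter of constant terms. In the orthogonal case these are lower unitriangular.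
In the symplectic case they are lower triangular in `2 × 2` blocks, and a block is invertible
because its upper right entry is a unit and the q-commutation of its first row
(`constantTerm_qcomm`) together with the block relation makes the Schur complement of that entry a
unit. -/

/-- The ordered product `s a₁ (t a₁ a₂ ⋯ t a₁ aₘ) s a₂ (t a₂ a₃ ⋯ t a₂ aₘ) ⋯ s aₘ`. -/
def listBracket (s : κ → M) (t : κ → κ → M) : List κ → M
  | [] => 1
  | a :: l => s a * (l.map (t a)).prod * listBracket s t l

/-- The same ordered product read from right to left. -/
def listBracketRev (s : κ → M) (t : κ → κ → M) : List κ → M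
  | [] => 1
  | a :: l => listBracketRev s t l * ((l.map (t a)).reverse.prod * s a)

/-- The product of all `t a b` with `a` in the first and `b` in the second list. -/
def listCross (t : κ → κ → M) : List κ → List κ → M
  | [], _ => 1
  | a :: l, l' => (l'.map (t a)).prod * listCross t l l'

theorem listBracket_map_hom (φ : M →* N) (s : κ → M) (t : κ → κ → M) (l : List κ) :
    φ (listBracket s t l) = listBracket (fun a => φ (s a)) (fun a b => φ (t a b)) l := by
  induction l with
  | nil => simp [listBracket]
  | cons a l ih => simp [listBracket, ih, map_list_prod, Function.comp_def]

theorem listBracket_map_list (f : κ' → κ) (s : κ → M) (t : κ → κ → M) (l : List κ') :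
    listBracket s t (l.map f)
      = listBracket (fun a => s (f a)) (fun a b => t (f a) (f b)) l := by
  induction l with
  | nil => simp [listBracket]
  | cons a l ih => simp [listBracket, ih, Function.comp_def]

theorem listBracket_congr {s s' : κ → M} {t t' : κ → κ → M} {l : List κ}
    (hs : ∀ a ∈ l, s a = s' a) (ht : ∀ a ∈ l, ∀ b ∈ l, t a b = t' a b) :
    listBracket s t l = listBracket s' t' l := by
  induction l with
  | nil => rfl
  | cons a l ih =>
    simp only [listBracket]
    rw [hs a (by simp), ih (fun c hc => hs c (by simp [hc]))
      (fun c hc d hd => ht c (by simp [hc]) d (by simp [hd])),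
      List.map_congr_left fun b hb => ht a (by simp) b (by simp [hb])]

/-- For an increasing list, `listBracket` is the product over `a` of `s a` times the product of the
`t a b` with `a < b`. -/
theorem prod_map_filter_lt_eq_listBracket [LinearOrder κ] (s : κ → M) (t : κ → κ → M)
    (l : List κ) (hl : l.Pairwise (· < ·)) :
    (l.map fun a => s a * ((l.filter fun b => a < b).map fun b => t a b).prod).prod
      = listBracket s t l := by
  induction l with
  | nil => rfl
  | cons a l ih =>
    rw [List.pairwise_cons] at hl
    have h1 : (a :: l).filter (fun b => a < b) = l := by
      rw [List.filter_cons_of_neg (by simp)]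
      exact List.filter_eq_self.2 fun b hb => by simpa using hl.1 b hb
    rw [List.map_cons, List.prod_cons, h1, listBracket, ← ih hl.2]
    congr 2
    refine List.map_congr_left fun c hc => ?_
    rw [List.filter_cons_of_neg (by simpa using (hl.1 c hc).le)]

theorem commute_prod_map {x : M} {f : κ → M} {l : List κ} (h : ∀ b ∈ l, Commute x (f b)) :
    Commute x (l.map f).prod :=
  Commute.list_prod_right _ _ (by simpa using h)

theorem commute_listBracket {x : M} {s : κ → M} {t : κ → κ → M} {l : List κ} (hl : l.Nodup)
    (hs : ∀ a ∈ l, Commute x (s a)) (ht : ∀ a ∈ l, ∀ b ∈ l, a ≠ b → Commute x (t a b)) :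
    Commute x (listBracket s t l) := by
  induction l with
  | nil => exact Commute.one_right x
  | cons a l ih =>
    rw [List.nodup_cons] at hl
    refine ((hs a (by simp)).mul_right (commute_prod_map fun b hb => ht a (by simp) b ?_ ?_)).mul_right
      (ih hl.2 (fun c hc => hs c ?_) (fun c hc d hd => ht c ?_ d ?_))
    · simp [hb]
    · rintro rfl; exact hl.1 hb
    all_goals simp_all

theorem commute_listBracketRev {x : M} {s : κ → M} {t : κ → κ → M} {l : List κ} (hl : l.Nodup)
    (hs : ∀ a ∈ l, Commute x (s a)) (ht : ∀ a ∈ l, ∀ b ∈ l, a ≠ b → Commute x (t a b)) :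
    Commute x (listBracketRev s t l) := by
  induction l with
  | nil => exact Commute.one_right x
  | cons a l ih =>
    rw [List.nodup_cons] at hl
    refine (ih hl.2 (fun c hc => hs c (by simp [hc]))
      (fun c hc d hd => ht c (by simp [hc]) d (by simp [hd]))).mul_right
      (Commute.mul_right (Commute.list_prod_right _ _ ?_) (hs a (by simp)))
    simp only [List.mem_reverse, List.mem_map, forall_exists_index, and_imp]
    rintro _ b hb rfl
    exact ht a (by simp) b (by simp [hb]) (by rintro rfl; exact hl.1 hb)

/-- Compatibility conditions for families of operators `s a`, `t a b`: operators acting on disjoint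
sets of sites commute, except possibly for `s a` and `s b`. -/
structure SiteLocal (s : κ → M) (t : κ → κ → M) : Prop where
  st : ∀ a b c, a ≠ b → a ≠ c → b ≠ c → Commute (s a) (t b c)
  tt : ∀ a b c d, a ≠ b → c ≠ d → a ≠ c → a ≠ d → b ≠ c → b ≠ d → Commute (t a b) (t c d)

/-- The factors `t a b` with `a` in `l` and `b` in `l'` commute with everything that involves only
later sites of `l`, so they can be pushed to the right until all of `l` has been written. -/
theorem listBracket_append {s : κ → M} {t : κ → κ → M} (h : SiteLocal s t) {l l' : List κ}
    (hl : (l ++ l').Nodup) :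
    listBracket s t (l ++ l') = listBracket s t l * listCross t l l' * listBracket s t l' := by
  induction l with
  | nil => simp [listBracket, listCross]
  | cons a l ih =>
    rw [List.cons_append, List.nodup_cons] at hl
    have key : Commute (l'.map (t a)).prod (listBracket s t l) := by
      refine (commute_listBracket (List.nodup_append.1 hl.2).1 (fun c hc => ?_)
        (fun c hc d hd hcd => ?_))
      · refine (commute_prod_map fun b hb => ?_).symm
        have hcb : c ≠ b := (List.nodup_append.1 hl.2).2.2 c hc b hb
        refine h.st c a b ?_ hcb ?_ <;> rintro rfl <;> simp_all
      · refine (commute_prod_map fun b hb => ?_).symm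
        have hcb : c ≠ b := (List.nodup_append.1 hl.2).2.2 c hc b hb
        have hdb : d ≠ b := (List.nodup_append.1 hl.2).2.2 d hd b hb
        refine h.tt c d a b hcd ?_ ?_ hcb ?_ hdb <;> rintro rfl <;> simp_all
    simp only [List.cons_append, listBracket, listCross, List.map_append, List.prod_append,
      ih hl.2]
    calc s a * ((l.map (t a)).prod * (l'.map (t a)).prod) *
          (listBracket s t l * listCross t l l' * listBracket s t l')
        = s a * (l.map (t a)).prod * ((l'.map (t a)).prod * listBracket s t l)
          * listCross t l l' * listBracket s t l' := by simp only [mul_assoc]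
      _ = _ := by rw [key.eq]; simp only [mul_assoc]

/-- The two products can be interleaved into pairs `t k j * t k' j`, since `t k i` and `t k' j` with
`i ≠ j` act on disjoint sites; `g` then crosses one pair at a time. -/
theorem mul_prod_mul_prod_swap {s : κ → M} {t : κ → κ → M} (h : SiteLocal s t) {g : M}
    {k k' : κ} (hk : k ≠ k') {l : List κ} (hl : l.Nodup) (hkl : k ∉ l) (hkl' : k' ∉ l)
    (hg : ∀ j ∈ l, g * (t k j * t k' j) = t k' j * t k j * g) :
    g * ((l.map (t k)).prod * (l.map (t k')).prod)
      = (l.map (t k')).prod * (l.map (t k)).prod * g := by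
  have comm : ∀ (a b j : κ) (l : List κ), a ≠ b → j ∉ l → a ∉ l → b ∉ l → j ≠ a → j ≠ b →
      Commute (l.map (t a)).prod (t b j) := by
    intro a b j l hab hj ha hb hja hjb
    refine (commute_prod_map fun c hc => ?_).symm
    have hcj : c ≠ j := by rintro rfl; exact hj hc
    have hca : c ≠ a := by rintro rfl; exact ha hc
    have hcb : c ≠ b := by rintro rfl; exact hb hc
    exact h.tt b j a c hjb.symm hca.symm hab.symm hcb.symm hja hcj.symm
  induction l with
  | nil => simp
  | cons j l ih =>
    rw [List.nodup_cons] at hl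
    simp only [List.mem_cons, not_or] at hkl hkl'
    have h1 := comm k k' j l hk hl.1 hkl.2 hkl'.2 (Ne.symm hkl.1) (Ne.symm hkl'.1)
    have h2 := comm k' k j l hk.symm hl.1 hkl'.2 hkl.2 (Ne.symm hkl'.1) (Ne.symm hkl.1)
    have ih' := ih hl.2 hkl.2 hkl'.2 fun j hj => hg j (by simp [hj])
    simp only [List.map_cons, List.prod_cons]
    calc g * (t k j * (l.map (t k)).prod * (t k' j * (l.map (t k')).prod))
        = g * (t k j * ((l.map (t k)).prod * t k' j) * (l.map (t k')).prod) := by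
          simp only [mul_assoc]
      _ = g * (t k j * t k' j) * ((l.map (t k)).prod * (l.map (t k')).prod) := by
          rw [h1.eq]; simp only [mul_assoc]
      _ = t k' j * t k j * (g * ((l.map (t k)).prod * (l.map (t k')).prod)) := by
          rw [hg j (by simp)]; simp only [mul_assoc]
      _ = t k' j * (t k j * (l.map (t k')).prod) * (l.map (t k)).prod * g := by
          rw [ih']; simp only [mul_assoc]
      _ = _ := by rw [← h2.eq]; simp only [mul_assoc]

/-- If `g` exchanges the sites `k` and `k'`, then it exchanges them in `listBracket`. -/
theorem mul_listBracket_swap {s : κ → M} {t : κ → κ → M} (h : SiteLocal s t) {g : M}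
    {k k' : κ} (ht : t k' k = t k k')
    (hgs : ∀ c, c ≠ k → c ≠ k' → Commute g (s c))
    (hgt : ∀ c d, c ≠ d → c ≠ k → c ≠ k' → d ≠ k → d ≠ k' → Commute g (t c d))
    (core : g * (s k * t k k' * s k') = s k' * t k k' * s k * g)
    {l l' : List κ} (hl : (l ++ k :: k' :: l').Nodup)
    (h₁ : ∀ i ∈ l, g * (t i k * t i k') = t i k' * t i k * g)
    (h₂ : ∀ j ∈ l', g * (t k j * t k' j) = t k' j * t k j * g) :
    g * listBracket s t (l ++ k :: k' :: l') = listBracket s t (l ++ k' :: k :: l') * g := by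
  induction l with
  -- The pair heads the list: `core` exchanges its two sites, and `h₂` carries `g` through the
  -- factors that link them to later sites.
  | nil =>
    simp only [List.nil_append, List.nodup_cons, List.mem_cons, not_or] at hl
    obtain ⟨⟨hk, hkl⟩, hkl', hl⟩ := hl
    have c1 : Commute (s k') (l'.map (t k)).prod := commute_prod_map fun b hb =>
      h.st _ _ _ (Ne.symm hk) (by rintro rfl; exact hkl' hb) (by rintro rfl; exact hkl hb)
    have c2 : Commute (s k) (l'.map (t k')).prod := commute_prod_map fun b hb =>
      h.st _ _ _ hk (by rintro rfl; exact hkl hb) (by rintro rfl; exact hkl' hb)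
    have c3 : Commute g (listBracket s t l') := by
      refine commute_listBracket hl (fun a ha => hgs a ?_ ?_)
        (fun a ha b hb hab => hgt a b hab ?_ ?_ ?_ ?_) <;> rintro rfl <;> contradiction
    have hswap := mul_prod_mul_prod_swap h hk hl hkl hkl' h₂
    simp only [List.nil_append, listBracket, List.map_cons, List.prod_cons, ht]
    calc g * (s k * (t k k' * (l'.map (t k)).prod) *
          (s k' * (l'.map (t k')).prod * listBracket s t l'))
        = g * (s k * t k k' * ((l'.map (t k)).prod * s k')) * (l'.map (t k')).prod
            * listBracket s t l' := by simp only [mul_assoc]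
      _ = (g * (s k * t k k' * s k')) * ((l'.map (t k)).prod * (l'.map (t k')).prod)
            * listBracket s t l' := by rw [← c1.eq]; simp only [mul_assoc]
      _ = s k' * t k k' * s k * (g * ((l'.map (t k)).prod * (l'.map (t k')).prod))
            * listBracket s t l' := by rw [core]; simp only [mul_assoc]
      _ = s k' * t k k' * (s k * (l'.map (t k')).prod) * (l'.map (t k)).prod
            * (g * listBracket s t l') := by rw [hswap]; simp only [mul_assoc]
      _ = _ := by rw [c2.eq, c3.eq]; simp only [mul_assoc]
  -- An earlier site `i` meets the pair only in `t i k * t i k'`, which `h₁` handles; all its other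
  -- factors commute with `g`.
  | cons i l ih =>
    rw [List.cons_append, List.nodup_cons] at hl
    have hi := hl.1
    simp only [List.mem_append, List.mem_cons, not_or] at hi
    obtain ⟨hil, hik, hik', hil'⟩ := hi
    have hkl : k ∉ l := fun hk => (List.nodup_append.1 hl.2).2.2 k hk k (by simp) rfl
    have hkl' : k' ∉ l := fun hk => (List.nodup_append.1 hl.2).2.2 k' hk k' (by simp) rfl
    have hn := (List.nodup_append.1 hl.2).2.1
    simp only [List.nodup_cons, List.mem_cons, not_or] at hn
    have comm : ∀ l₀ : List κ, i ∉ l₀ → k ∉ l₀ → k' ∉ l₀ → Commute g (l₀.map (t i)).prod := by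
      intro l₀ h0 h1 h2
      refine commute_prod_map fun b hb => hgt i b ?_ hik hik' ?_ ?_ <;> rintro rfl <;> contradiction
    have c1 := comm l hil hkl hkl'
    have c2 := comm l' hil' hn.1.2 hn.2.1
    have ih' := ih hl.2 fun i hi => h₁ i (by simp [hi])
    simp only [List.cons_append, listBracket, List.map_append, List.map_cons, List.prod_append,
      List.prod_cons]
    calc g * (s i * ((l.map (t i)).prod * (t i k * (t i k' * (l'.map (t i)).prod))) *
          listBracket s t (l ++ k :: k' :: l'))
        = (g * s i) * (l.map (t i)).prod * (t i k * t i k') * (l'.map (t i)).prod *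
          listBracket s t (l ++ k :: k' :: l') := by simp only [mul_assoc]
      _ = s i * (g * (l.map (t i)).prod) * (t i k * t i k') * (l'.map (t i)).prod *
          listBracket s t (l ++ k :: k' :: l') := by
          rw [(hgs i hik hik').eq]; simp only [mul_assoc]
      _ = s i * (l.map (t i)).prod * (g * (t i k * t i k')) * (l'.map (t i)).prod *
          listBracket s t (l ++ k :: k' :: l') := by rw [c1.eq]; simp only [mul_assoc]
      _ = s i * (l.map (t i)).prod * (t i k' * t i k) * (g * (l'.map (t i)).prod) *
          listBracket s t (l ++ k :: k' :: l') := by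
          rw [h₁ i (by simp)]; simp only [mul_assoc]
      _ = s i * (l.map (t i)).prod * (t i k' * t i k) * (l'.map (t i)).prod *
          (g * listBracket s t (l ++ k :: k' :: l')) := by rw [c2.eq]; simp only [mul_assoc]
      _ = _ := by rw [ih']; simp only [mul_assoc]

theorem prod_map_reverse_mul_prod_map {f f' : κ → M} {l : List κ}
    (h : ∀ b ∈ l, f' b * f b = 1) : (l.map f').reverse.prod * (l.map f).prod = 1 := by
  induction l with
  | nil => simp
  | cons b l ih =>
    simp only [List.map_cons, List.reverse_cons, List.prod_append, List.prod_cons, List.prod_nil,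
      mul_one]
    rw [mul_assoc, ← mul_assoc (f' b), h b (by simp), one_mul, ih fun c hc => h c (by simp [hc])]

theorem prod_map_mul_prod_map_reverse {f f' : κ → M} {l : List κ}
    (h : ∀ b ∈ l, f b * f' b = 1) : (l.map f).prod * (l.map f').reverse.prod = 1 := by
  induction l with
  | nil => simp
  | cons b l ih =>
    simp only [List.map_cons, List.reverse_cons, List.prod_append, List.prod_cons, List.prod_nil,
      mul_one]
    rw [mul_assoc, ← mul_assoc (l.map f).prod, ih fun c hc => h c (by simp [hc]), one_mul,
      h b (by simp)]

theorem listBracketRev_mul_listBracket {s s' : κ → M} {t t' : κ → κ → M} {l : List κ}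
    (hl : l.Nodup) (hs : ∀ a ∈ l, s' a * s a = 1)
    (ht : ∀ a ∈ l, ∀ b ∈ l, a ≠ b → t' a b * t a b = 1) :
    listBracketRev s' t' l * listBracket s t l = 1 := by
  induction l with
  | nil => simp [listBracket, listBracketRev]
  | cons a l ih =>
    rw [List.nodup_cons] at hl
    have h1 : (l.map (t' a)).reverse.prod * (l.map (t a)).prod = 1 :=
      prod_map_reverse_mul_prod_map fun b hb => ht a (by simp) b (by simp [hb])
        (by rintro rfl; exact hl.1 hb)
    have h2 := ih hl.2 (fun c hc => hs c (by simp [hc]))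
      (fun c hc d hd => ht c (by simp [hc]) d (by simp [hd]))
    simp only [listBracket, listBracketRev]
    calc listBracketRev s' t' l * ((l.map (t' a)).reverse.prod * s' a) *
          (s a * (l.map (t a)).prod * listBracket s t l)
        = listBracketRev s' t' l * ((l.map (t' a)).reverse.prod * (s' a * s a)
          * (l.map (t a)).prod) * listBracket s t l := by simp only [mul_assoc]
      _ = 1 := by rw [hs a (by simp), mul_one, h1, mul_one, h2]

theorem listBracket_mul_listBracketRev {s s' : κ → M} {t t' : κ → κ → M} {l : List κ}
    (hl : l.Nodup) (hs : ∀ a ∈ l, s a * s' a = 1)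
    (ht : ∀ a ∈ l, ∀ b ∈ l, a ≠ b → t a b * t' a b = 1) :
    listBracket s t l * listBracketRev s' t' l = 1 := by
  induction l with
  | nil => simp [listBracket, listBracketRev]
  | cons a l ih =>
    rw [List.nodup_cons] at hl
    have h1 : (l.map (t a)).prod * (l.map (t' a)).reverse.prod = 1 :=
      prod_map_mul_prod_map_reverse fun b hb => ht a (by simp) b (by simp [hb])
        (by rintro rfl; exact hl.1 hb)
    have h2 := ih hl.2 (fun c hc => hs c (by simp [hc]))
      (fun c hc d hd => ht c (by simp [hc]) d (by simp [hd]))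
    simp only [listBracket, listBracketRev]
    calc s a * (l.map (t a)).prod * listBracket s t l *
          (listBracketRev s' t' l * ((l.map (t' a)).reverse.prod * s' a))
        = s a * ((l.map (t a)).prod * (listBracket s t l * listBracketRev s' t' l)
          * (l.map (t' a)).reverse.prod) * s' a := by simp only [mul_assoc]
      _ = 1 := by rw [h2, mul_one, h1, mul_one, hs a (by simp)]

end ListBracket

/-! ### Restriction to a block -/

section Corner

variable {κ Ω Ω' B : Type*} [Ring B] [Fintype Ω] [DecidableEq Ω] [Fintype Ω'] [DecidableEq Ω']

/-- Restricting operators on `Ω` to `Ω'` along `G`, with section `G'`: the operators `s a` and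
`t a b` restrict to `s' a` and `t' a b` once they are suitably cut off by the projections `π a`. -/
structure CornerData (G : Matrix Ω' Ω B) (G' : Matrix Ω Ω' B) (π : κ → Matrix Ω Ω B)
    (s : κ → Matrix Ω Ω B) (t y : κ → κ → Matrix Ω Ω B)
    (s' : κ → Matrix Ω' Ω' B) (t' : κ → κ → Matrix Ω' Ω' B) : Prop where
  G_mul_G' : G * G' = 1
  G_mul_π : ∀ a, G * π a = G
  π_mul_G' : ∀ a, π a * G' = G'
  idem : ∀ a, π a * π a = π a
  ππ : ∀ a b, Commute (π a) (π b)
  sπ : ∀ a b, a ≠ b → Commute (s a) (π b)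
  tπ : ∀ a b c, a ≠ b → c ≠ a → c ≠ b → Commute (t a b) (π c)
  corner : ∀ a b, a ≠ b → π b * t a b * π a = y a b
  corner' : ∀ a b, a ≠ b → π a * t a b * π b = y a b
  π_mul_y : ∀ a b, a ≠ b → π a * y a b = y a b
  y_mul_π : ∀ a b, a ≠ b → y a b * π a = y a b
  G_mul_s : ∀ a, G * (π a * s a * π a) = s' a * G
  s_mul_G' : ∀ a, (π a * s a * π a) * G' = G' * s' a
  G_mul_y : ∀ a b, a ≠ b → G * y a b = t' a b * G
  y_mul_G' : ∀ a b, a ≠ b → y a b * G' = G' * t' a b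

variable {G : Matrix Ω' Ω B} {G' : Matrix Ω Ω' B} {π : κ → Matrix Ω Ω B}
  {s : κ → Matrix Ω Ω B} {t y : κ → κ → Matrix Ω Ω B}
  {s' : κ → Matrix Ω' Ω' B} {t' : κ → κ → Matrix Ω' Ω' B}

/-- Restriction to `Ω'` is not multiplicative in general; the projections make it so here. `G`
absorbs `π b` for the later sites `b`, and these commute with `s a`. `G'` absorbs `π a`, which
commutes with the bracket over the later sites. Each `t a b` can thus be enclosed as `π b * t a b *
π a = y a b`, which does restrict. -/
theorem CornerData.mul_listBracket_mul (h : CornerData G G' π s t y s' t') {l : List κ}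
    (hl : l.Nodup) : G * listBracket s t l * G' = listBracket s' t' l := by
  have π_mul : ∀ (a : κ) (l : List κ), a ∉ l →
      π a * ((l.map (y a)).prod * π a) = (l.map (y a)).prod * π a := by
    intro a l hal
    cases l with
    | nil => simp [h.idem]
    | cons b l =>
      have : a ≠ b := by rintro rfl; simp at hal
      rw [List.map_cons, List.prod_cons, mul_assoc, ← mul_assoc (π a), h.π_mul_y a b this]
  -- The factors are cut off from right to left: once the tail consists of `y`'s, it begins with its
  -- own `π a`, which is what the next `t a b` needs on its right.
  have cut : ∀ (a : κ) (l : List κ), l.Nodup → a ∉ l →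
      (l.map π).prod * (l.map (t a)).prod * π a = (l.map (y a)).prod * π a := by
    intro a l
    induction l with
    | nil => simp
    | cons b l ih =>
      intro hl hal
      rw [List.nodup_cons] at hl
      simp only [List.mem_cons, not_or] at hal
      have c : Commute (t a b) (l.map π).prod := commute_prod_map fun c hc =>
        h.tπ a b c hal.1 (by rintro rfl; exact hal.2 hc) (by rintro rfl; exact hl.1 hc)
      simp only [List.map_cons, List.prod_cons]
      calc π b * (l.map π).prod * (t a b * (l.map (t a)).prod) * π a
          = π b * ((l.map π).prod * t a b) * (l.map (t a)).prod * π a := by simp only [mul_assoc]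
        _ = π b * t a b * ((l.map π).prod * (l.map (t a)).prod * π a) := by
          rw [← c.eq]; simp only [mul_assoc]
        _ = π b * t a b * (π a * ((l.map (y a)).prod * π a)) := by
          rw [ih hl.2 hal.2, π_mul a l hal.2]
        _ = (π b * t a b * π a) * ((l.map (y a)).prod * π a) := by simp only [mul_assoc]
        _ = _ := by rw [h.corner a b hal.1]; simp only [mul_assoc]
  have G_prod : ∀ l : List κ, G * (l.map π).prod = G := by
    intro l
    induction l with
    | nil => simp
    | cons b l ih => rw [List.map_cons, List.prod_cons, ← Matrix.mul_assoc, h.G_mul_π, ih]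
  have G_prod_y : ∀ (a : κ) (l : List κ), a ∉ l →
      G * (l.map (y a)).prod = (l.map (t' a)).prod * G := by
    intro a l
    induction l with
    | nil => simp
    | cons b l ih =>
      intro hal
      simp only [List.mem_cons, not_or] at hal
      rw [List.map_cons, List.prod_cons, ← Matrix.mul_assoc, h.G_mul_y a b hal.1,
        Matrix.mul_assoc, ih hal.2, List.map_cons, List.prod_cons, Matrix.mul_assoc]
  induction l with
  | nil => simp [listBracket, h.G_mul_G']
  | cons a l ih =>
    rw [List.nodup_cons] at hl
    have c1 : Commute (s a) (l.map π).prod := commute_prod_map fun c hc =>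
        h.sπ a c (by rintro rfl; exact hl.1 hc)
    have c2 : Commute (π a) (listBracket s t l) := by
      refine commute_listBracket hl.2 (fun c hc => (h.sπ c a ?_).symm)
        (fun c hc d hd hcd => (h.tπ c d a hcd ?_ ?_).symm) <;> rintro rfl <;> exact hl.1 ‹_›
    have main : G * (s a * (l.map (t a)).prod * π a) = s' a * (l.map (t' a)).prod * G := by
      calc G * (s a * (l.map (t a)).prod * π a)
          = G * (l.map π).prod * (s a * (l.map (t a)).prod * π a) := by rw [G_prod]
        _ = G * (((l.map π).prod * s a) * (l.map (t a)).prod * π a) := by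
          simp only [Matrix.mul_assoc]
        _ = G * (s a * ((l.map π).prod * (l.map (t a)).prod * π a)) := by
          rw [← c1.eq]; simp only [Matrix.mul_assoc]
        _ = G * π a * (s a * (π a * ((l.map (y a)).prod * π a))) := by
          rw [cut a l hl.2 hl.1, h.G_mul_π, π_mul a l hl.1]
        _ = G * (π a * s a * π a) * (l.map (y a)).prod * π a := by simp only [Matrix.mul_assoc]
        _ = s' a * (G * (l.map (y a)).prod) * π a := by
          rw [h.G_mul_s]; simp only [Matrix.mul_assoc]
        _ = s' a * (l.map (t' a)).prod * (G * π a) := by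
          rw [G_prod_y a l hl.1]; simp only [Matrix.mul_assoc]
        _ = _ := by rw [h.G_mul_π]
    simp only [listBracket]
    calc G * (s a * (l.map (t a)).prod * listBracket s t l) * G'
        = G * (s a * (l.map (t a)).prod * listBracket s t l) * (π a * G') := by rw [h.π_mul_G']
      _ = G * (s a * (l.map (t a)).prod * (listBracket s t l * π a)) * G' := by
        simp only [Matrix.mul_assoc]
      _ = G * (s a * (l.map (t a)).prod * π a) * listBracket s t l * G' := by
        rw [← c2.eq]; simp only [Matrix.mul_assoc]
      _ = s' a * (l.map (t' a)).prod * (G * listBracket s t l * G') := by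
        rw [main]; simp only [Matrix.mul_assoc]
      _ = _ := by rw [ih hl.2]

/-- The mirror image of the previous argument: `π a` now comes from `G` and the `π b` come from
`G'`, so the projections enclose `t a b` in the opposite order and `corner'` is used. -/
theorem CornerData.mul_listBracketRev_mul (h : CornerData G G' π s t y s' t') {l : List κ}
    (hl : l.Nodup) : G * listBracketRev s t l * G' = listBracketRev s' t' l := by
  have mul_π : ∀ (a : κ) (l : List κ), a ∉ l →
      π a * (l.map (y a)).reverse.prod * π a = π a * (l.map (y a)).reverse.prod := by
    intro a l hal
    cases l with
    | nil => simp [h.idem]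
    | cons b l =>
      have : a ≠ b := by rintro rfl; simp at hal
      rw [List.map_cons, List.reverse_cons, List.prod_append, List.prod_singleton, mul_assoc,
        mul_assoc, h.y_mul_π a b this]
  have cut : ∀ (a : κ) (l : List κ), l.Nodup → a ∉ l →
      π a * (l.map (t a)).reverse.prod * (l.map π).prod = π a * (l.map (y a)).reverse.prod := by
    intro a l
    induction l with
    | nil => simp
    | cons b l ih =>
      intro hl hal
      rw [List.nodup_cons] at hl
      simp only [List.mem_cons, not_or] at hal
      have c : Commute (t a b * π b) (l.map π).prod := by
        refine Commute.mul_left (commute_prod_map fun c hc => h.tπ a b c hal.1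
          (by rintro rfl; exact hal.2 hc) (by rintro rfl; exact hl.1 hc)) ?_
        exact commute_prod_map fun c _ => h.ππ b c
      simp only [List.map_cons, List.prod_cons, List.reverse_cons, List.prod_append, List.prod_nil,
        mul_one]
      calc π a * ((l.map (t a)).reverse.prod * t a b) * (π b * (l.map π).prod)
          = π a * (l.map (t a)).reverse.prod * ((t a b * π b) * (l.map π).prod) := by
            simp only [mul_assoc]
        _ = (π a * (l.map (t a)).reverse.prod * (l.map π).prod) * (t a b * π b) := by
          rw [c.eq]; simp only [mul_assoc]
        _ = π a * (l.map (y a)).reverse.prod * (π a * t a b * π b) := by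
          rw [ih hl.2 hal.2]
          conv_lhs => rw [← mul_π a l hal.2]
          simp only [mul_assoc]
        _ = _ := by rw [h.corner' a b hal.1]; simp only [mul_assoc]
  have prod_G' : ∀ l : List κ, (l.map π).prod * G' = G' := by
    intro l
    induction l with
    | nil => simp
    | cons b l ih => rw [List.map_cons, List.prod_cons, Matrix.mul_assoc, ih, h.π_mul_G']
  have prod_y_G' : ∀ (a : κ) (l : List κ), a ∉ l →
      (l.map (y a)).reverse.prod * G' = G' * (l.map (t' a)).reverse.prod := by
    intro a l
    induction l with
    | nil => simp
    | cons b l ih =>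
      intro hal
      simp only [List.mem_cons, not_or] at hal
      simp only [List.map_cons, List.reverse_cons, List.prod_append, List.prod_cons,
        List.prod_nil, mul_one]
      rw [Matrix.mul_assoc, h.y_mul_G' a b hal.1, ← Matrix.mul_assoc, ih hal.2, Matrix.mul_assoc]
  induction l with
  | nil => simp [listBracketRev, h.G_mul_G']
  | cons a l ih =>
    rw [List.nodup_cons] at hl
    have c1 : Commute (s a) (l.map π).prod := commute_prod_map fun c hc =>
        h.sπ a c (by rintro rfl; exact hl.1 hc)
    have c2 : Commute (π a) (listBracketRev s t l) := by
      refine commute_listBracketRev hl.2 (fun c hc => (h.sπ c a ?_).symm)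
        (fun c hc d hd hcd => (h.tπ c d a hcd ?_ ?_).symm) <;> rintro rfl <;> exact hl.1 ‹_›
    have main : π a * ((l.map (t a)).reverse.prod * s a) * G'
        = G' * ((l.map (t' a)).reverse.prod * s' a) := by
      calc π a * ((l.map (t a)).reverse.prod * s a) * G'
          = π a * ((l.map (t a)).reverse.prod * s a) * ((l.map π).prod * G') := by rw [prod_G']
        _ = π a * (l.map (t a)).reverse.prod * (s a * (l.map π).prod) * G' := by
          simp only [Matrix.mul_assoc]
        _ = π a * (l.map (t a)).reverse.prod * (l.map π).prod * s a * (π a * G') := by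
          rw [c1.eq, h.π_mul_G']; simp only [Matrix.mul_assoc]
        _ = π a * (l.map (y a)).reverse.prod * ((π a * s a * π a) * G') := by
          rw [cut a l hl.2 hl.1]
          conv_lhs => rw [← mul_π a l hl.1]
          simp only [Matrix.mul_assoc]
        _ = π a * ((l.map (y a)).reverse.prod * G') * s' a := by
          rw [h.s_mul_G']; simp only [Matrix.mul_assoc]
        _ = (π a * G') * (l.map (t' a)).reverse.prod * s' a := by
          rw [prod_y_G' a l hl.1]; simp only [Matrix.mul_assoc]
        _ = _ := by rw [h.π_mul_G']; simp only [Matrix.mul_assoc]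
    simp only [listBracketRev]
    calc G * (listBracketRev s t l * ((l.map (t a)).reverse.prod * s a)) * G'
        = G * π a * (listBracketRev s t l * ((l.map (t a)).reverse.prod * s a)) * G' := by
          rw [h.G_mul_π]
      _ = G * (π a * listBracketRev s t l) * ((l.map (t a)).reverse.prod * s a) * G' := by
        simp only [Matrix.mul_assoc]
      _ = G * listBracketRev s t l * (π a * ((l.map (t a)).reverse.prod * s a) * G') := by
        rw [c2.eq]; simp only [Matrix.mul_assoc]
      _ = (G * listBracketRev s t l * G') * ((l.map (t' a)).reverse.prod * s' a) := by
        rw [main]; simp only [Matrix.mul_assoc]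
      _ = _ := by rw [ih hl.2]

end Corner

/-! ### Operators acting on part of the tensor factors -/

section Lens

variable {Ω τ σ B : Type*}

/-- `get` reads the part `τ` of a configuration in `Ω` and `put` overwrites it. -/
structure IsLens (get : Ω → τ) (put : Ω → τ → Ω) : Prop where
  get_put : ∀ I x, get (put I x) = x
  put_get : ∀ I, put I (get I) = I
  put_put : ∀ I x y, put (put I x) y = put I y

/-- The operator on `Ω` that acts as `T` on the part `τ`. -/
def liftMat [Zero B] [DecidableEq Ω] (get : Ω → τ) (put : Ω → τ → Ω) (T : Matrix τ τ B) :
    Matrix Ω Ω B :=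
  fun I J => if put I (get J) = J then T (get I) (get J) else 0

variable {get : Ω → τ} {put : Ω → τ → Ω} [DecidableEq Ω] [Fintype Ω] [Fintype τ]

/-- The configurations that agree with `I` outside the part `τ` are exactly the `put I x`, each for
one `x`. -/
theorem IsLens.sum_eq [AddCommMonoid B] (h : IsLens get put) (I : Ω) (F : Ω → B)
    (hF : ∀ L, put I (get L) ≠ L → F L = 0) : ∑ L, F L = ∑ x, F (put I x) := by
  have hinj : Function.Injective (put I) := fun x y hxy => by
    rw [← h.get_put I x, hxy, h.get_put]
  rw [← Finset.sum_image (f := F) (s := Finset.univ) (g := put I) (fun x _ y _ hxy => hinj hxy)]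
  refine (Finset.sum_subset (Finset.subset_univ _) fun L _ hL => hF L fun hput => hL ?_).symm
  exact Finset.mem_image.2 ⟨get L, Finset.mem_univ _, hput⟩

variable [Ring B]

theorem IsLens.liftMat_mul_apply (h : IsLens get put) (T : Matrix τ τ B) (X : Matrix Ω σ B)
    (I : Ω) (J : σ) :
    (liftMat get put T * X) I J = ∑ x, T (get I) x * X (put I x) J := by
  rw [Matrix.mul_apply, h.sum_eq I]
  · simp [liftMat, h.get_put]
  · intro L hL
    simp [liftMat, hL]

theorem IsLens.put_comm (h : IsLens get put) {I J : Ω} :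
    put I (get J) = J ↔ put J (get I) = I := by
  constructor <;> intro hh <;> conv_lhs => rw [← hh]
  · rw [h.put_put, h.put_get]
  · rw [h.put_put, h.put_get]

theorem IsLens.vecMul_liftMat (h : IsLens get put) (T : Matrix τ τ B) (w : Ω → B) (J : Ω) :
    Matrix.vecMul w (liftMat get put T) J = ∑ x, w (put J x) * T x (get J) := by
  rw [Matrix.vecMul, dotProduct, h.sum_eq J]
  · simp [liftMat, h.get_put, h.put_put, h.put_get]
  · intro L hL
    simp [liftMat, h.put_comm, hL]

theorem IsLens.mul_liftMat_apply (h : IsLens get put) (T : Matrix τ τ B) (X : Matrix σ Ω B)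
    (I : σ) (J : Ω) :
    (X * liftMat get put T) I J = ∑ x, X I (put J x) * T x (get J) := by
  rw [← h.vecMul_liftMat T (X I) J]
  rfl

theorem IsLens.liftMat_one (h : IsLens get put) [DecidableEq τ] :
    liftMat get put (1 : Matrix τ τ B) = 1 := by
  ext I J
  simp only [liftMat, Matrix.one_apply]
  by_cases hIJ : I = J
  · subst hIJ
    simp [h.put_get]
  · rw [if_neg hIJ]
    split_ifs with h1 h2
    · rw [← h2, h.put_get] at h1
      exact absurd h1 hIJ
    all_goals rfl

theorem IsLens.liftMat_mul (h : IsLens get put) (T T' : Matrix τ τ B) :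
    liftMat get put (T * T') = liftMat get put T * liftMat get put T' := by
  ext I J
  rw [h.liftMat_mul_apply]
  simp only [liftMat, h.put_put, h.get_put]
  split_ifs
  · rfl
  · simp

/-- `liftMat` as a ring homomorphism. -/
def IsLens.liftHom (h : IsLens get put) [DecidableEq τ] (B : Type*) [Ring B] :
    Matrix τ τ B →+* Matrix Ω Ω B where
  toFun := liftMat get put
  map_one' := h.liftMat_one
  map_mul' := h.liftMat_mul
  map_zero' := by ext; simp [liftMat]
  map_add' T T' := by
    ext I J
    simp only [liftMat, Matrix.add_apply]
    split_ifs <;> simp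


theorem liftMat_liftMat [DecidableEq τ] {get' : τ → σ} {put' : τ → σ → τ}
    (h : IsLens get put) (T : Matrix σ σ B) :
    liftMat get put (liftMat get' put' T)
      = liftMat (fun I => get' (get I)) (fun I x => put I (put' (get I) x)) T := by
  ext I J
  simp only [liftMat]
  by_cases hJ : put I (put' (get I) (get' (get J))) = J
  · have h2 : put' (get I) (get' (get J)) = get J := by
      conv_rhs => rw [← hJ, h.get_put]
    rw [h2] at hJ
    simp [h2, hJ]
  · rw [if_neg hJ]
    split_ifs with h1 h2
    · rw [h2] at hJ
      exact absurd h1 hJ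
    all_goals rfl

/-- Operators acting on independent parts commute when their entries do. -/
theorem IsLens.commute_liftMat [Fintype σ] {get' : Ω → σ} {put' : Ω → σ → Ω}
    (h : IsLens get put)
    (h₁ : ∀ I x, get' (put I x) = get' I) (h₂ : ∀ I x, get (put' I x) = get I)
    (h₃ : ∀ I x y, put' (put I x) y = put (put' I y) x)
    {T : Matrix τ τ B} {T' : Matrix σ σ B} (hT : ∀ i j k l, Commute (T i j) (T' k l)) :
    Commute (liftMat get put T) (liftMat get' put' T') := by
  ext I J
  rw [h.liftMat_mul_apply, h.mul_liftMat_apply]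
  simp only [liftMat, h₁]
  by_cases hJ : put (put' I (get' J)) (get J) = J
  · rw [Finset.sum_eq_single (get J), Finset.sum_eq_single (get I)]
    · rw [h₃, if_pos hJ, if_pos]
      · exact hT _ _ _ _
      · rw [← h.put_comm.1 hJ, h₂]
    · intro x _ hx
      rw [if_neg, zero_mul]
      intro hh
      apply hx
      rw [← h.get_put J x, ← hh, h₂]
    · simp
    · intro x _ hx
      rw [if_neg, mul_zero]
      intro hh
      apply hx
      rw [← hh, h₃, h.get_put]
    · simp
  · rw [Finset.sum_eq_zero, Finset.sum_eq_zero]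
    · intro x _
      rw [if_neg, zero_mul]
      intro hh
      apply hJ
      rw [hh, h.put_put, h.put_get]
    · intro x _
      rw [if_neg, mul_zero]
      intro hh
      apply hJ
      rw [h₃] at hh
      have : x = get J := by rw [← hh, h.get_put]
      rw [← this, hh]

end Lens

/-! ### Operators on one, two or three tensor factors. -/

section Sites

variable {ι B : Type*} [DecidableEq ι] {m : ℕ}

theorem isLens_site (a : Fin m) :
    IsLens (fun I : Fin m → ι => I a) (fun I x => Function.update I a x) where
  get_put := by simp
  put_get := by simp
  put_put := by simp

theorem isLens_pair {a b : Fin m} (hab : a ≠ b) :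
    IsLens (fun I : Fin m → ι => (I a, I b))
      (fun I x => Function.update (Function.update I a x.1) b x.2) where
  get_put := by simp [hab]
  put_get := by simp
  put_put I x y := by
    ext k
    by_cases hk : k = b <;> by_cases hk' : k = a <;> simp [Function.update_apply, hk, hk']

theorem isLens_triple {a b c : Fin m} (hab : a ≠ b) (hac : a ≠ c) (hbc : b ≠ c) :
    IsLens (fun I : Fin m → ι => (I a, I b, I c))
      (fun I x => Function.update (Function.update (Function.update I a x.1) b x.2.1) c x.2.2) where
  get_put := by simp [hab, hac, hbc]
  put_get := by simp
  put_put I x y := by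
    ext k
    by_cases hk : k = b <;> by_cases hk' : k = a <;> by_cases hk'' : k = c <;>
      simp [Function.update_apply, hk, hk', hk'']

theorem isLens_comp {κ : Type*} {φ : κ → Fin m} (hφ : Function.Injective φ) :
    IsLens (fun I : Fin m → ι => I ∘ φ) (fun I x => Function.extend φ x I) where
  get_put I x := by
    ext k
    simp [hφ.extend_apply]
  put_get I := by
    ext k
    by_cases hk : ∃ i, φ i = k
    · obtain ⟨i, rfl⟩ := hk
      simp [hφ.extend_apply]
    · simp [Function.extend_apply' _ _ _ hk]
  put_put I x y := by
    ext k
    by_cases hk : ∃ i, φ i = k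
    · obtain ⟨i, rfl⟩ := hk
      simp [hφ.extend_apply]
    · simp [Function.extend_apply' _ _ _ hk]

theorem onSite_eq_liftMat [Zero B] (a : Fin m) (T : Matrix ι ι B) :
    onSite a T = liftMat (fun I : Fin m → ι => I a) (fun I x => Function.update I a x) T := by
  ext I J
  simp only [onSite, liftMat]
  congr 1
  simp only [funext_iff, Function.update_apply, eq_iff_iff]
  refine forall_congr' fun k => ?_
  by_cases hk : k = a <;> simp [hk]

theorem onPair_eq_liftMat [Zero B] (a b : Fin m) (T : Matrix (ι × ι) (ι × ι) B) :
    onPair a b T = liftMat (fun I : Fin m → ι => (I a, I b))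
      (fun I x => Function.update (Function.update I a x.1) b x.2) T := by
  ext I J
  simp only [onPair, liftMat]
  congr 1
  simp only [funext_iff, Function.update_apply, eq_iff_iff]
  refine forall_congr' fun k => ?_
  by_cases hk : k = a <;> by_cases hk' : k = b <;> simp [hk, hk'] <;> (rintro rfl; rfl)

variable [Ring B] [Fintype ι]

theorem onPair_mul {a b : Fin m} (hab : a ≠ b) (T T' : Matrix (ι × ι) (ι × ι) B) :
    onPair a b (T * T') = onPair a b T * onPair a b T' := by
  simp only [onPair_eq_liftMat, (isLens_pair hab).liftMat_mul]

theorem onPair_one {a b : Fin m} (hab : a ≠ b) :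
    onPair a b (1 : Matrix (ι × ι) (ι × ι) B) = 1 := by
  simp only [onPair_eq_liftMat, (isLens_pair hab).liftMat_one]

theorem onSite_mul (a : Fin m) (T T' : Matrix ι ι B) :
    onSite a (T * T') = onSite a T * onSite a T' := by
  simp only [onSite_eq_liftMat, (isLens_site a).liftMat_mul]

theorem onSite_one (a : Fin m) : onSite a (1 : Matrix ι ι B) = 1 := by
  simp only [onSite_eq_liftMat, (isLens_site a).liftMat_one]


theorem onPair_kronecker_one {a b : Fin m} (hab : a ≠ b) (S : Matrix ι ι B) :
    onPair a b (Matrix.kronecker S 1) = onSite a S := by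
  ext I J
  simp only [onPair, onSite, Matrix.kronecker, Matrix.kroneckerMap_apply, Matrix.one_apply]
  by_cases h : ∀ k, k ≠ a → I k = J k
  · rw [if_pos h, if_pos fun k hk _ => h k hk, if_pos (h b hab.symm), mul_one]
  · rw [if_neg h]
    split_ifs with h1 h2
    · refine absurd (fun k hk => ?_) h
      by_cases hkb : k = b
      · rw [hkb]; exact h2
      · exact h1 k hk hkb
    · simp
    · rfl


theorem onPair_one_kronecker {a b : Fin m} (hab : a ≠ b) (S : Matrix ι ι B) :
    onPair a b (Matrix.kronecker 1 S) = onSite b S := by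
  ext I J
  simp only [onPair, onSite, Matrix.kronecker, Matrix.kroneckerMap_apply, Matrix.one_apply]
  by_cases h : ∀ k, k ≠ b → I k = J k
  · rw [if_pos h, if_pos fun k _ hk => h k hk, if_pos (h a hab), one_mul]
  · rw [if_neg h]
    split_ifs with h1 h2
    · refine absurd (fun k hk => ?_) h
      by_cases hka : k = a
      · rw [hka]; exact h2
      · exact h1 k hka hk
    · simp
    · rfl

theorem commute_onSite_onPair {a b c : Fin m} (hab : a ≠ b) (hac : a ≠ c) (hbc : b ≠ c)
    {S : Matrix ι ι B} {T : Matrix (ι × ι) (ι × ι) B} (hT : ∀ i j k l, Commute (S i j) (T k l)) :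
    Commute (onSite a S) (onPair b c T) := by
  rw [onSite_eq_liftMat, onPair_eq_liftMat]
  refine (isLens_site a).commute_liftMat ?_ ?_ ?_ hT
  · intro I x
    simp [hab.symm, hac.symm]
  · intro I x
    simp [hab, hac]
  · intro I x y
    ext k
    by_cases ha : k = a <;> by_cases hb : k = b <;> by_cases hc : k = c <;> simp_all

theorem commute_onPair_onPair {a b c d : Fin m} (hab : a ≠ b) (hcd : c ≠ d)
    (hac : a ≠ c) (had : a ≠ d) (hbc : b ≠ c) (hbd : b ≠ d)
    {T T' : Matrix (ι × ι) (ι × ι) B} (hT : ∀ i j k l, Commute (T i j) (T' k l)) :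
    Commute (onPair a b T) (onPair c d T') := by
  rw [onPair_eq_liftMat, onPair_eq_liftMat]
  refine (isLens_pair hab).commute_liftMat ?_ ?_ ?_ hT
  · intro I x
    simp [hac.symm, had.symm, hbc.symm, hbd.symm]
  · intro I x
    simp [hac, had, hbc, hbd]
  · intro I x y
    ext k
    by_cases ha : k = a <;> by_cases hb : k = b <;> by_cases hc : k = c <;> by_cases hd : k = d <;>
      simp_all


theorem liftMat_comp_onSite {n : ℕ} {φ : Fin n → Fin m} (hφ : Function.Injective φ) (i : Fin n)
    (S : Matrix ι ι B) :
    liftMat (fun I : Fin m → ι => I ∘ φ) (fun I x => Function.extend φ x I) (onSite i S)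
      = onSite (φ i) S := by
  rw [onSite_eq_liftMat, onSite_eq_liftMat, liftMat_liftMat (isLens_comp hφ)]
  congr 1
  ext I x k
  by_cases hk : ∃ j, φ j = k
  · obtain ⟨j, rfl⟩ := hk
    simp [hφ.extend_apply, Function.update_apply, hφ.eq_iff]
  · rw [Function.extend_apply' _ _ _ hk, Function.update_of_ne]
    rintro rfl
    exact hk ⟨i, rfl⟩


theorem liftMat_comp_onPair {n : ℕ} {φ : Fin n → Fin m} (hφ : Function.Injective φ) (i j : Fin n)
    (T : Matrix (ι × ι) (ι × ι) B) :
    liftMat (fun I : Fin m → ι => I ∘ φ) (fun I x => Function.extend φ x I) (onPair i j T)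
      = onPair (φ i) (φ j) T := by
  rw [onPair_eq_liftMat, onPair_eq_liftMat, liftMat_liftMat (isLens_comp hφ)]
  congr 1
  ext I x k
  by_cases hk : ∃ j, φ j = k
  · obtain ⟨j, rfl⟩ := hk
    simp [hφ.extend_apply, Function.update_apply, hφ.eq_iff]
  · rw [Function.extend_apply' _ _ _ hk, Function.update_of_ne, Function.update_of_ne]
    · rintro rfl
      exact hk ⟨i, rfl⟩
    · rintro rfl
      exact hk ⟨j, rfl⟩

/-! The three pairs of factors in a triple tensor product. -/


theorem isLens_pair12 : IsLens (fun I : ι × ι × ι => (I.1, I.2.1)) (fun I x => (x.1, x.2, I.2.2)) :=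
  ⟨fun _ _ => rfl, fun _ => rfl, fun _ _ _ => rfl⟩


theorem isLens_pair13 : IsLens (fun I : ι × ι × ι => (I.1, I.2.2)) (fun I x => (x.1, I.2.1, x.2)) :=
  ⟨fun _ _ => rfl, fun _ => rfl, fun _ _ _ => rfl⟩


theorem isLens_pair23 : IsLens (fun I : ι × ι × ι => (I.2.1, I.2.2)) (fun I x => (I.1, x.1, x.2)) :=
  ⟨fun _ _ => rfl, fun _ => rfl, fun _ _ _ => rfl⟩

/-- `T` acting on the first two factors. -/
def onPair12 (T : Matrix (ι × ι) (ι × ι) B) : Matrix (ι × ι × ι) (ι × ι × ι) B :=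
  liftMat (fun I : ι × ι × ι => (I.1, I.2.1)) (fun I x => (x.1, x.2, I.2.2)) T

/-- `T` acting on the first and the third factor. -/
def onPair13 (T : Matrix (ι × ι) (ι × ι) B) : Matrix (ι × ι × ι) (ι × ι × ι) B :=
  liftMat (fun I : ι × ι × ι => (I.1, I.2.2)) (fun I x => (x.1, I.2.1, x.2)) T

/-- `T` acting on the last two factors. -/
def onPair23 (T : Matrix (ι × ι) (ι × ι) B) : Matrix (ι × ι × ι) (ι × ι × ι) B :=
  liftMat (fun I : ι × ι × ι => (I.2.1, I.2.2)) (fun I x => (I.1, x.1, x.2)) T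

/-- A relation between operators on three factors holds on any three sites. -/
theorem onPair_triple_relation {a b c : Fin m} (hab : a ≠ b) (hac : a ≠ c) (hbc : b ≠ c)
    {G T T' : Matrix (ι × ι) (ι × ι) B}
    (h : onPair12 G * (onPair13 T * onPair23 T') = onPair23 T' * onPair13 T * onPair12 G) :
    onPair a b G * (onPair a c T * onPair b c T') = onPair b c T' * onPair a c T * onPair a b G := by
  have hl := isLens_triple (ι := ι) hab hac hbc
  have h12 : ∀ X : Matrix (ι × ι) (ι × ι) B, liftMat (fun I : Fin m → ι => (I a, I b, I c))
      (fun I x => Function.update (Function.update (Function.update I a x.1) b x.2.1) c x.2.2)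
      (onPair12 X) = onPair a b X := fun X => by
    rw [onPair_eq_liftMat, onPair12, liftMat_liftMat hl]
    congr 1
    ext I x k
    simp only [Function.update_apply]
    split_ifs <;> simp_all
  have h13 : ∀ X : Matrix (ι × ι) (ι × ι) B, liftMat (fun I : Fin m → ι => (I a, I b, I c))
      (fun I x => Function.update (Function.update (Function.update I a x.1) b x.2.1) c x.2.2)
      (onPair13 X) = onPair a c X := fun X => by
    rw [onPair_eq_liftMat, onPair13, liftMat_liftMat hl]
    congr 1
    ext I x k
    simp only [Function.update_apply]
    split_ifs <;> simp_all
  have h23 : ∀ X : Matrix (ι × ι) (ι × ι) B, liftMat (fun I : Fin m → ι => (I a, I b, I c))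
      (fun I x => Function.update (Function.update (Function.update I a x.1) b x.2.1) c x.2.2)
      (onPair23 X) = onPair b c X := fun X => by
    rw [onPair_eq_liftMat, onPair23, liftMat_liftMat hl]
    congr 1
    ext I x k
    simp only [Function.update_apply]
    split_ifs <;> simp_all
  have := congrArg (liftMat (fun I : Fin m → ι => (I a, I b, I c))
      (fun I x => Function.update (Function.update (Function.update I a x.1) b x.2.1) c x.2.2)) h
  simpa only [hl.liftMat_mul, h12, h13, h23] using this

end Sites

/-! ### A Yang-Baxter equation for the partially transposed R-matrix -/

section YangBaxter

variable {K k ι : Type*} [Field K] [CommRing k] [Algebra K k] [LinearOrder ι]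

/-- The coefficients of the q-permutation operator. -/
def swapCoeff (k : Type*) [CommRing k] [Algebra K k] (q : K) (a b : ι) : k :=
  if a = b then 1 else if b < a then algebraMap K k q else algebraMap K k q⁻¹

/-- The coefficients of `R^t(x, 1) - (x - 1)`, which is supported on the span of the `e_a ⊗ e_a`. -/
def diagCoeff (q : K) (x : k) : Matrix ι ι k := fun a b =>
  if a = b then algebraMap K k q⁻¹ * x - algebraMap K k q - (x - 1)
  else if a < b then (algebraMap K k q⁻¹ - algebraMap K k q) * x
  else algebraMap K k q⁻¹ - algebraMap K k q

/-- The operator with matrix `F` on the span of the `e_a ⊗ e_a`, and zero on `e_a ⊗ e_b`, `a ≠ b`. -/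
def diagSupp {B : Type*} [Zero B] (F : Matrix ι ι B) : Matrix (ι × ι) (ι × ι) B :=
  fun a b => if a.1 = a.2 ∧ b.1 = b.2 then F a.1 b.1 else 0

/-- Transposing the first factor turns `E_ij ⊗ E_ji` into `E_ji ⊗ E_ji`, which sends `e_i ⊗ e_i` to
`e_j ⊗ e_j`. Hence `Rᵗ` is the scalar `x - 1` plus an operator on the span of the `e_a ⊗ e_a`. -/
theorem partialTranspose_rMatrix_eq (q : K) (x : k) :
    partialTranspose (rMatrix (ι := ι) q x 1) = (x - 1) • 1 + diagSupp (diagCoeff q x) := by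
  ext ⟨a, b⟩ ⟨c, d⟩
  simp only [partialTranspose, rMatrix, diagSupp, diagCoeff, Matrix.add_apply, Matrix.smul_apply,
    Matrix.one_apply, Prod.mk.injEq, smul_eq_mul, Algebra.smul_def, map_sub, mul_one]
  by_cases h1 : c = a <;> by_cases h2 : b = d <;> by_cases h3 : a = b <;> by_cases h4 : c = d <;>
    simp_all [eq_comm]

section Coefficients

variable {q : K} (hq : q ≠ 0) (x : k)
include hq

/-- This and the following relations are the entries of the Yang-Baxter equation. Its terms fall
into three groups with different index patterns: relations ₁, ₂ and ₃ treat entries where one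
pattern occurs, relations ₁₃, ₂₃ and ₁₂₃ those where patterns overlap and the groups are summed.
Only the relative order of the indices matters, which leaves polynomial identities in `s = q` and
`s' = q⁻¹` modulo `s s' = 1`. -/
theorem diagCoeff_relation₁ (a b e : ι) (hab : a ≠ b) :
    diagCoeff q x a b * diagCoeff q (algebraMap K k q ^ 2 * x) b e
      - (x - 1) * swapCoeff k q a b * diagCoeff q (algebraMap K k q ^ 2 * x) a e
      + (algebraMap K k q ^ 2 * x - 1) * diagCoeff q x a e * swapCoeff k q e b = 0 := by
  have h : algebraMap K k q * algebraMap K k q⁻¹ = 1 := by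
    rw [← map_mul, mul_inv_cancel₀ hq, map_one]
  unfold diagCoeff swapCoeff
  generalize algebraMap K k q = s at *
  generalize algebraMap K k q⁻¹ = s' at *
  rcases lt_trichotomy a b with h1 | h1 | h1 <;> rcases lt_trichotomy a e with h2 | h2 | h2 <;>
    rcases lt_trichotomy b e with h3 | h3 | h3 <;>
    first
    | (exfalso; order)
    | (subst_vars
       simp only [*, ne_of_lt, ne_of_gt, not_lt_of_gt, lt_irrefl, if_true, if_false]
       grind)

theorem diagCoeff_relation₂ (a b d : ι) (had : a ≠ d) :
    - (diagCoeff q (algebraMap K k q ^ 2 * x) b a * diagCoeff q x a d)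
      - (algebraMap K k q ^ 2 * x - 1) * swapCoeff k q a b * diagCoeff q x b d
      + (x - 1) * diagCoeff q (algebraMap K k q ^ 2 * x) b d * swapCoeff k q a d = 0 := by
  have h : algebraMap K k q * algebraMap K k q⁻¹ = 1 := by
    rw [← map_mul, mul_inv_cancel₀ hq, map_one]
  unfold diagCoeff swapCoeff
  generalize algebraMap K k q = s at *
  generalize algebraMap K k q⁻¹ = s' at *
  rcases lt_trichotomy a b with h1 | h1 | h1 <;> rcases lt_trichotomy a d with h2 | h2 | h2 <;>
    rcases lt_trichotomy b d with h3 | h3 | h3 <;>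
    first
    | (exfalso; order)
    | (subst_vars
       simp only [*, ne_of_lt, ne_of_gt, not_lt_of_gt, lt_irrefl, if_true, if_false]
       grind)

theorem diagCoeff_relation₃ (a b e : ι) (hab : a ≠ b) (hae : a ≠ e) :
    - (swapCoeff k q a b * diagCoeff q x b a * diagCoeff q (algebraMap K k q ^ 2 * x) a e)
      + diagCoeff q (algebraMap K k q ^ 2 * x) b a * diagCoeff q x a e * swapCoeff k q e a = 0 := by
  have h : algebraMap K k q * algebraMap K k q⁻¹ = 1 := by
    rw [← map_mul, mul_inv_cancel₀ hq, map_one]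
  unfold diagCoeff swapCoeff
  generalize algebraMap K k q = s at *
  generalize algebraMap K k q⁻¹ = s' at *
  rcases lt_or_gt_of_ne hab with h1 | h1 <;> rcases lt_or_gt_of_ne hae with h2 | h2 <;>
    simp only [hab, hae, hab.symm, hae.symm, h1, h2, not_lt_of_gt, if_true, if_false] <;> grind

theorem diagCoeff_relation₁₃ (a e : ι) (hae : a ≠ e) :
    diagCoeff q x a a * diagCoeff q (algebraMap K k q ^ 2 * x) a e
      - (x - 1) * swapCoeff k q a a * diagCoeff q (algebraMap K k q ^ 2 * x) a e
      + (algebraMap K k q ^ 2 * x - 1) * diagCoeff q x a e * swapCoeff k q e a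
      + (- (swapCoeff k q a a * diagCoeff q x a a * diagCoeff q (algebraMap K k q ^ 2 * x) a e)
      + diagCoeff q (algebraMap K k q ^ 2 * x) a a * diagCoeff q x a e * swapCoeff k q e a)
      = 0 := by
  have h : algebraMap K k q * algebraMap K k q⁻¹ = 1 := by
    rw [← map_mul, mul_inv_cancel₀ hq, map_one]
  unfold diagCoeff swapCoeff
  generalize algebraMap K k q = s at *
  generalize algebraMap K k q⁻¹ = s' at *
  rcases lt_or_gt_of_ne hae with h2 | h2 <;>
    simp only [hae, hae.symm, h2, not_lt_of_gt, if_true, if_false] <;> grind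

theorem diagCoeff_relation₂₃ (a b : ι) (hab : a ≠ b) :
    - (diagCoeff q (algebraMap K k q ^ 2 * x) b a * diagCoeff q x a a)
      - (algebraMap K k q ^ 2 * x - 1) * swapCoeff k q a b * diagCoeff q x b a
      + (x - 1) * diagCoeff q (algebraMap K k q ^ 2 * x) b a * swapCoeff k q a a
      + (- (swapCoeff k q a b * diagCoeff q x b a * diagCoeff q (algebraMap K k q ^ 2 * x) a a)
      + diagCoeff q (algebraMap K k q ^ 2 * x) b a * diagCoeff q x a a * swapCoeff k q a a)
      = 0 := by
  have h : algebraMap K k q * algebraMap K k q⁻¹ = 1 := by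
    rw [← map_mul, mul_inv_cancel₀ hq, map_one]
  unfold diagCoeff swapCoeff
  generalize algebraMap K k q = s at *
  generalize algebraMap K k q⁻¹ = s' at *
  rcases lt_or_gt_of_ne hab with h2 | h2 <;>
    simp only [hab, hab.symm, h2, not_lt_of_gt, if_true, if_false] <;> grind

omit hq in
theorem diagCoeff_relation₁₂₃ (a : ι) (y : k) :
    diagCoeff q x a a * diagCoeff q y a a - (x - 1) * swapCoeff k q a a * diagCoeff q y a a
      + (y - 1) * diagCoeff q x a a * swapCoeff k q a a
      + (- (diagCoeff q y a a * diagCoeff q x a a)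
      - (y - 1) * swapCoeff k q a a * diagCoeff q x a a
      + (x - 1) * diagCoeff q y a a * swapCoeff k q a a)
      + (- (swapCoeff k q a a * diagCoeff q x a a * diagCoeff q y a a)
      + diagCoeff q y a a * diagCoeff q x a a * swapCoeff k q a a) = 0 := by
  ring

end Coefficients

variable [Fintype ι]

/-- The q-permutation operator over a `K`-algebra. -/
def qSwapOver (k : Type*) [CommRing k] [Algebra K k] (q : K) : Matrix (ι × ι) (ι × ι) k :=
  (qSwap q).map (algebraMap K k)

theorem qSwapOver_apply (q : K) (x y : ι × ι) :
    qSwapOver k q x y = if x = (y.2, y.1) then swapCoeff k q x.1 x.2 else 0 := by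
  obtain ⟨a, b⟩ := x
  obtain ⟨c, d⟩ := y
  simp only [qSwapOver, qSwap, swapCoeff, Matrix.map_apply, Prod.mk.injEq]
  split_ifs <;> simp_all

theorem onPair12_qSwapOver_mul (q : K) (X : Matrix (ι × ι × ι) (ι × ι × ι) k) (a b c : ι)
    (J : ι × ι × ι) :
    (onPair12 (qSwapOver (ι := ι) k q) * X) (a, b, c) J = swapCoeff k q a b * X (b, a, c) J := by
  rw [onPair12, isLens_pair12.liftMat_mul_apply, Finset.sum_eq_single (b, a)]
  · simp [qSwapOver_apply]
  · rintro ⟨c, d⟩ _ h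
    rw [qSwapOver_apply, if_neg, zero_mul]
    intro h'
    apply h
    simp_all
  · simp

theorem mul_onPair12_qSwapOver (q : K) (X : Matrix (ι × ι × ι) (ι × ι × ι) k) (d e f : ι)
    (I : ι × ι × ι) :
    (X * onPair12 (qSwapOver (ι := ι) k q)) I (d, e, f) = X I (e, d, f) * swapCoeff k q e d := by
  rw [onPair12, isLens_pair12.mul_liftMat_apply, Finset.sum_eq_single (e, d)]
  · simp [qSwapOver_apply]
  · rintro ⟨a, b⟩ _ h
    rw [qSwapOver_apply, if_neg, mul_zero]
    exact h
  · simp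

theorem onPair13_diagSupp_mul (F : Matrix ι ι k) (X : Matrix (ι × ι × ι) (ι × ι × ι) k) (a b c : ι)
    (J : ι × ι × ι) :
    (onPair13 (diagSupp F) * X) (a, b, c) J = if a = c then ∑ g, F a g * X (g, b, g) J else 0 := by
  rw [onPair13, isLens_pair13.liftMat_mul_apply, Fintype.sum_prod_type]
  simp only [diagSupp]
  split_ifs with h
  · simp [h, ite_mul]
  · simp [h]

theorem onPair23_diagSupp_mul (F : Matrix ι ι k) (X : Matrix (ι × ι × ι) (ι × ι × ι) k) (a b c : ι)
    (J : ι × ι × ι) :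
    (onPair23 (diagSupp F) * X) (a, b, c) J = if b = c then ∑ g, F b g * X (a, g, g) J else 0 := by
  rw [onPair23, isLens_pair23.liftMat_mul_apply, Fintype.sum_prod_type]
  simp only [diagSupp]
  split_ifs with h
  · simp [h, ite_mul]
  · simp [h]

theorem onPair13_diagSupp_apply (F : Matrix ι ι k) (a b c d e f : ι) :
    onPair13 (diagSupp F) (a, b, c) (d, e, f)
      = if a = c ∧ d = f ∧ b = e then F a d else 0 := by
  simp only [onPair13, liftMat, diagSupp, Prod.mk.injEq]
  split_ifs <;> simp_all

theorem onPair23_diagSupp_apply (F : Matrix ι ι k) (a b c d e f : ι) :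
    onPair23 (diagSupp F) (a, b, c) (d, e, f)
      = if b = c ∧ e = f ∧ a = d then F b e else 0 := by
  simp only [onPair23, liftMat, diagSupp, Prod.mk.injEq]
  split_ifs <;> simp_all

theorem onPair13_mul_onPair23_apply (F F' : Matrix ι ι k) (a b c d e f : ι) :
    (onPair13 (diagSupp F) * onPair23 (diagSupp F')) (a, b, c) (d, e, f)
      = if a = c ∧ e = f ∧ b = d then F a b * F' b e else 0 := by
  rw [onPair13_diagSupp_mul]
  simp only [onPair23_diagSupp_apply]
  by_cases h : a = c
  · rw [if_pos h, Finset.sum_eq_single b]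
    · simp [h]
    · intro g _ hg
      rw [if_neg (fun hh => hg hh.1.symm), mul_zero]
    · simp
  · simp [h]

theorem onPair23_mul_onPair13_apply (F F' : Matrix ι ι k) (a b c d e f : ι) :
    (onPair23 (diagSupp F') * onPair13 (diagSupp F)) (a, b, c) (d, e, f)
      = if b = c ∧ d = f ∧ a = e then F' b a * F a d else 0 := by
  rw [onPair23_diagSupp_mul]
  simp only [onPair13_diagSupp_apply]
  by_cases h : b = c
  · rw [if_pos h, Finset.sum_eq_single a]
    · simp [h]
    · intro g _ hg
      rw [if_neg (fun hh => hg hh.1.symm), mul_zero]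
    · simp
  · simp [h]

theorem liftMat_smul {Ω τ : Type*} [DecidableEq Ω] (get : Ω → τ) (put : Ω → τ → Ω) (c : k)
    (T : Matrix τ τ k) : liftMat get put (c • T) = c • liftMat get put T := by
  ext I J
  simp [liftMat]

/-- The Yang-Baxter equation for `1 - P^q` and the partially transposed R-matrices. -/
theorem yangBaxter_partialTranspose {q : K} (hq : q ≠ 0) (x : k) :
    onPair12 (1 - qSwapOver (ι := ι) k q) *
        (onPair13 (partialTranspose (rMatrix q x 1)) *
          onPair23 (partialTranspose (rMatrix q (algebraMap K k q ^ 2 * x) 1)))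
      = onPair23 (partialTranspose (rMatrix q (algebraMap K k q ^ 2 * x) 1)) *
          onPair13 (partialTranspose (rMatrix q x 1)) * onPair12 (1 - qSwapOver k q) := by
  have e12 : onPair12 (1 - qSwapOver (ι := ι) k q) = 1 - onPair12 (qSwapOver k q) := by
    rw [onPair12, ← isLens_pair12.liftMat_one]
    exact map_sub (isLens_pair12.liftHom k) _ _
  have e13 : ∀ (x : k) (F : Matrix ι ι k), onPair13 (x • 1 + diagSupp (ι := ι) F) = x • 1 + onPair13 (diagSupp F) := by
    intro x F
    rw [onPair13, ← isLens_pair13.liftMat_one, ← liftMat_smul]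
    exact map_add (isLens_pair13.liftHom k) _ _
  have e23 : ∀ (x : k) (F : Matrix ι ι k), onPair23 (x • 1 + diagSupp (ι := ι) F) = x • 1 + onPair23 (diagSupp F) := by
    intro x F
    rw [onPair23, ← isLens_pair23.liftMat_one, ← liftMat_smul]
    exact map_add (isLens_pair23.liftHom k) _ _
  simp only [partialTranspose_rMatrix_eq, e12, e13, e23]
  rw [← sub_eq_zero]
  set y := algebraMap K k q ^ 2 * x with hy
  set α := x - 1 with hα
  set β := y - 1 with hβ
  set P : Matrix (ι × ι × ι) (ι × ι × ι) k := onPair12 (qSwapOver k q) with hP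
  set Q := onPair13 (diagSupp (ι := ι) (diagCoeff q x)) with hQ
  set Q' := onPair23 (diagSupp (ι := ι) (diagCoeff q y)) with hQ'
  -- The terms linear in `Q` or `Q'` without `P` and the scalar terms cancel. The rest is grouped by
  -- support: in row `(a, b, c)` and column `(d, e, f)` the first group needs `a = c, e = f, b = d`,
  -- the second `b = c, d = f, a = e`, the third `b = c, e = f, a = d`.
  have expand : (1 - P) * ((α • 1 + Q) * (β • 1 + Q')) - (β • 1 + Q') * (α • 1 + Q) * (1 - P)
      = (Q * Q' - α • (P * Q') + β • (Q * P)) + (- (Q' * Q) - β • (P * Q) + α • (Q' * P))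
        + (- (P * (Q * Q')) + (Q' * Q) * P) := by
    simp only [mul_add, add_mul, sub_mul, mul_sub, one_mul, mul_one, smul_mul_assoc,
      mul_smul_comm, smul_add, smul_sub, smul_smul, mul_assoc, mul_comm β α]
    abel
  rw [expand]
  ext ⟨a, b, c⟩ ⟨d, e, f⟩
  simp only [Matrix.add_apply, Matrix.sub_apply, Matrix.neg_apply, Matrix.smul_apply, hP,
    onPair12_qSwapOver_mul, mul_onPair12_qSwapOver, hQ, hQ', onPair13_mul_onPair23_apply,
    onPair23_mul_onPair13_apply, onPair13_diagSupp_apply, onPair23_diagSupp_apply,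
    smul_eq_mul, Matrix.zero_apply]
  by_cases h1 : a = c ∧ e = f ∧ b = d
  · obtain ⟨rfl, rfl, rfl⟩ := h1
    by_cases hab : a = b
    · subst hab
      by_cases hae : a = e
      · subst hae
        simp only [and_self, if_true]
        linear_combination diagCoeff_relation₁₂₃ (q := q) x a y
      · simp only [and_self, if_true, hae, and_false, if_false]
        linear_combination diagCoeff_relation₁₃ hq x a e hae
    · simp only [and_self, if_true, hab, Ne.symm hab, false_and, if_false]
      linear_combination diagCoeff_relation₁ hq x a b e hab
  · simp only [if_neg h1]
    by_cases h2 : b = c ∧ d = f ∧ a = e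
    · obtain ⟨rfl, rfl, rfl⟩ := h2
      by_cases had : a = d
      · subst had
        have hab : a ≠ b := fun h => h1 ⟨h, rfl, h.symm⟩
        simp only [and_self, if_true]
        linear_combination diagCoeff_relation₂₃ hq x a b hab
      · simp only [and_self, if_true, had, and_false, if_false]
        linear_combination diagCoeff_relation₂ hq x a b d had
    · simp only [if_neg h2]
      by_cases h3 : b = c ∧ e = f ∧ a = d
      · obtain ⟨rfl, rfl, rfl⟩ := h3
        have hab : a ≠ b := fun h => h1 ⟨h, rfl, h.symm⟩
        have hae : a ≠ e := fun h => h2 ⟨rfl, h, h⟩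
        simp only [and_self, if_true]
        linear_combination diagCoeff_relation₃ hq x a b e hab hae
      · simp [if_neg h3]
end YangBaxter

/-! ### Operators supported on the diagonal tensors -/

section PairOp

variable {k ι ι' : Type*} [CommRing k] [DecidableEq ι] [DecidableEq ι']

/-- The operator with matrix `F` on the span of the `e_a ⊗ e_a`, fixing `e_a ⊗ e_b` for `a ≠ b`. -/
def pairOp (F : Matrix ι ι k) : Matrix (ι × ι) (ι × ι) k :=
  fun a b => if a.1 = a.2 ∧ b.1 = b.2 then F a.1 b.1 else if a = b then 1 else 0

theorem pairOp_one : pairOp (1 : Matrix ι ι k) = 1 := by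
  ext ⟨a, b⟩ ⟨c, d⟩
  simp only [pairOp, Matrix.one_apply, Prod.mk.injEq]
  by_cases hab : a = b <;> by_cases hcd : c = d <;> by_cases hac : a = c <;> simp_all

/-- Both operators preserve the span of the `e_a ⊗ e_a` and fix the complementary basis tensors.
Inverting `R̄ᵗ` is thereby reduced to inverting a matrix indexed by `ι` alone. -/
theorem pairOp_mul [Fintype ι] (F F' : Matrix ι ι k) :
    pairOp F * pairOp F' = pairOp (F * F') := by
  ext ⟨a, b⟩ ⟨c, d⟩
  rw [Matrix.mul_apply]
  by_cases hab : a = b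
  · subst hab
    by_cases hcd : c = d
    · subst hcd
      have h0 : ∀ x y : ι, x ≠ y → pairOp F (a, a) (x, y) * pairOp F' (x, y) (c, c) = 0 := by
        intro x y hxy
        have : ¬ (a = x ∧ a = y) := fun h => hxy (h.1.symm.trans h.2)
        simp [pairOp, hxy, this]
      rw [Fintype.sum_prod_type]
      have h1 : ∀ x : ι, ∑ y, pairOp F (a, a) (x, y) * pairOp F' (x, y) (c, c)
          = F a x * F' x c := by
        intro x
        rw [Finset.sum_eq_single x]
        · simp [pairOp]
        · intro y _ hy
          exact h0 x y hy.symm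
        · simp
      simp only [h1]
      simp [pairOp, Matrix.mul_apply]
    · rw [Finset.sum_eq_zero]
      · have : ¬ (a = c ∧ a = d) := fun h => hcd (h.1.symm.trans h.2)
        simp [pairOp, hcd, this]
      · rintro ⟨x, y⟩ _
        by_cases hxy : x = y
        · subst hxy
          have : ¬ (x = c ∧ x = d) := fun h => hcd (h.1.symm.trans h.2)
          simp [pairOp, hcd, this]
        · have : ¬ (a = x ∧ a = y) := fun h => hxy (h.1.symm.trans h.2)
          simp [pairOp, hxy, this]
  · rw [Finset.sum_eq_single (a, b)]
    · simp [pairOp, hab]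
    · rintro ⟨x, y⟩ _ hxy
      have : ¬ (a = x ∧ b = y) := fun h => hxy (by rw [h.1, h.2])
      simp [pairOp, hab, this]
    · simp

theorem pairOp_submatrix {g : ι' → ι} (hg : Function.Injective g) (F : Matrix ι ι k) :
    (pairOp F).submatrix (Prod.map g g) (Prod.map g g) = pairOp (F.submatrix g g) := by
  ext ⟨a, b⟩ ⟨c, d⟩
  simp [pairOp, hg.eq_iff]

theorem pairOp_apply_eq_zero {F : Matrix ι ι k} {a b c d : ι} (h₁ : ¬ (a = c ∧ b = d))
    (h₂ : ¬ (a = b ∧ c = d)) : pairOp F (a, b) (c, d) = 0 := by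
  simp [pairOp, h₁, h₂]

/-- The diagonal tensors, and the property of being one of the fixed tensors, are unchanged by the
flip of the two factors. -/
theorem onPair_pairOp_comm {m : ℕ} {a b : Fin m} (F : Matrix ι ι k) :
    onPair b a (pairOp F) = onPair a b (pairOp F) := by
  ext I J
  simp only [onPair]
  have : (∀ c, c ≠ b → c ≠ a → I c = J c) ↔ (∀ c, c ≠ a → c ≠ b → I c = J c) := by
    constructor <;> exact fun h c h1 h2 => h c h2 h1
  simp only [this]
  congr 1
  simp only [pairOp, Prod.mk.injEq]
  split_ifs <;> simp_all

end PairOp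

/-! ### The inverse of the partially transposed R-matrix -/

section Inverse

variable {k : Type*} [CommRing k]

/-- The matrix of `R^t(x, 1)` on the span of the `e_a ⊗ e_a`. -/
def rtMat (s s' x : k) (i j : ℕ) : k :=
  if i = j then s' * x - s else if i < j then (s' - s) * x else s' - s

/-- The inverse of `rtMat`, up to a scalar factor. -/
def rtInvMat (s s' w : k) (i j : ℕ) : k :=
  if i = j then s * w - s'
  else if i < j then - ((s' - s) * (s ^ (2 * j) * s' ^ (2 * i)) * w)
  else - ((s' - s) * (s ^ (2 * j) * s' ^ (2 * i)))

/-- The partial sums of a column telescope, by `s s'² = s'`; the closed form changes when the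
diagonal entry `i = j` is passed. -/
theorem sum_range_rtInvMat {s s' : k} (h : s * s' = 1) (w : k) (j r : ℕ) :
    ∑ i ∈ Finset.range r, rtInvMat s s' w i j
      = if r ≤ j then s * s ^ (2 * j) * w * (1 - s' ^ (2 * r))
        else s * s ^ (2 * j) * (w - s' ^ (2 * r)) := by
  have hj : ∀ j, s ^ (2 * j) * s' ^ (2 * j) = 1 := fun j => by rw [← mul_pow, h, one_pow]
  induction r with
  | zero => simp
  | succ r ih =>
    rw [Finset.sum_range_succ, ih, mul_add, pow_add, mul_one]
    have h2 : s * s' ^ 2 = s' := by rw [pow_two, ← mul_assoc, h, one_mul]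
    rcases lt_trichotomy r j with hr | rfl | hr
    · rw [if_pos hr.le, if_pos (Nat.succ_le_of_lt hr), rtInvMat, if_neg hr.ne, if_pos hr]
      linear_combination (s ^ (2 * j) * s' ^ (2 * r) * w) * h2
    · rw [if_pos le_rfl, if_neg (by omega), rtInvMat, if_pos rfl]
      linear_combination (s' - s * w) * hj r + (s ^ (2 * r) * s' ^ (2 * r)) * h2
    · rw [if_neg (by omega), if_neg (by omega), rtInvMat, if_neg hr.ne', if_neg (by omega)]
      linear_combination (s ^ (2 * j) * s' ^ (2 * r)) * h2

/-- A row of `rtMat` is constant to the left of the diagonal and constant to its right, so the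
product only sees partial column sums of `rtInvMat`. The argument `x = s^(2n) w` is chosen so that
`x s'^(2n) = w` turns up in the full column sum. -/
theorem sum_rtMat_mul_rtInvMat {s s' : k} (h : s * s' = 1) (w : k) {n i j : ℕ} (hi : i < n)
    (hj : j < n) :
    ∑ l ∈ Finset.range n, rtMat s s' (s ^ (2 * n) * w) i l * rtInvMat s s' w l j
      = if i = j then (s ^ (2 * n) * w - 1) * (w - 1) else 0 := by
  set x := s ^ (2 * n) * w with hx
  have h1 : ∑ l ∈ Finset.range n, rtMat s s' x i l * rtInvMat s s' w l j
      = (s' - s) * ∑ l ∈ Finset.range i, rtInvMat s s' w l j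
        + (s' * x - s) * rtInvMat s s' w i j
        + (s' - s) * x * (∑ l ∈ Finset.range n, rtInvMat s s' w l j
          - ∑ l ∈ Finset.range (i + 1), rtInvMat s s' w l j) := by
    rw [← Finset.sum_Ico_eq_sub _ (Nat.succ_le_of_lt hi), Finset.mul_sum, Finset.mul_sum]
    have : ∀ F : ℕ → k, ∑ l ∈ Finset.range n, F l = ∑ l ∈ Finset.range i, F l + F i
        + ∑ l ∈ Finset.Ico (i + 1) n, F l := by
      intro F
      rw [Finset.sum_Ico_eq_sub _ (Nat.succ_le_of_lt hi), Finset.sum_range_succ]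
      ring
    rw [this]
    congr 1
    · congr 1
      · refine Finset.sum_congr rfl fun l hl => ?_
        rw [Finset.mem_range] at hl
        rw [rtMat, if_neg hl.ne', if_neg (by omega)]
      · rw [rtMat, if_pos rfl]
    · refine Finset.sum_congr rfl fun l hl => ?_
      rw [Finset.mem_Ico] at hl
      rw [rtMat, if_neg (by omega), if_pos (by omega)]
  have hp : ∀ j, s ^ (2 * j) * s' ^ (2 * j) = 1 := fun j => by rw [← mul_pow, h, one_pow]
  rw [h1]
  simp only [sum_range_rtInvMat h]
  rw [if_neg (by omega : ¬ n ≤ j)]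
  have hn := hp n
  have hjj := hp j
  have e : s' ^ (2 * (i + 1)) = s' ^ (2 * i) * s' ^ 2 := by rw [mul_add, pow_add, mul_one]
  rw [e]
  rcases lt_trichotomy i j with hij | rfl | hij
  · rw [if_pos hij.le, if_pos (by omega), rtInvMat, if_neg hij.ne, if_pos hij, if_neg hij.ne]
    generalize s' ^ (2 * n) = pn at *
    generalize s' ^ (2 * i) = pi at *
    generalize s ^ (2 * j) = z at *
    generalize s ^ (2 * n) = zn at *
    grind
  · rw [if_pos le_rfl, if_neg (by omega), rtInvMat, if_pos rfl, if_pos rfl]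
    generalize s' ^ (2 * n) = pn at *
    generalize s' ^ (2 * i) = pi at *
    generalize s ^ (2 * i) = z at *
    generalize s ^ (2 * n) = zn at *
    grind
  · rw [if_neg (by omega), if_neg (by omega), rtInvMat, if_neg hij.ne', if_neg (by omega),
      if_neg hij.ne']
    generalize s' ^ (2 * n) = pn at *
    generalize s' ^ (2 * i) = pi at *
    generalize s ^ (2 * j) = z at *
    generalize s ^ (2 * n) = zn at *
    grind

end Inverse

/-! ### The normalized matrix `R̄ᵗ` and its inverse over power series. -/

section RBar

variable {K : Type*} [Field K]

/-- The matrix of `R̄^t(x)` on the span of the `e_a ⊗ e_a`. -/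
def rBarMat {ι : Type*} [LinearOrder ι] (q : K) (x : PowerSeries K) : Matrix ι ι (PowerSeries K) :=
  1 + (x - 1)⁻¹ • diagCoeff q x

/-- The matrix of `R̄^t(x)⁻¹` on the span of the `e_a ⊗ e_a`, where `x = q ^ (2 n) w`. -/
def rBarInvMat {n : ℕ} (q : K) (w : PowerSeries K) : Matrix (Fin n) (Fin n) (PowerSeries K) :=
  fun i j => (w - 1)⁻¹ * rtInvMat (PowerSeries.C q) (PowerSeries.C q⁻¹) w i j

theorem inv_sub_one_mul {x : PowerSeries K} (hx : PowerSeries.constantCoeff x = 0) :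
    (x - 1)⁻¹ * (x - 1) = 1 :=
  PowerSeries.inv_mul_cancel _ (by simp [hx])

theorem rBarT_eq_pairOp {ι : Type*} [LinearOrder ι] (q : K) {x : PowerSeries K}
    (hx : PowerSeries.constantCoeff x = 0) :
    rBarT (ι := ι) q x = pairOp (rBarMat q x) := by
  rw [rBarT, partialTranspose_rMatrix_eq, smul_add, smul_smul, inv_sub_one_mul hx, one_smul]
  ext ⟨a, b⟩ ⟨c, d⟩
  simp only [rBarMat, diagSupp, pairOp, Matrix.add_apply, Matrix.smul_apply, Matrix.one_apply,
    Prod.mk.injEq]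
  by_cases hab : a = b <;> by_cases hcd : c = d <;> by_cases hac : a = c <;> by_cases hbd : b = d <;>
    simp_all

theorem rBarMat_apply {n : ℕ} (q : K) {x : PowerSeries K}
    (hx : PowerSeries.constantCoeff x = 0) (i j : Fin n) :
    rBarMat q x i j = (x - 1)⁻¹ * rtMat (PowerSeries.C q) (PowerSeries.C q⁻¹) x i j := by
  simp only [rBarMat, Matrix.add_apply, Matrix.smul_apply, smul_eq_mul, Matrix.one_apply, diagCoeff,
    rtMat, PowerSeries.algebraMap_apply, Algebra.algebraMap_self, RingHom.id_apply, Fin.val_inj,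
    Fin.lt_def]
  split_ifs
  · linear_combination -inv_sub_one_mul hx
  · ring
  · ring

theorem rBarMat_mul_rBarInvMat {n : ℕ} {q : K} (hq : q ≠ 0) {w : PowerSeries K}
    (hw : PowerSeries.constantCoeff w = 0) :
    rBarMat (ι := Fin n) q (PowerSeries.C (q ^ (2 * n)) * w) * rBarInvMat q w = 1 := by
  have hx : PowerSeries.constantCoeff (PowerSeries.C (q ^ (2 * n)) * w) = 0 := by simp [hw]
  have h : PowerSeries.C q * PowerSeries.C q⁻¹ = (1 : PowerSeries K) := by
    rw [← map_mul, mul_inv_cancel₀ hq, map_one]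
  ext1 i j
  rw [Matrix.mul_apply, Matrix.one_apply]
  simp only [rBarMat_apply q hx, rBarInvMat]
  have := sum_rtMat_mul_rtInvMat h w i.2 j.2
  rw [← map_pow] at this
  rw [← Fin.sum_univ_eq_sum_range (fun l => rtMat (PowerSeries.C q) (PowerSeries.C q⁻¹)
    (PowerSeries.C (q ^ (2 * n)) * w) i l * rtInvMat (PowerSeries.C q) (PowerSeries.C q⁻¹) w l j)]
    at this
  have h2 := inv_sub_one_mul hx
  have h3 := inv_sub_one_mul hw
  set x := PowerSeries.C (q ^ (2 * n)) * w
  calc _ = (x - 1)⁻¹ * (w - 1)⁻¹ * ∑ l : Fin n, rtMat (PowerSeries.C q) (PowerSeries.C q⁻¹) x i l *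
        rtInvMat (PowerSeries.C q) (PowerSeries.C q⁻¹) w l j := by
        rw [Finset.mul_sum]
        exact Finset.sum_congr rfl fun l _ => by ring
    _ = _ := by
      rw [this]
      simp only [Fin.val_inj]
      split_ifs
      · linear_combination (x - 1)⁻¹ * (x - 1) * h3 + h2
      · simp

/-- Apart from the order of the indices, the entries depend on them only through `q^(2j) q^(-2i)`,
which a common shift does not change, and the dimension enters only through `w`. A block of
consecutive indices in the inverse of a large `R̄ᵗ` is therefore the inverse of a small `R̄ᵗ` at
another argument. This is the origin of the shift in the spectral parameter of the second
determinant. -/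
theorem rBarInvMat_submatrix {n b : ℕ} {q : K} (hq : q ≠ 0) (w : PowerSeries K)
    {g : Fin b → Fin n} (c : ℕ) (hg : ∀ i, (g i : ℕ) = c + i) :
    (rBarInvMat q w).submatrix g g = rBarInvMat q w := by
  have h : PowerSeries.C q * PowerSeries.C q⁻¹ = (1 : PowerSeries K) := by
    rw [← map_mul, mul_inv_cancel₀ hq, map_one]
  ext1 i j
  have : ∀ s s' : PowerSeries K, s * s' = 1 →
      s ^ (2 * (c + j)) * s' ^ (2 * (c + i)) = s ^ (2 * (j : ℕ)) * s' ^ (2 * (i : ℕ)) := by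
    intro s s' h
    calc _ = (s * s') ^ (2 * c) * (s ^ (2 * (j : ℕ)) * s' ^ (2 * (i : ℕ))) := by
          rw [mul_add, mul_add, pow_add, pow_add, mul_pow]; ring
      _ = _ := by rw [h, one_pow, one_mul]
  simp only [Matrix.submatrix_apply, rBarInvMat, rtInvMat, hg, this _ _ h, add_right_inj,
    add_lt_add_iff_left]

end RBar

/-! ### Restricting operators to tensors over a subset of the basis -/

section Restrict

variable {ι ι' B : Type*} [Ring B] [Fintype ι] [DecidableEq ι] [Fintype ι'] [DecidableEq ι']
  {m : ℕ} (g : ι' → ι)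

variable (B m) in
/-- The projection of tensors over `ι` to tensors over `ι'`. -/
def restrictMat : Matrix (Fin m → ι') (Fin m → ι) B :=
  fun I J => if g ∘ I = J then 1 else 0

variable (B) in
open Classical in
/-- The projection of `B^ι` onto the span of the basis vectors in the range of `g`. -/
def rangeProj : Matrix ι ι B :=
  Matrix.diagonal fun i => if i ∈ Set.range g then 1 else 0

open Classical in
/-- The part of `T` that lives in the range of `g`. -/
def pairCut (T : Matrix (ι × ι) (ι × ι) B) : Matrix (ι × ι) (ι × ι) B :=
  fun x y => if (x.1 ∈ Set.range g ∧ x.2 ∈ Set.range g) ∧ y.1 ∈ Set.range g ∧ y.2 ∈ Set.range g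
    then T x y else 0

variable {g}

theorem restrictMat_mul {X : Matrix (Fin m → ι) (Fin m → ι) B}
    {X' : Matrix (Fin m → ι') (Fin m → ι') B}
    (hg : Function.Injective g)
    (h : ∀ I L, X (g ∘ I) (g ∘ L) = X' I L)
    (h₀ : ∀ I J, (¬ ∃ L, J = g ∘ L) → X (g ∘ I) J = 0) :
    restrictMat B m g * X = X' * restrictMat B m g := by
  ext I J
  simp only [Matrix.mul_apply, restrictMat, ite_mul, one_mul, zero_mul, mul_ite, mul_one, mul_zero,
    Finset.sum_ite_eq, Finset.mem_univ, if_true]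
  by_cases hJ : ∃ L, J = g ∘ L
  · obtain ⟨L, rfl⟩ := hJ
    rw [h, Finset.sum_eq_single L]
    · simp
    · intro L' _ hL
      rw [if_neg fun hh => hL (hg.comp_left hh)]
    · simp
  · rw [h₀ I J hJ, Finset.sum_eq_zero]
    intro L _
    rw [if_neg fun hh => hJ ⟨L, hh.symm⟩]

theorem mul_restrictMat_transpose {X : Matrix (Fin m → ι) (Fin m → ι) B}
    {X' : Matrix (Fin m → ι') (Fin m → ι') B}
    (hg : Function.Injective g)
    (h : ∀ I L, X (g ∘ I) (g ∘ L) = X' I L)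
    (h₀ : ∀ I J, (¬ ∃ L, J = g ∘ L) → X J (g ∘ I) = 0) :
    X * (restrictMat B m g).transpose = (restrictMat B m g).transpose * X' := by
  ext J I
  simp only [Matrix.mul_apply, restrictMat, Matrix.transpose_apply, ite_mul, one_mul, zero_mul,
    mul_ite, mul_one, mul_zero, Finset.sum_ite_eq, Finset.mem_univ, if_true]
  by_cases hJ : ∃ L, J = g ∘ L
  · obtain ⟨L, rfl⟩ := hJ
    rw [h, Finset.sum_eq_single L]
    · simp
    · intro L' _ hL
      rw [if_neg fun hh => hL (hg.comp_left hh)]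
    · simp
  · rw [h₀ I J hJ, Finset.sum_eq_zero]
    intro L _
    rw [if_neg fun hh => hJ ⟨L, hh.symm⟩]

theorem restrictMat_mul_transpose (hg : Function.Injective g) :
    restrictMat B m g * (restrictMat B m g).transpose = 1 := by
  ext I J
  simp only [Matrix.mul_apply, restrictMat, Matrix.transpose_apply, ite_mul, one_mul, zero_mul,
    Finset.sum_ite_eq, Finset.mem_univ, if_true, Matrix.one_apply]
  simp [hg.comp_left.eq_iff, eq_comm]

theorem restrictMat_mul_mul_transpose_apply (X : Matrix (Fin m → ι) (Fin m → ι) B)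
    (I J : Fin m → ι') :
    (restrictMat B m g * X * (restrictMat B m g).transpose) I J = X (g ∘ I) (g ∘ J) := by
  simp [Matrix.mul_apply, restrictMat]

theorem exists_eq_comp {J : Fin m → ι} (h : ∀ k, J k ∈ Set.range g) : ∃ L, J = g ∘ L := by
  choose L hL using h
  exact ⟨L, funext fun k => (hL k).symm⟩

theorem onSite_comp (hg : Function.Injective g) (a : Fin m) (S : Matrix ι ι B)
    (I L : Fin m → ι') :
    onSite a S (g ∘ I) (g ∘ L) = onSite a (S.submatrix g g) I L := by
  simp [onSite, hg.eq_iff]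

theorem onPair_comp (hg : Function.Injective g) (a b : Fin m) (T : Matrix (ι × ι) (ι × ι) B)
    (I L : Fin m → ι') :
    onPair a b T (g ∘ I) (g ∘ L)
      = onPair a b (T.submatrix (Prod.map g g) (Prod.map g g)) I L := by
  simp [onPair, hg.eq_iff]

theorem rangeProj_mul_mul_apply (S : Matrix ι ι B) (i j : ι) (hi : i ∈ Set.range g)
    (hj : j ∈ Set.range g) : (rangeProj B g * S * rangeProj B g) i j = S i j := by
  rw [rangeProj, Matrix.mul_diagonal, Matrix.diagonal_mul, if_pos hi, if_pos hj, one_mul, mul_one]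

theorem rangeProj_mul_mul_submatrix (S : Matrix ι ι B) :
    (rangeProj B g * S * rangeProj B g).submatrix g g = S.submatrix g g := by
  ext1 i j
  exact rangeProj_mul_mul_apply S _ _ ⟨i, rfl⟩ ⟨j, rfl⟩

theorem pairCut_submatrix (T : Matrix (ι × ι) (ι × ι) B) :
    (pairCut g T).submatrix (Prod.map g g) (Prod.map g g)
      = T.submatrix (Prod.map g g) (Prod.map g g) := by
  ext1 i j
  simp [pairCut]

theorem onSite_diagonal_eq_onPair {a b : Fin m} (hab : a ≠ b) (v : ι → B) :
    onSite a (Matrix.diagonal v) = onPair a b (Matrix.diagonal fun x => v x.1) := by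
  rw [← onPair_kronecker_one hab]
  congr 1
  ext ⟨i, j⟩ ⟨i', j'⟩
  by_cases h : j = j' <;>
  simp [Matrix.kronecker, Matrix.diagonal_apply, Prod.mk.injEq, h]

theorem onSite_diagonal_eq_onPair' {a b : Fin m} (hab : a ≠ b) (v : ι → B) :
    onSite b (Matrix.diagonal v) = onPair a b (Matrix.diagonal fun x => v x.2) := by
  rw [← onPair_one_kronecker hab]
  congr 1
  ext ⟨i, j⟩ ⟨i', j'⟩
  by_cases h : i = i' <;>
  simp [Matrix.kronecker, Matrix.diagonal_apply, Prod.mk.injEq, h]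

/-- `T` has the sparsity pattern of a partially transposed R-matrix. -/
def IsPairLike (T : Matrix (ι × ι) (ι × ι) B) : Prop :=
  ∀ a b c d, ¬ (a = c ∧ b = d) → ¬ (a = b ∧ c = d) → T (a, b) (c, d) = 0

/-- The operators `onSite a (S a)` and `onPair a b (T a b)` restrict to tensors over `ι'`. -/
theorem cornerData (hg : Function.Injective g) (S : Fin m → Matrix ι ι B)
    (T : Fin m → Fin m → Matrix (ι × ι) (ι × ι) B) (hT : ∀ a b, a ≠ b → IsPairLike (T a b)) :
    CornerData (restrictMat B m g) (restrictMat B m g).transpose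
      (fun a => onSite a (rangeProj B g)) (fun a => onSite a (S a))
      (fun a b => onPair a b (T a b)) (fun a b => onPair a b (pairCut g (T a b)))
      (fun a => onSite a ((S a).submatrix g g))
      (fun a b => onPair a b ((T a b).submatrix (Prod.map g g) (Prod.map g g))) := by
  have hcase : ∀ a b c d (T : Matrix (ι × ι) (ι × ι) B), IsPairLike T → T (a, b) (c, d) ≠ 0 →
      (a = c ∧ b = d) ∨ (a = b ∧ c = d) := by
    intro a b c d T hT h
    by_contra hh
    rw [not_or] at hh
    exact h (hT a b c d hh.1 hh.2)
  have hπ : ∀ i j, (rangeProj B g) i j = 0 ∨ (rangeProj B g) i j = 1 := by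
    intro i j
    simp only [rangeProj, Matrix.diagonal_apply]
    split_ifs <;> simp
  have hππ : ∀ i j (c : B), Commute (rangeProj B g i j) c := by
    intro i j c
    rcases hπ i j with h | h <;> rw [h]
    · exact Commute.zero_left c
    · exact Commute.one_left c
  have hid : rangeProj B g * rangeProj B g = rangeProj B g := by
    rw [rangeProj, Matrix.diagonal_mul_diagonal]
    congr 1
    ext i
    split_ifs <;> simp
  have hsub : (rangeProj B g).submatrix g g = 1 := by
    ext i j
    simp [rangeProj, Matrix.diagonal_apply, Matrix.one_apply, hg.eq_iff]
  have siteZero : ∀ (a : Fin m) (S : Matrix ι ι B) (I : Fin m → ι') (J : Fin m → ι),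
      (∀ i j, j ∉ Set.range g → S i j = 0) → (¬ ∃ L, J = g ∘ L) → onSite a S (g ∘ I) J = 0 := by
    intro a S I J hS hJ
    simp only [onSite]
    split_ifs with h
    · apply hS
      intro hJa
      refine hJ (exists_eq_comp fun k => ?_)
      by_cases hk : k = a
      · rw [hk]; exact hJa
      · exact ⟨I k, h k hk⟩
    · rfl
  have siteZero' : ∀ (a : Fin m) (S : Matrix ι ι B) (I : Fin m → ι') (J : Fin m → ι),
      (∀ i j, i ∉ Set.range g → S i j = 0) → (¬ ∃ L, J = g ∘ L) → onSite a S J (g ∘ I) = 0 := by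
    intro a S I J hS hJ
    simp only [onSite]
    split_ifs with h
    · apply hS
      intro hJa
      refine hJ (exists_eq_comp fun k => ?_)
      by_cases hk : k = a
      · rw [hk]; exact hJa
      · exact ⟨I k, (h k hk).symm⟩
    · rfl
  have projZero : ∀ i j, j ∉ Set.range g → (rangeProj B g) i j = 0 := by
    intro i j hj
    simp only [rangeProj, Matrix.diagonal_apply]
    split_ifs with h h' <;> first | rfl | (subst h; exact absurd h' hj)
  have projZero' : ∀ i j, i ∉ Set.range g → (rangeProj B g) i j = 0 := by
    intro i j hj
    simp only [rangeProj, Matrix.diagonal_apply]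
    split_ifs with h <;> rfl
  constructor
  case G_mul_G' => exact restrictMat_mul_transpose hg
  case G_mul_π =>
    intro a
    rw [restrictMat_mul hg (X' := 1), Matrix.one_mul]
    · intro I L
      rw [onSite_comp hg, hsub, onSite_one]
    · exact fun I J => siteZero a _ I J projZero
  case π_mul_G' =>
    intro a
    rw [mul_restrictMat_transpose hg (X' := 1), Matrix.mul_one]
    · intro I L
      rw [onSite_comp hg, hsub, onSite_one]
    · exact fun I J => siteZero' a _ I J projZero'
  case idem =>
    intro a
    rw [← onSite_mul, hid]
  case ππ =>
    intro a b
    by_cases hab : a = b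
    · rw [hab]
    · rw [onSite_eq_liftMat, onSite_eq_liftMat]
      refine (isLens_site a).commute_liftMat ?_ ?_ ?_ (fun i j k l => hππ i j _)
      · intro I x; simp [Ne.symm hab]
      · intro I x; simp [hab]
      · intro I x y; rw [Function.update_comm hab]
  case sπ =>
    intro a b hab
    rw [onSite_eq_liftMat, onSite_eq_liftMat]
    refine (isLens_site a).commute_liftMat ?_ ?_ ?_ (fun i j k l => (hππ k l _).symm)
    · intro I x; simp [Ne.symm hab]
    · intro I x; simp [hab]
    · intro I x y; rw [Function.update_comm hab]
  case tπ =>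
    intro a b c hab hca hcb
    exact (commute_onSite_onPair hca hcb hab fun i j k l => hππ i j _).symm
  case corner =>
    intro a b hab
    rw [rangeProj, onSite_diagonal_eq_onPair hab, onSite_diagonal_eq_onPair' hab,
      ← onPair_mul hab, ← onPair_mul hab]
    congr 1
    ext ⟨i, j⟩ ⟨i', j'⟩
    rw [Matrix.mul_diagonal, Matrix.diagonal_mul, pairCut]
    -- A nonzero entry has either `i = i'` and `j = j'`, or `i = j` and `i' = j'`. In both cases the
    -- two projections, which test `j` and `i'`, force all four indices into the range of `g`.
    by_cases h0 : T a b (i, j) (i', j') = 0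
    · simp [h0]
    · rcases hcase _ _ _ _ _ (hT a b hab) h0 with ⟨rfl, rfl⟩ | ⟨rfl, rfl⟩ <;>
      by_cases h1 : i ∈ Set.range g <;>
      [by_cases h2 : j ∈ Set.range g; by_cases h2 : j ∈ Set.range g;
       by_cases h2 : i' ∈ Set.range g; by_cases h2 : i' ∈ Set.range g] <;>
      simp only [h1, h2, if_true, if_false, one_mul, mul_one, mul_zero, zero_mul, and_true,
        and_false]
  case corner' =>
    intro a b hab
    rw [rangeProj, onSite_diagonal_eq_onPair hab, onSite_diagonal_eq_onPair' hab,
      ← onPair_mul hab, ← onPair_mul hab]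
    congr 1
    ext ⟨i, j⟩ ⟨i', j'⟩
    rw [Matrix.mul_diagonal, Matrix.diagonal_mul, pairCut]
    -- The same dichotomy, with the projections testing `i` and `j'`.
    by_cases h0 : T a b (i, j) (i', j') = 0
    · simp [h0]
    · rcases hcase _ _ _ _ _ (hT a b hab) h0 with ⟨rfl, rfl⟩ | ⟨rfl, rfl⟩ <;>
      by_cases h1 : i ∈ Set.range g <;>
      [by_cases h2 : j ∈ Set.range g; by_cases h2 : j ∈ Set.range g;
       by_cases h2 : i' ∈ Set.range g; by_cases h2 : i' ∈ Set.range g] <;>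
      simp only [h1, h2, if_true, if_false, one_mul, mul_one, mul_zero, zero_mul, and_true,
        and_false]
  case π_mul_y =>
    intro a b hab
    rw [rangeProj, onSite_diagonal_eq_onPair hab, ← onPair_mul hab]
    congr 1
    ext ⟨i, j⟩ ⟨i', j'⟩
    rw [Matrix.diagonal_mul, pairCut]
    by_cases h1 : i ∈ Set.range g <;> simp only [h1, if_true, if_false, one_mul, zero_mul,
      false_and, true_and]
  case y_mul_π =>
    intro a b hab
    rw [rangeProj, onSite_diagonal_eq_onPair hab, ← onPair_mul hab]
    congr 1
    ext ⟨i, j⟩ ⟨i', j'⟩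
    rw [Matrix.mul_diagonal, pairCut]
    by_cases h1 : i' ∈ Set.range g <;> simp only [h1, if_true, if_false, mul_one, mul_zero,
      false_and, and_false]
  case G_mul_s =>
    intro a
    rw [← onSite_mul, ← onSite_mul]
    refine restrictMat_mul hg (fun I L => ?_) (fun I J => siteZero a _ I J ?_)
    · rw [onSite_comp hg, rangeProj_mul_mul_submatrix]
    · intro i j hj
      rw [rangeProj, Matrix.mul_diagonal, if_neg hj, mul_zero]
  case s_mul_G' =>
    intro a
    rw [← onSite_mul, ← onSite_mul]
    refine mul_restrictMat_transpose hg (fun I L => ?_) (fun I J => siteZero' a _ I J ?_)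
    · rw [onSite_comp hg, rangeProj_mul_mul_submatrix]
    · intro i j hj
      rw [rangeProj, Matrix.mul_diagonal, Matrix.diagonal_mul, if_neg hj, zero_mul, zero_mul]
  case G_mul_y =>
    intro a b hab
    refine restrictMat_mul hg (fun I L => ?_) (fun I J hJ => ?_)
    · rw [onPair_comp hg, pairCut_submatrix]
    · simp only [onPair]
      split_ifs with h
      · rw [pairCut, if_neg]
        intro hh
        refine hJ (exists_eq_comp fun k => ?_)
        by_cases hk : k = a
        · rw [hk]; exact hh.2.1
        · by_cases hk' : k = b
          · rw [hk']; exact hh.2.2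
          · exact ⟨I k, h k hk hk'⟩
      · rfl
  case y_mul_G' =>
    intro a b hab
    refine mul_restrictMat_transpose hg (fun I L => ?_) (fun I J hJ => ?_)
    · rw [onPair_comp hg, pairCut_submatrix]
    · simp only [onPair]
      split_ifs with h
      · rw [pairCut, if_neg]
        intro hh
        refine hJ (exists_eq_comp fun k => ?_)
        by_cases hk : k = a
        · rw [hk]; exact hh.1.1
        · by_cases hk' : k = b
          · rw [hk']; exact hh.1.2
          · exact ⟨I k, (h k hk hk').symm⟩
      · rfl

end Restrict

/-! ### q-antisymmetric row vectors -/

section Antisymmetric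

variable {K B ι : Type*} [Field K] [Ring B] [Algebra K B] [LinearOrder ι] {m : ℕ}

/-- Row vectors `w` with `w P = -w` for the q-permutation operator on any two adjacent factors. -/
def IsQAntisymm (q : K) (w : (Fin m → ι) → B) : Prop :=
  ∀ (k l : Fin m), (l : ℕ) = k + 1 → ∀ J : Fin m → ι,
    w (J ∘ Equiv.swap k l) * algebraMap K B (qSwap q (J l, J k) (J k, J l)) = - w J

variable (B) in
/-- The q-permutation operator over `B`. -/
def qSwapMap (q : K) : Matrix (ι × ι) (ι × ι) B := (qSwap q).map (algebraMap K B)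

variable [Fintype ι]

theorem vecMul_onPair_qSwapMap (q : K) (w : (Fin m → ι) → B) {k l : Fin m} (hkl : k ≠ l)
    (J : Fin m → ι) :
    Matrix.vecMul w (onPair k l (qSwapMap B q)) J
      = w (J ∘ Equiv.swap k l) * algebraMap K B (qSwap q (J l, J k) (J k, J l)) := by
  rw [onPair_eq_liftMat, (isLens_pair hkl).vecMul_liftMat, Finset.sum_eq_single (J l, J k)]
  · congr 2
    ext i
    by_cases h1 : i = k
    · subst h1; simp [hkl]
    · by_cases h2 : i = l
      · subst h2; simp
      · simp [h1, h2, Equiv.swap_apply_of_ne_of_ne h1 h2]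
  · rintro ⟨x, y⟩ _ hxy
    have : qSwap q (x, y) (J k, J l) = 0 := by
      rw [qSwap, if_neg]
      rintro ⟨h1, h2⟩
      exact hxy (by simp_all)
    simp [qSwapMap, this]
  · simp

theorem ne_of_val_eq_succ {k l : Fin m} (hkl : (l : ℕ) = k + 1) : k ≠ l := by
  rintro rfl
  omega

theorem isQAntisymm_iff (q : K) (w : (Fin m → ι) → B) :
    IsQAntisymm q w ↔ ∀ (k l : Fin m), (l : ℕ) = k + 1 →
      Matrix.vecMul w (onPair k l (qSwapMap B q)) = -w := by
  refine forall_congr' fun k => forall_congr' fun l => forall_congr' fun hkl => ?_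
  rw [funext_iff]
  refine forall_congr' fun J => ?_
  rw [vecMul_onPair_qSwapMap q w (ne_of_val_eq_succ hkl), Pi.neg_apply]

theorem onPair_map {B' : Type*} [Ring B'] (f : B →+* B') (a b : Fin m)
    (T : Matrix (ι × ι) (ι × ι) B) : onPair a b (T.map f) = (onPair a b T).map f := by
  ext I J
  simp only [onPair, Matrix.map_apply]
  split_ifs <;> simp

theorem onSite_map {B' : Type*} [Ring B'] (f : B →+* B') (a : Fin m)
    (T : Matrix ι ι B) : onSite a (T.map f) = (onSite a T).map f := by
  ext I J
  simp only [onSite, Matrix.map_apply]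
  split_ifs <;> simp

theorem qPerm_one (q : K) : qPerm (ι := ι) q (1 : Equiv.Perm (Fin m)) = 1 := by
  ext I J
  have : J ∘ (Equiv.symm (1 : Equiv.Perm (Fin m))) = J := rfl
  simp only [qPerm, this, Matrix.one_apply]
  split_ifs with h
  · simp [h]
  · rfl

theorem onPair_qSwapMap_sq {q : K} (hq : q ≠ 0) {k l : Fin m} (hkl : (l : ℕ) = k + 1) :
    onPair k l (qSwapMap (ι := ι) B q) * onPair k l (qSwapMap B q) = 1 := by
  rw [qSwapMap, onPair_map, ← Matrix.map_mul, ← qPerm_swap q k l hkl, ← qPerm_mul hq,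
    Equiv.swap_mul_self, qPerm_one]
  exact Matrix.map_one _ (map_zero _) (map_one _)

theorem onPair_one_sub {a b : Fin m} (hab : a ≠ b) (T : Matrix (ι × ι) (ι × ι) B) :
    onPair a b (1 - T) = 1 - onPair a b T := by
  rw [← onPair_one hab]
  ext I J
  simp only [onPair, Matrix.sub_apply]
  split_ifs <;> simp

variable [CharZero K]

variable (K) in
theorem eq_zero_of_eq_neg {V : Type*} [AddCommGroup V] [Module K V] {x : V} (h : x = -x) :
    x = 0 := by
  have h2 : (2 : K) • x = 0 := by
    rw [two_smul]
    nth_rw 1 [h]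
    exact neg_add_cancel x
  exact (smul_eq_zero.1 h2).resolve_left two_ne_zero

/-- If `X` intertwines `1 - P` on adjacent factors, then it preserves q-antisymmetry. -/
theorem IsQAntisymm.vecMul {q : K} (hq : q ≠ 0) {w : (Fin m → ι) → B} (hw : IsQAntisymm q w)
    {X : Matrix (Fin m → ι) (Fin m → ι) B}
    (hX : ∀ k l : Fin m, (l : ℕ) = k + 1 → ∃ X' : Matrix (Fin m → ι) (Fin m → ι) B,
      onPair k l (1 - qSwapMap B q) * X = X' * onPair k l (1 - qSwapMap B q)) :
    IsQAntisymm q (Matrix.vecMul w X) := by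
  rw [isQAntisymm_iff] at hw ⊢
  intro k l hkl
  obtain ⟨X', hX'⟩ := hX k l hkl
  have hne := ne_of_val_eq_succ hkl
  have hP := onPair_qSwapMap_sq (ι := ι) (B := B) hq hkl
  rw [onPair_one_sub hne] at hX'
  have hwk := hw k l hkl
  set P := onPair k l (qSwapMap (ι := ι) B q)
  -- Since `w (1 - P) = 2 w`, the vector `2 w X = w X' (1 - P)` is killed by `1 + P`, because `P² =
  -- 1`. Characteristic `0` allows division by `2`.
  have h1 : Matrix.vecMul w (1 - P) = (2 : K) • w := by
    rw [Matrix.vecMul_sub, Matrix.vecMul_one, hwk, two_smul, sub_neg_eq_add]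
  have h0 : (1 - P) * (1 + P) = 0 := by
    rw [mul_add, mul_one, sub_mul, hP, one_mul]
    abel
  have h2 : (2 : K) • Matrix.vecMul w X = Matrix.vecMul (Matrix.vecMul w X') (1 - P) := by
    rw [Matrix.vecMul_vecMul, ← hX', ← Matrix.vecMul_vecMul, h1, Matrix.smul_vecMul]
  have h3 : (2 : K) • (Matrix.vecMul w X + Matrix.vecMul (Matrix.vecMul w X) P) = 0 := by
    have : Matrix.vecMul w X + Matrix.vecMul (Matrix.vecMul w X) P
        = Matrix.vecMul (Matrix.vecMul w X) (1 + P) := by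
      rw [Matrix.vecMul_add, Matrix.vecMul_one]
    rw [this, ← Matrix.smul_vecMul, h2, Matrix.vecMul_vecMul, h0, Matrix.vecMul_zero]
  have h4 := (smul_eq_zero.1 h3).resolve_left two_ne_zero
  exact (neg_eq_of_add_eq_zero_right h4).symm

/-- The adjacent transpositions generate the symmetric group, and both sides are multiplicative in
`σ`. -/
theorem IsQAntisymm.vecMul_qPerm {q : K} (hq : q ≠ 0) {w : (Fin m → ι) → B}
    (hw : IsQAntisymm q w) (σ : Equiv.Perm (Fin m)) :
    Matrix.vecMul w ((qPerm q σ).map (algebraMap K B)) = ((Equiv.Perm.sign σ : ℤ) : K) • w := by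
  rw [isQAntisymm_iff] at hw
  have hone : Matrix.vecMul w ((qPerm q (1 : Equiv.Perm (Fin m))).map (algebraMap K B))
      = ((Equiv.Perm.sign (1 : Equiv.Perm (Fin m)) : ℤ) : K) • w := by
    rw [qPerm_one, Matrix.map_one _ (map_zero _) (map_one _), Matrix.vecMul_one]
    simp
  cases m with
  | zero =>
    rw [Subsingleton.elim σ 1, hone]
  | succ n =>
    have hσ : σ ∈ Submonoid.closure
        (Set.range fun i : Fin n => Equiv.swap i.castSucc i.succ) := by
      rw [Equiv.Perm.mclosure_swap_castSucc_succ]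
      trivial
    induction hσ using Submonoid.closure_induction with
    | mem τ hτ =>
      obtain ⟨i, rfl⟩ := hτ
      have hi : ((i.succ : Fin (n + 1)) : ℕ) = (i.castSucc : Fin (n + 1)) + 1 := by simp
      have := hw _ _ hi
      rw [qSwapMap, onPair_map, ← qPerm_swap q _ _ hi] at this
      simp only
      rw [this, Equiv.Perm.sign_swap (ne_of_val_eq_succ hi)]
      simp
    | one => exact hone
    | mul τ τ' _ _ h h' =>
      rw [qPerm_mul hq, Matrix.map_mul, ← Matrix.vecMul_vecMul, h, Matrix.smul_vecMul, h', smul_smul,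
        map_mul]
      push_cast
      rfl

theorem IsQAntisymm.apply_comp {q : K} (hq : q ≠ 0) {w : (Fin m → ι) → B}
    (hw : IsQAntisymm q w) (σ : Equiv.Perm (Fin m)) (J : Fin m → ι) :
    w (J ∘ σ.symm) * algebraMap K B (q ^ ((inversions (J ∘ σ.symm) : ℤ) - (inversions J : ℤ)))
      = ((Equiv.Perm.sign σ : ℤ) : K) • w J := by
  have := congrFun (hw.vecMul_qPerm hq σ) J
  rw [Matrix.vecMul, dotProduct, Finset.sum_eq_single (J ∘ σ.symm)] at this
  · simpa [qPerm] using this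
  · intro I _ hI
    simp [qPerm, hI]
  · simp

/-- A transposition of two sites with equal values fixes `J`, and its sign gives `w J = -w J`. -/
theorem IsQAntisymm.eq_zero_of_not_injective {q : K} (hq : q ≠ 0) {w : (Fin m → ι) → B}
    (hw : IsQAntisymm q w) {J : Fin m → ι} (hJ : ¬ Function.Injective J) : w J = 0 := by
  simp only [Function.Injective, not_forall] at hJ
  obtain ⟨i, j, hij, hne⟩ := hJ
  have h := hw.apply_comp hq (Equiv.swap i j) J
  have hJJ : J ∘ (Equiv.swap i j).symm = J := by
    ext x
    simp only [Function.comp, Equiv.symm_swap, Equiv.swap_apply_def]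
    split_ifs with h1 h2
    · rw [h1, hij]
    · rw [h2, hij]
    · rfl
  rw [hJJ, Equiv.Perm.sign_swap hne] at h
  simp only [sub_self, zpow_zero, map_one, mul_one, Units.val_neg, Units.val_one, Int.cast_neg,
    Int.cast_one, neg_smul, one_smul] at h
  exact eq_zero_of_eq_neg K h

theorem IsQAntisymm.eq_zero_of_apply_eq_zero {q : K} (hq : q ≠ 0) {w : (Fin m → ι) → B}
    (hw : IsQAntisymm q w) {I J : Fin m → ι} (hI : w I = 0) (σ : Equiv.Perm (Fin m))
    (hJ : J ∘ σ.symm = I) : w J = 0 := by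
  have h := hw.apply_comp hq σ J
  rw [hJ, hI, zero_mul] at h
  refine (smul_eq_zero.1 h.symm).resolve_left ?_
  rcases Int.units_eq_one_or (Equiv.Perm.sign σ) with h' | h' <;> simp [h']

/-- An index sequence either repeats a value, and the entry vanishes, or is a permutation, and the
entry is determined by the one at `id`. This is the one-dimensionality of the top q-exterior power.
-/
theorem IsQAntisymm.eq_zero {q : K} (hq : q ≠ 0) {w : (Fin m → Fin m) → B}
    (hw : IsQAntisymm q w) (hid : w id = 0) : w = 0 := by
  ext J
  by_cases hJ : Function.Injective J
  · have hb : Function.Bijective J := (Finite.injective_iff_bijective).1 hJ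
    refine hw.eq_zero_of_apply_eq_zero hq hid (Equiv.ofBijective J hb) ?_
    ext x
    exact congrArg Fin.val (Equiv.ofBijective_apply_symm_apply J hb x)
  · exact hw.eq_zero_of_not_injective hq hJ

/-- The first row of `m!` times the q-antisymmetrizer, for `m = dim`. -/
def qEta (q : K) (m : ℕ) : (Fin m → Fin m) → K :=
  (∑ σ : Equiv.Perm (Fin m), ((Equiv.Perm.sign σ : ℤ) : K) • qPerm q σ :
    Matrix (Fin m → Fin m) (Fin m → Fin m) K) id

omit [CharZero K] in
theorem qEta_id (q : K) (m : ℕ) : qEta q m id = 1 := by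
  rw [qEta, Matrix.sum_apply, Finset.sum_eq_single 1]
  · simp [qPerm_one]
  · intro σ _ hσ
    rw [Matrix.smul_apply, qPerm, if_neg, smul_zero]
    intro h
    apply hσ
    ext x
    have := congrFun h (σ x)
    simp only [id, Function.comp, Equiv.symm_apply_apply] at this
    rw [this]
    rfl
  · simp

-- Right multiplication by the operator of an adjacent transposition permutes the summands of the
-- antisymmetrizer and reverses their signs.
omit [CharZero K] in
theorem isQAntisymm_qEta {q : K} (hq : q ≠ 0) (m : ℕ) :
    IsQAntisymm q (qEta q m) := by
  rw [isQAntisymm_iff]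
  intro k l hkl
  have h1 : (qSwapMap K q : Matrix (Fin m × Fin m) (Fin m × Fin m) K) = qSwap q := by
    ext; simp [qSwapMap]
  rw [h1, ← qPerm_swap q k l hkl]
  set τ := Equiv.swap k l
  have hτ : Equiv.Perm.sign τ = -1 := Equiv.Perm.sign_swap (ne_of_val_eq_succ hkl)
  have h2 : (∑ σ : Equiv.Perm (Fin m), ((Equiv.Perm.sign σ : ℤ) : K) • qPerm (ι := Fin m) q σ)
      * qPerm q τ = - ∑ σ : Equiv.Perm (Fin m), ((Equiv.Perm.sign σ : ℤ) : K) • qPerm q σ := by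
    rw [Finset.sum_mul, ← Finset.sum_neg_distrib,
      ← Equiv.sum_comp (Equiv.mulRight τ) fun σ : Equiv.Perm (Fin m) =>
        -(((Equiv.Perm.sign σ : ℤ) : K) • qPerm (ι := Fin m) q σ)]
    refine Finset.sum_congr rfl fun σ _ => ?_
    rw [smul_mul_assoc, ← qPerm_mul hq, Equiv.coe_mulRight, map_mul, hτ]
    simp
  exact congrFun h2 id

/-- Row vectors on `Fin m` tensor factors of dimension `m` that are q-antisymmetric are
proportional to `qEta`. -/
theorem IsQAntisymm.eq_mul_qEta {q : K} (hq : q ≠ 0) {w : (Fin m → Fin m) → B}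
    (hw : IsQAntisymm q w) (J : Fin m → Fin m) :
    w J = w id * algebraMap K B (qEta q m J) := by
  -- The difference of the two sides is antisymmetric and vanishes at `id`, as `η` has entry `1`
  -- there.
  have h : IsQAntisymm q fun J => w J - w id * algebraMap K B (qEta q m J) := by
    intro k l hkl J
    have h1 := hw k l hkl J
    have h2 := isQAntisymm_qEta hq m k l hkl J
    simp only [Algebra.algebraMap_self, RingHom.id_apply] at h2
    simp only
    rw [sub_mul, h1, mul_assoc, ← map_mul, h2, map_neg]
    noncomm_ring
  have := congrFun (h.eq_zero hq (by simp [qEta_id])) J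
  exact sub_eq_zero.1 this

theorem IsQAntisymm.algebraMap_comp {q : K} {w : (Fin m → ι) → K} (hw : IsQAntisymm q w) :
    IsQAntisymm q fun J => algebraMap K B (w J) := by
  intro k l hkl J
  have := hw k l hkl J
  simp only [Algebra.algebraMap_self, RingHom.id_apply] at this
  rw [← map_mul, this, map_neg]

end Antisymmetric

/-! ### Entries of `η` at concatenated index sequences. -/

section Append

variable {K : Type*} [Field K] [CharZero K] {q : K} {a b : ℕ}

omit [CharZero K] in
theorem qSwap_apply_strictMono {ι ι' : Type*} [LinearOrder ι] [LinearOrder ι'] (q : K)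
    {f : ι → ι'} (hf : StrictMono f) (x y z t : ι) :
    qSwap q (f x, f y) (f z, f t) = qSwap q (x, y) (z, t) := by
  simp [qSwap, hf.injective.eq_iff, hf.lt_iff_lt]

/-- As a function of `I` the left side is antisymmetric on `a` factors of dimension `a`, because an
increasing `f` preserves the coefficients of `P^q`. By uniqueness it is a multiple of the small `η`,
and `I = id` gives the factor. -/
theorem qEta_append_left (hq : q ≠ 0) {f : Fin a → Fin (a + b)} (hf : StrictMono f)
    (g : Fin b → Fin (a + b)) (I : Fin a → Fin a) :
    qEta q (a + b) (Fin.append (f ∘ I) g) = qEta q (a + b) (Fin.append f g) * qEta q a I := by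
  have h : IsQAntisymm q fun I : Fin a → Fin a => qEta q (a + b) (Fin.append (f ∘ I) g) := by
    intro k l hkl J
    have := isQAntisymm_qEta hq (a + b) (Fin.castAdd b k) (Fin.castAdd b l) (by simpa using hkl)
      (Fin.append (f ∘ J) g)
    simp only [Fin.append_left, Function.comp_apply, qSwap_apply_strictMono q hf] at this
    simp only
    rw [← this]
    congr 2
    ext i
    refine Fin.addCases (fun i => ?_) (fun i => ?_) i
    · rw [Function.comp_apply, ← (Fin.castAdd_injective a b).map_swap]
      simp
    · rw [Function.comp_apply, Equiv.swap_apply_of_ne_of_ne]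
      · simp
      · simp [Fin.ext_iff]; omega
      · simp [Fin.ext_iff]; omega
  simpa using h.eq_mul_qEta hq I

theorem qEta_append_right (hq : q ≠ 0) (f : Fin a → Fin (a + b))
    {g : Fin b → Fin (a + b)} (hg : StrictMono g) (I : Fin b → Fin b) :
    qEta q (a + b) (Fin.append f (g ∘ I)) = qEta q (a + b) (Fin.append f g) * qEta q b I := by
  have h : IsQAntisymm q fun I : Fin b → Fin b => qEta q (a + b) (Fin.append f (g ∘ I)) := by
    intro k l hkl J
    have := isQAntisymm_qEta hq (a + b) (Fin.natAdd a k) (Fin.natAdd a l)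
      (by simp only [Fin.val_natAdd]; omega)
      (Fin.append f (g ∘ J))
    simp only [Fin.append_right, Function.comp_apply, qSwap_apply_strictMono q hg] at this
    simp only
    rw [← this]
    congr 2
    ext i
    refine Fin.addCases (fun i => ?_) (fun i => ?_) i
    · rw [Function.comp_apply, Equiv.swap_apply_of_ne_of_ne]
      · simp
      · simp [Fin.ext_iff]; omega
      · simp [Fin.ext_iff]; omega
    · rw [Function.comp_apply, ← (Fin.natAdd_injective b a).map_swap]
      simp
  simpa using h.eq_mul_qEta hq I

theorem qEta_ne_zero (hq : q ≠ 0) {m : ℕ} {J : Fin m → Fin m} (hJ : Function.Bijective J) :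
    qEta q m J ≠ 0 := by
  intro h
  have : qEta q m id = 0 := (isQAntisymm_qEta hq m).eq_zero_of_apply_eq_zero hq h
    (Equiv.ofBijective J hJ).symm rfl
  rw [qEta_id] at this
  exact one_ne_zero this

end Append

/-! ### Invertible matrices of power series -/

section Units

variable {A ι : Type*} [Ring A] [Fintype ι] [DecidableEq ι]

/-- A power series of matrices as a matrix of power series. -/
def matrixOfPowerSeries : PowerSeries (Matrix ι ι A) →+* Matrix ι ι (PowerSeries A) where
  toFun f := Matrix.of fun i j => PowerSeries.mk fun r => PowerSeries.coeff r f i j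
  map_zero' := by ext; simp
  map_one' := by
    ext i j r
    rw [Matrix.of_apply, PowerSeries.coeff_mk, PowerSeries.coeff_one, Matrix.one_apply]
    by_cases hij : i = j <;> by_cases hr : r = 0 <;>
      simp [hij, hr, PowerSeries.coeff_one, Matrix.one_apply]
  map_add' f g := by ext; simp
  map_mul' f g := by
    ext i j r
    simp only [Matrix.of_apply, PowerSeries.coeff_mk, Matrix.mul_apply, map_sum,
      PowerSeries.coeff_mul, Matrix.sum_apply]
    exact Finset.sum_comm

/-- A matrix of power series is a power series of matrices, and a power series over any ring is a
unit when its constant coefficient is. -/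
theorem isUnit_of_isUnit_constantCoeff {S : Matrix ι ι (PowerSeries A)}
    (h : IsUnit (S.map (PowerSeries.coeff 0))) : IsUnit S := by
  set φ : PowerSeries (Matrix ι ι A) := PowerSeries.mk fun r => S.map (PowerSeries.coeff r)
  have hφ : matrixOfPowerSeries φ = S := by
    ext i j r
    simp [matrixOfPowerSeries, φ]
  rw [← hφ]
  refine IsUnit.map _ (PowerSeries.isUnit_iff_constantCoeff.2 ?_)
  rw [← PowerSeries.coeff_zero_eq_constantCoeff_apply, PowerSeries.coeff_mk]
  exact h

/-- After division by the diagonal, `T` becomes `1 + N` with `N` strictly lower triangular, hence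
nilpotent. No determinant is involved, so the entries need not commute. -/
theorem isUnit_of_lowerTriangular {n : ℕ} {T : Matrix (Fin n) (Fin n) A}
    (h : ∀ i j, i < j → T i j = 0) (hd : ∀ i, IsUnit (T i i)) : IsUnit T := by
  choose d hd using hd
  set D : Matrix (Fin n) (Fin n) A := Matrix.diagonal fun i => ↑(d i)⁻¹
  have hD : IsUnit D := by
    refine ⟨⟨D, Matrix.diagonal fun i => ↑(d i), ?_, ?_⟩, rfl⟩ <;>
    simp [D, Matrix.diagonal_mul_diagonal]
  set N := D * T - 1
  have hN : ∀ i j, i ≤ j → N i j = 0 := by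
    intro i j hij
    simp only [N, Matrix.sub_apply, D, Matrix.diagonal_mul]
    rcases hij.lt_or_eq with hlt | rfl
    · rw [h i j hlt, mul_zero, Matrix.one_apply_ne hlt.ne, sub_zero]
    · rw [← hd i, Units.inv_mul, Matrix.one_apply_eq, sub_self]
  -- Each factor `N` moves the support at least one diagonal further down.
  have hpow : ∀ (r : ℕ) (i j : Fin n), (i : ℕ) < j + r → (N ^ r) i j = 0 := by
    intro r
    induction r with
    | zero =>
      intro i j hij
      rw [pow_zero, Matrix.one_apply_ne]
      rintro rfl
      simp at hij
    | succ r ih =>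
      intro i j hij
      rw [pow_succ, Matrix.mul_apply]
      refine Finset.sum_eq_zero fun l _ => ?_
      by_cases hl : l ≤ j
      · rw [hN l j hl, mul_zero]
      · rw [ih i l, zero_mul]
        rw [not_le, Fin.lt_def] at hl
        omega
  have hnil : IsNilpotent N := ⟨n, by ext i j; exact hpow n i j (by omega)⟩
  have hDT : IsUnit (D * T) := by
    have := hnil.isUnit_add_one
    simpa [N] using this
  exact (hD.mul_left_iff).1 hDT

end Units

/-! ### Specializing the reflection equation -/

section Specialize

variable {K A : Type*} [Field K] [Ring A] [Algebra K A]

/-- The exponent of the monomial `u⁻ⁱ v⁻ʲ`. -/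
def biExponent (i j : ℕ) : Fin 2 →₀ ℕ := Finsupp.single 0 i + Finsupp.single 1 j

theorem biExponent_zero (i j : ℕ) : biExponent i j 0 = i := by simp [biExponent]

theorem biExponent_one (i j : ℕ) : biExponent i j 1 = j := by simp [biExponent]

theorem biExponent_eta (d : Fin 2 →₀ ℕ) : biExponent (d 0) (d 1) = d := by
  ext i
  fin_cases i
  · exact biExponent_zero _ _
  · exact biExponent_one _ _

theorem sum_antidiagonal_biExponent {V : Type*} [AddCommMonoid V] (i j : ℕ)
    (F : (Fin 2 →₀ ℕ) → (Fin 2 →₀ ℕ) → V) :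
    ∑ p ∈ Finset.HasAntidiagonal.antidiagonal (biExponent i j), F p.1 p.2
      = ∑ x ∈ Finset.HasAntidiagonal.antidiagonal i ×ˢ Finset.HasAntidiagonal.antidiagonal j,
        F (biExponent x.1.1 x.2.1) (biExponent x.1.2 x.2.2) := by
  refine Finset.sum_nbij' (fun p => ((p.1 0, p.2 0), (p.1 1, p.2 1)))
    (fun x => (biExponent x.1.1 x.2.1, biExponent x.1.2 x.2.2)) ?_ ?_ ?_ ?_ ?_
  · rintro ⟨d, d'⟩ h
    rw [Finset.HasAntidiagonal.mem_antidiagonal] at h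
    have h0 := DFunLike.congr_fun h 0
    have h1 := DFunLike.congr_fun h 1
    simp only [Finsupp.add_apply, biExponent_zero, biExponent_one] at h0 h1
    simp [h0, h1]
  · rintro ⟨⟨a, b⟩, c, d⟩ h
    simp only [Finset.mem_product, Finset.HasAntidiagonal.mem_antidiagonal] at h ⊢
    rw [← h.1, ← h.2]
    simp only [biExponent, Finsupp.single_add]
    abel
  · rintro ⟨d, d'⟩ _
    simp [biExponent_eta]
  · rintro ⟨⟨a, b⟩, c, d⟩ _
    simp [biExponent_zero, biExponent_one]
  · rintro ⟨d, d'⟩ _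
    simp [biExponent_eta]

/-- The homomorphism `F(u⁻¹, v⁻¹) ↦ F(c₀ u⁻¹, c₁ u⁻¹)`. -/
def specialize (A : Type*) [Ring A] [Algebra K A] (c₀ c₁ : K) :
    MvPowerSeries (Fin 2) A →+* PowerSeries A where
  toFun F := PowerSeries.mk fun r => ∑ p ∈ Finset.HasAntidiagonal.antidiagonal r,
    (c₀ ^ p.1 * c₁ ^ p.2) • MvPowerSeries.coeff (biExponent p.1 p.2) F
  map_zero' := by ext; simp
  map_add' F G := by ext; simp [Finset.sum_add_distrib]
  map_one' := by
    ext r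
    rw [PowerSeries.coeff_mk, PowerSeries.coeff_one]
    have : ∀ i j, biExponent i j = 0 ↔ i = 0 ∧ j = 0 := by
      intro i j
      rw [DFunLike.ext_iff, Fin.forall_fin_two]
      simp [biExponent_zero, biExponent_one]
    by_cases hr : r = 0
    · subst hr
      simp [MvPowerSeries.coeff_one, this]
    · rw [if_neg hr]
      refine Finset.sum_eq_zero fun p hp => ?_
      rw [Finset.HasAntidiagonal.mem_antidiagonal] at hp
      rw [MvPowerSeries.coeff_one, if_neg, smul_zero]
      rw [this]
      omega
  map_mul' F G := by
    ext r
    simp only [PowerSeries.coeff_mk, PowerSeries.coeff_mul, MvPowerSeries.coeff_mul,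
      sum_antidiagonal_biExponent _ _
        (fun d d' => MvPowerSeries.coeff d F * MvPowerSeries.coeff d' G),
      Finset.sum_mul_sum, Finset.smul_sum, ← Finset.sum_product', Finset.sum_sigma']
    -- Four exponents are summed over, those of `u⁻¹` and `v⁻¹` in `F` and in `G`. One side groups
    -- them by variable, the other by factor; the regrouping transposes this `2 × 2` array and is
    -- its own inverse.
    refine Finset.sum_nbij'
      (fun x => ⟨(x.2.1.1 + x.2.2.1, x.2.1.2 + x.2.2.2),
        ((x.2.1.1, x.2.2.1), (x.2.1.2, x.2.2.2))⟩)
      (fun x => ⟨(x.2.1.1 + x.2.2.1, x.2.1.2 + x.2.2.2),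
        ((x.2.1.1, x.2.2.1), (x.2.1.2, x.2.2.2))⟩) ?_ ?_ ?_ ?_ ?_
    · rintro ⟨⟨i, j⟩, ⟨a, b⟩, ⟨c, d⟩⟩ h
      simp only [Finset.mem_sigma, Finset.mem_product, Finset.HasAntidiagonal.mem_antidiagonal] at h ⊢
      obtain ⟨rfl, rfl, rfl⟩ := h
      simp only [and_self, and_true]
      omega
    · rintro ⟨⟨i, j⟩, ⟨a, b⟩, ⟨c, d⟩⟩ h
      simp only [Finset.mem_sigma, Finset.mem_product, Finset.HasAntidiagonal.mem_antidiagonal] at h ⊢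
      obtain ⟨rfl, rfl, rfl⟩ := h
      simp only [and_self, and_true]
      omega
    · rintro ⟨⟨i, j⟩, ⟨a, b⟩, ⟨c, d⟩⟩ h
      simp only [Finset.mem_sigma, Finset.mem_product, Finset.HasAntidiagonal.mem_antidiagonal] at h ⊢
      obtain ⟨-, rfl, rfl⟩ := h
      rfl
    · rintro ⟨⟨i, j⟩, ⟨a, b⟩, ⟨c, d⟩⟩ h
      simp only [Finset.mem_sigma, Finset.mem_product, Finset.HasAntidiagonal.mem_antidiagonal] at h ⊢
      obtain ⟨-, rfl, rfl⟩ := h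
      rfl
    · rintro ⟨⟨i, j⟩, ⟨a, b⟩, ⟨c, d⟩⟩ h
      simp only [Finset.mem_sigma, Finset.mem_product, Finset.HasAntidiagonal.mem_antidiagonal] at h
      obtain ⟨-, rfl, rfl⟩ := h
      simp only [smul_mul_smul_comm]
      congr 1
      ring

theorem specialize_inVar_zero (c₀ c₁ : K) (f : PowerSeries A) :
    specialize A c₀ c₁ (inVar 0 f) = rescaleArg c₀⁻¹ f := by
  ext r
  simp only [specialize, RingHom.coe_mk, MonoidHom.coe_mk, OneHom.coe_mk, PowerSeries.coeff_mk,
    rescaleArg, inv_inv]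
  rw [Finset.sum_eq_single (r, 0)]
  · change _ • inVar 0 f _ = _
    have : biExponent r 0 = Finsupp.single 0 r := by simp [biExponent]
    simp [inVar, this]
  · rintro ⟨i, j⟩ hp hne
    change _ • inVar 0 f _ = _
    rw [inVar, if_neg, smul_zero]
    intro h
    have := DFunLike.congr_fun h 1
    simp only [biExponent_one, biExponent_zero] at this
    rw [Finset.HasAntidiagonal.mem_antidiagonal] at hp
    simp at this
    simp_all
  · simp

theorem specialize_inVar_one (c₀ c₁ : K) (f : PowerSeries A) :
    specialize A c₀ c₁ (inVar 1 f) = rescaleArg c₁⁻¹ f := by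
  ext r
  simp only [specialize, RingHom.coe_mk, MonoidHom.coe_mk, OneHom.coe_mk, PowerSeries.coeff_mk,
    rescaleArg, inv_inv]
  rw [Finset.sum_eq_single (0, r)]
  · change _ • inVar 1 f _ = _
    have : biExponent 0 r = Finsupp.single 1 r := by simp [biExponent]
    simp [inVar, this]
  · rintro ⟨i, j⟩ hp hne
    change _ • inVar 1 f _ = _
    rw [inVar, if_neg, smul_zero]
    intro h
    have := DFunLike.congr_fun h 0
    simp only [biExponent_one, biExponent_zero] at this
    rw [Finset.HasAntidiagonal.mem_antidiagonal] at hp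
    simp at this
    simp_all
  · simp

theorem specialize_X_zero (c₀ c₁ : K) :
    specialize K c₀ c₁ (MvPowerSeries.X 0) = PowerSeries.C c₀ * PowerSeries.X := by
  have : (MvPowerSeries.X 0 : MvPowerSeries (Fin 2) K) = inVar 0 PowerSeries.X := by
    ext d
    change _ = inVar 0 _ d
    simp only [MvPowerSeries.coeff_X, inVar, PowerSeries.coeff_X]
    by_cases h : d = Finsupp.single 0 (d 0)
    · rw [if_pos h, h]
      simp [(Finsupp.single_injective _).eq_iff]
    · rw [if_neg h, if_neg]
      rintro rfl
      simp at h
  rw [this, specialize_inVar_zero]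
  ext r
  simp only [rescaleArg, inv_inv, PowerSeries.coeff_mk, PowerSeries.coeff_C_mul,
    PowerSeries.coeff_X, smul_eq_mul]
  split_ifs with h <;> simp [h]

theorem specialize_X_one (c₀ c₁ : K) :
    specialize K c₀ c₁ (MvPowerSeries.X 1) = PowerSeries.C c₁ * PowerSeries.X := by
  have : (MvPowerSeries.X 1 : MvPowerSeries (Fin 2) K) = inVar 1 PowerSeries.X := by
    ext d
    change _ = inVar 1 _ d
    simp only [MvPowerSeries.coeff_X, inVar, PowerSeries.coeff_X]
    by_cases h : d = Finsupp.single 1 (d 1)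
    · rw [if_pos h, h]
      simp [(Finsupp.single_injective _).eq_iff]
    · rw [if_neg h, if_neg]
      rintro rfl
      simp at h
  rw [this, specialize_inVar_one]
  ext r
  simp only [rescaleArg, inv_inv, PowerSeries.coeff_mk, PowerSeries.coeff_C_mul,
    PowerSeries.coeff_X, smul_eq_mul]
  split_ifs with h <;> simp [h]

theorem specialize_smul (c₀ c₁ c : K) (F : MvPowerSeries (Fin 2) K) :
    specialize K c₀ c₁ (c • F) = c • specialize K c₀ c₁ F := by
  ext r
  simp [specialize, Finset.mul_sum, mul_left_comm]

theorem specialize_map (c₀ c₁ : K) (F : MvPowerSeries (Fin 2) K) :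
    specialize A c₀ c₁ (MvPowerSeries.map (algebraMap K A) F)
      = PowerSeries.map (algebraMap K A) (specialize K c₀ c₁ F) := by
  ext r
  simp [specialize, Algebra.smul_def]

/-- Series with coefficients in `K` are central. -/
theorem commute_map_algebraMap (r : PowerSeries K) (f : PowerSeries A) :
    Commute (PowerSeries.map (algebraMap K A) r) f := by
  ext n
  rw [PowerSeries.coeff_mul, PowerSeries.coeff_mul, ← Finset.Nat.sum_antidiagonal_swap]
  refine Finset.sum_congr rfl fun p _ => ?_
  simpa using Algebra.commutes _ _

theorem rMatrix_map {k k' ι : Type*} [CommRing k] [CommRing k'] [Algebra K k] [Algebra K k']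
    [LinearOrder ι] (q : K) (u v : k) (φ : k →+* k') (hφ : ∀ (c : K) x, φ (c • x) = c • φ x) :
    (rMatrix (ι := ι) q u v).map φ = rMatrix q (φ u) (φ v) := by
  ext a b
  simp only [rMatrix, Matrix.map_apply]
  split_ifs <;> simp [hφ, map_sub]

theorem rMatrix_smul {k ι : Type*} [CommRing k] [Algebra K k] [LinearOrder ι] (q : K) (c u v : k) :
    rMatrix (ι := ι) q (c * u) (c * v) = c • rMatrix q u v := by
  ext a b
  simp only [rMatrix, Matrix.smul_apply, smul_eq_mul]
  split_ifs <;> (try simp only [Algebra.smul_def]) <;> ring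

/-- At `u = q² v` the coefficient `q⁻¹ u - q v` vanishes, and the R-matrix degenerates to a multiple
of `1 - P^q`. -/
theorem rMatrix_sq_one {k ι : Type*} [CommRing k] [Algebra K k] [LinearOrder ι] {q : K}
    (hq : q ≠ 0) :
    rMatrix (ι := ι) q (algebraMap K k (q ^ 2)) 1
      = algebraMap K k (q ^ 2 - 1) • (1 - (qSwap q).map (algebraMap K k)) := by
  have h1 : ∀ c : K, c • algebraMap K k (q ^ 2) = algebraMap K k (c * q ^ 2) := fun c => by
    rw [Algebra.smul_def, ← map_mul]
  have h2 : ∀ c : K, c • (1 : k) = algebraMap K k c := fun c => by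
    rw [Algebra.smul_def, mul_one]
  ext ⟨a, b⟩ ⟨c, d⟩
  simp only [rMatrix, Matrix.smul_apply, Matrix.sub_apply, Matrix.map_apply, qSwap,
    Matrix.one_apply, Prod.mk.injEq, smul_eq_mul, h1, h2, apply_ite (algebraMap K k), map_zero]
  have e1 : q⁻¹ * q ^ 2 - q = 0 := by field_simp; ring
  have e2 : (q⁻¹ - q) * q ^ 2 = - (q ^ 2 - 1) * q := by field_simp; ring
  have e3 : q⁻¹ - q = - (q ^ 2 - 1) * q⁻¹ := by field_simp; ring
  by_cases hac : a = c ∧ b = d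
  · obtain ⟨rfl, rfl⟩ := hac
    by_cases hab : a = b
    · subst hab
      simp only [and_self, if_true, ← map_sub, e1, map_zero, map_one, sub_self, mul_zero]
    · simp [hab]
  · rw [if_neg hac, if_neg hac]
    by_cases had : a = d ∧ b = c
    · obtain ⟨rfl, rfl⟩ := had
      have hab : a ≠ b := fun h => hac ⟨h, h.symm⟩
      simp only [and_self, if_true, hab, if_false]
      split_ifs
      · rw [h1, e2, map_mul, map_neg]; ring
      · rw [h2]
        conv_lhs => rw [e3, map_mul, map_neg]
        ring
    · simp [had]

theorem partialTranspose_map {k k' ι : Type*} (φ : k → k')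
    (T : Matrix (ι × ι) (ι × ι) k) :
    (partialTranspose T).map φ = partialTranspose (T.map φ) := rfl

end Specialize

/-! ### The local relations between the factors of the Sklyanin bracket -/

section Core

variable {K A ι : Type*} [Field K] [Ring A] [Algebra K A] [LinearOrder ι] [Fintype ι]

/-- `R̄^t(q^(2c) u⁻²)` over `A`. -/
def siteT (K A ι : Type*) [Field K] [Ring A] [Algebra K A] [LinearOrder ι] (q : K) (c : ℕ) :
    Matrix (ι × ι) (ι × ι) (PowerSeries A) :=
  (rBarT q (PowerSeries.C (q ^ (2 * c)) * PowerSeries.X ^ 2)).map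
    (PowerSeries.map (algebraMap K A))

/-- The matrix `S(q^(-2c) u)`. -/
def siteS (q : K) (S : Matrix ι ι (PowerSeries A)) (c : ℕ) : Matrix ι ι (PowerSeries A) :=
  S.map (rescaleArg (q ^ (-2 * (c : ℤ))))

theorem algebraMap_powerSeries_eq (c : K) :
    algebraMap K (PowerSeries A) c = PowerSeries.map (algebraMap K A) (PowerSeries.C c) := by
  simp [PowerSeries.algebraMap_apply]

theorem one_sub_qSwapMap_eq (q : K) :
    (1 - qSwapMap (PowerSeries A) q : Matrix (ι × ι) (ι × ι) (PowerSeries A))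
      = (1 - qSwapOver (PowerSeries K) q).map (PowerSeries.map (algebraMap K A)) := by
  ext1 x y
  simp only [qSwapMap, qSwapOver, Matrix.sub_apply, Matrix.map_apply, map_sub,
    algebraMap_powerSeries_eq, Algebra.algebraMap_self,
    Matrix.one_apply]
  split_ifs <;> simp

theorem kronecker_map {B B' : Type*} [Ring B] [Ring B'] (φ : B →+* B') (S T : Matrix ι ι B) :
    (Matrix.kronecker S T).map φ = Matrix.kronecker (S.map φ) (T.map φ) := by
  ext ⟨a, b⟩ ⟨c, d⟩
  simp [Matrix.kronecker]

theorem matrix_one_map {B B' κ : Type*} [Ring B] [Ring B'] [DecidableEq κ] (φ : B →+* B') :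
    (1 : Matrix κ κ B).map φ = 1 :=
  Matrix.map_one _ (map_zero φ) (map_one φ)

theorem smul_mul_of_commute {B κ : Type*} [Ring B] [Fintype κ] {s : B}
    (hs : ∀ b, Commute s b) (X Y : Matrix κ κ B) : X * s • Y = s • (X * Y) := by
  ext i j
  simp only [Matrix.mul_apply, Matrix.smul_apply, smul_eq_mul, Finset.mul_sum]
  refine Finset.sum_congr rfl fun l _ => ?_
  rw [← mul_assoc, ← (hs (X i l)).eq, mul_assoc]

theorem smul_map_matrix {B B' κ : Type*} [Ring B] [Ring B'] (φ : B →+* B') (s : B)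
    (X : Matrix κ κ B) : (s • X).map φ = φ s • X.map φ := by
  ext i j
  simp

/-- The reflection equation at `u = q^(-2c) u`, `v = q^(-2c-2) u`. -/
theorem reflection_core {q : K} (hq : q ≠ 0) (hq2 : q ^ 2 ≠ 1) {S : Matrix ι ι (PowerSeries A)}
    (h : reflLHS q S = reflRHS q S) (c : ℕ) :
    (1 - qSwapMap (PowerSeries A) q) * (Matrix.kronecker (siteS q S c) 1 *
        siteT K A ι q (c + (c + 1)) * Matrix.kronecker 1 (siteS q S (c + 1)))
      = Matrix.kronecker 1 (siteS q S (c + 1)) * siteT K A ι q (c + (c + 1)) *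
          Matrix.kronecker (siteS q S c) 1 * (1 - qSwapMap (PowerSeries A) q) := by
  -- The substitution `u⁻¹ ↦ c₀ u⁻¹`, `v⁻¹ ↦ c₁ u⁻¹` gives the ratio `u/v = c₁/c₀ = q²` at which the
  -- R-matrix degenerates.
  set c₀ : K := q ^ (2 * c) with hc0
  set c₁ : K := q ^ (2 * (c + 1)) with hc1
  set σ := specialize A c₀ c₁ with hσ
  set μ := PowerSeries.map (algebraMap K A) with hμ
  have e0 : c₀⁻¹ = q ^ (-2 * (c : ℤ)) := by
    rw [hc0, ← zpow_natCast, ← zpow_neg]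
    push_cast
    ring_nf
  have e1 : c₁⁻¹ = q ^ (-2 * ((c + 1 : ℕ) : ℤ)) := by
    rw [hc1, ← zpow_natCast, ← zpow_neg]
    push_cast
    ring_nf
  have hS1 : (reflS1 S).map σ = Matrix.kronecker (siteS q S c) 1 := by
    rw [reflS1, kronecker_map, matrix_one_map]
    congr 1
    ext1 i j
    simp only [Matrix.map_apply, siteS, hσ, specialize_inVar_zero, e0]
  have hS2 : (reflS2 S).map σ = Matrix.kronecker 1 (siteS q S (c + 1)) := by
    rw [reflS2, kronecker_map, matrix_one_map]
    congr 1
    ext1 i j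
    simp only [Matrix.map_apply, siteS, hσ, specialize_inVar_one, e1]
  have hmap : ∀ T : Matrix (ι × ι) (ι × ι) (MvPowerSeries (Fin 2) K),
      (T.map (MvPowerSeries.map (algebraMap K A))).map σ
        = (T.map (specialize K c₀ c₁)).map μ := by
    intro T
    ext1 i j
    simp only [Matrix.map_apply, hσ, specialize_map, hμ]
  have hsmul : ∀ (b : K) x, specialize K c₀ c₁ (b • x) = b • specialize K c₀ c₁ x :=
    fun b x => specialize_smul c₀ c₁ b x
  set s : PowerSeries K := PowerSeries.C (c₀ * (q ^ 2 - 1)) * PowerSeries.X with hs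
  have hR : (reflR A q : Matrix (ι × ι) (ι × ι) _).map σ
      = μ s • (1 - qSwapMap (PowerSeries A) q) := by
    rw [reflR, hmap, rMatrix_map _ _ _ _ hsmul, specialize_X_zero, specialize_X_one,
      one_sub_qSwapMap_eq, ← smul_map_matrix]
    congr 1
    have : PowerSeries.C c₁ * PowerSeries.X
        = (PowerSeries.C c₀ * PowerSeries.X) * algebraMap K (PowerSeries K) (q ^ 2) := by
      rw [PowerSeries.algebraMap_apply, Algebra.algebraMap_self, RingHom.id_apply, hc1, mul_add,
        pow_add, map_mul, hc0, mul_one]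
      ring
    rw [this]
    have e := rMatrix_smul (ι := ι) q (PowerSeries.C c₀ * PowerSeries.X)
      (algebraMap K (PowerSeries K) (q ^ 2)) 1
    rw [mul_one] at e
    rw [e, rMatrix_sq_one hq, smul_smul, qSwapOver]
    congr 1
    rw [hs, PowerSeries.algebraMap_apply, Algebra.algebraMap_self, RingHom.id_apply, map_mul]
    ring
  set x : PowerSeries K := PowerSeries.C (q ^ (2 * (c + (c + 1)))) * PowerSeries.X ^ 2 with hx
  have hRt : (reflRt A q : Matrix (ι × ι) (ι × ι) _).map σ
      = (partialTranspose (rMatrix q x 1)).map μ := by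
    rw [reflRt, hmap, partialTranspose_map, rMatrix_map _ _ _ _ hsmul, map_mul, map_one,
      specialize_X_zero, specialize_X_one]
    have : PowerSeries.C c₀ * PowerSeries.X * (PowerSeries.C c₁ * PowerSeries.X) = x := by
      rw [hx, mul_add 2 c, pow_add, ← hc0, ← hc1, map_mul]
      ring
    rw [this]
  have main := congrArg (fun T => T.map σ) h
  simp only [reflLHS, reflRHS, Matrix.map_mul, hR, hS1, hS2, hRt] at main
  have hcomm : ∀ (r : PowerSeries K) (b : PowerSeries A), Commute (μ r) b :=
    fun r b => commute_map_algebraMap r b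
  rw [siteT, rBarT, smul_map_matrix, ← hx]
  set Rt := (partialTranspose (rMatrix (ι := ι) q x 1)).map μ
  set U := Matrix.kronecker (siteS q S c) (1 : Matrix ι ι (PowerSeries A))
  set V := Matrix.kronecker (1 : Matrix ι ι (PowerSeries A)) (siteS q S (c + 1))
  set G : Matrix (ι × ι) (ι × ι) (PowerSeries A) := 1 - qSwapMap (PowerSeries A) q
  have main' : μ s • (G * (U * Rt * V)) = μ s • (V * Rt * U * G) := by
    rw [smul_mul_of_commute (hcomm s)] at main
    simpa only [smul_mul_assoc, mul_assoc] using main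
  have hcancel : G * (U * Rt * V) = V * Rt * U * G := by
    generalize G * (U * Rt * V) = Y at main' ⊢
    generalize V * Rt * U * G = Y' at main' ⊢
    ext1 i j
    have hij := congrFun (congrFun main' i) j
    rw [Matrix.smul_apply, Matrix.smul_apply, smul_eq_mul, smul_eq_mul, hs, map_mul, hμ,
      PowerSeries.map_C, PowerSeries.map_X, mul_assoc, mul_assoc] at hij
    -- The common scalar is a constant times `X`, and the constant is invertible since `q² ≠ 1`; so
    -- it cancels.
    have hne : c₀ * (q ^ 2 - 1) ≠ 0 := mul_ne_zero (pow_ne_zero _ hq) (sub_ne_zero.2 hq2)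
    have hunit : IsUnit (PowerSeries.C (algebraMap K A (c₀ * (q ^ 2 - 1)))) :=
      (hne.isUnit.map (algebraMap K A)).map PowerSeries.C
    rw [hunit.mul_right_inj] at hij
    exact PowerSeries.X_mul_cancel hij
  rw [smul_mul_of_commute (hcomm _), smul_mul_of_commute (hcomm _)]
  simp only [smul_mul_assoc]
  rw [smul_mul_of_commute (hcomm _), hcancel]

theorem liftMat_map {Ω τ B B' : Type*} [DecidableEq Ω] [Ring B] [Ring B'] (φ : B →+* B')
    (get : Ω → τ) (put : Ω → τ → Ω) (T : Matrix τ τ B) :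
    liftMat get put (T.map φ) = (liftMat get put T).map φ := by
  ext I J
  simp only [liftMat, Matrix.map_apply]
  split_ifs <;> simp

/-- The Yang-Baxter equation on three sites. -/
theorem yangBaxter_siteT {q : K} (hq : q ≠ 0) (c : ℕ) {m : ℕ} {i j l : Fin m} (hij : i ≠ j)
    (hil : i ≠ l) (hjl : j ≠ l) :
    onPair i j (1 - qSwapMap (PowerSeries A) q) *
        (onPair i l (siteT K A ι q c) * onPair j l (siteT K A ι q (c + 1)))
      = onPair j l (siteT K A ι q (c + 1)) * onPair i l (siteT K A ι q c) *
          onPair i j (1 - qSwapMap (PowerSeries A) q) := by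
  refine onPair_triple_relation hij hil hjl ?_
  set x : PowerSeries K := PowerSeries.C (q ^ (2 * c)) * PowerSeries.X ^ 2 with hx
  have hx' : PowerSeries.C (q ^ (2 * (c + 1))) * PowerSeries.X ^ 2
      = algebraMap K (PowerSeries K) q ^ 2 * x := by
    rw [PowerSeries.algebraMap_apply, Algebra.algebraMap_self, RingHom.id_apply, mul_add,
      pow_add, map_mul, hx, mul_one, map_pow _ q 2]
    ring
  have h := yangBaxter_partialTranspose (ι := ι) hq x
  rw [siteT, siteT, hx', ← hx, one_sub_qSwapMap_eq]
  simp only [onPair12, onPair13, onPair23, liftMat_map, ← Matrix.map_mul]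
  congr 1
  -- The normalizing factors `(x - 1)⁻¹` are scalars and occur alike on both sides.
  simp only [rBarT, liftMat_smul]
  simp only [onPair12, onPair13, onPair23] at h
  simp only [smul_mul_assoc, mul_smul_comm, h]
  rw [smul_comm]

end Core

/-! ### Rescaling the spectral parameter -/

section Rescale

variable {K A : Type*} [Field K] [Ring A] [Algebra K A]

/-- `f(u) ↦ f(c u)` as a ring homomorphism. -/
def rescaleHom (A : Type*) [Ring A] [Algebra K A] (c : K) : PowerSeries A →+* PowerSeries A where
  toFun := rescaleArg c
  map_zero' := by ext; simp [rescaleArg]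
  map_add' f g := by ext; simp [rescaleArg]
  map_one' := by
    ext r
    simp only [rescaleArg, PowerSeries.coeff_mk, PowerSeries.coeff_one]
    split_ifs with h <;> simp [h]
  map_mul' f g := by
    ext r
    simp only [rescaleArg, PowerSeries.coeff_mk, PowerSeries.coeff_mul, Finset.smul_sum,
      smul_mul_smul_comm]
    refine Finset.sum_congr rfl fun p hp => ?_
    rw [← pow_add, Finset.HasAntidiagonal.mem_antidiagonal.1 hp]

theorem rescaleHom_apply (c : K) (f : PowerSeries A) : rescaleHom A c f = rescaleArg c f := rfl

theorem rescaleArg_rescaleArg (c d : K) (f : PowerSeries A) :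
    rescaleArg c (rescaleArg d f) = rescaleArg (c * d) f := by
  ext r
  simp [rescaleArg, smul_smul, mul_pow, mul_comm]

theorem rescaleArg_map (c : K) (f : PowerSeries K) :
    rescaleArg c (PowerSeries.map (algebraMap K A) f)
      = PowerSeries.map (algebraMap K A) (rescaleArg c f) := by
  ext r
  simp [rescaleArg, Algebra.smul_def]

theorem rescaleHom_algebraMap (c b : K) :
    rescaleHom A c (algebraMap K (PowerSeries A) b) = algebraMap K (PowerSeries A) b := by
  ext r
  simp only [rescaleHom_apply, rescaleArg, PowerSeries.coeff_mk, PowerSeries.algebraMap_apply,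
    PowerSeries.coeff_C]
  split_ifs with h <;> simp [h]

/-- The shift by `q^(-a)` inside the matrix and the one outside the determinant combine to
`q^(-2a)`, which is a displacement by `a` sites. -/
theorem siteS_shift {ι : Type*} [LinearOrder ι] {q : K} (hq : q ≠ 0) (S : Matrix ι ι (PowerSeries A))
    (a i : ℕ) :
    (siteS q (S.map (rescaleArg (q ^ (-(a : ℤ))))) i).map (rescaleHom A (q ^ (-(a : ℤ))))
      = siteS q S (a + i) := by
  ext1 k l
  simp only [siteS, Matrix.map_apply, rescaleHom_apply, rescaleArg_rescaleArg, ← zpow_add₀ hq]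
  congr 2
  push_cast
  ring

/-- Only the outer shift reaches `R̄ᵗ`. Its argument contains `u⁻²`, so the exponent `2c` grows by
`2a`, whereas displacing both sites by `a` would make it grow by `4a`. The discrepancy is what
passing from dimension `a + b` to dimension `b` accounts for. -/
theorem siteT_shift {ι : Type*} [LinearOrder ι] (q : K) (a c : ℕ) :
    (siteT K A ι q c).map (rescaleHom A (q ^ (-(a : ℤ)))) = siteT K A ι q (a + c) := by
  have h1 : ∀ (x : PowerSeries K) (hx : PowerSeries.constantCoeff x = 0),
      (rBarT (ι := ι) q x).map (rescaleHom K (q ^ (-(a : ℤ))))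
        = rBarT q (rescaleArg (q ^ (-(a : ℤ))) x) := by
    intro x hx
    have hx' : PowerSeries.constantCoeff (rescaleArg (q ^ (-(a : ℤ))) x) = 0 := by
      rw [← PowerSeries.coeff_zero_eq_constantCoeff_apply] at hx ⊢
      simp [rescaleArg, hx]
    have hsmul : ∀ (b : K) (f : PowerSeries K), rescaleHom K (q ^ (-(a : ℤ))) (b • f)
        = b • rescaleHom K (q ^ (-(a : ℤ))) f := by
      intro b f
      ext r
      simp [rescaleHom_apply, rescaleArg, mul_left_comm]
    rw [rBarT, rBarT, smul_map_matrix, partialTranspose_map, rMatrix_map _ _ _ _ hsmul, map_one,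
      rescaleHom_apply]
    congr 1
    have h2 := congrArg (rescaleHom K (q ^ (-(a : ℤ)))) (inv_sub_one_mul hx)
    rw [map_mul, map_sub, map_one, rescaleHom_apply, rescaleHom_apply] at h2
    have h3 := inv_sub_one_mul hx'
    calc rescaleArg (q ^ (-(a : ℤ))) (x - 1)⁻¹
        = rescaleArg (q ^ (-(a : ℤ))) (x - 1)⁻¹ * ((rescaleArg (q ^ (-(a : ℤ))) x - 1)⁻¹ *
            (rescaleArg (q ^ (-(a : ℤ))) x - 1)) := by rw [h3, mul_one]
      _ = (rescaleArg (q ^ (-(a : ℤ))) x - 1)⁻¹ := by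
          rw [mul_left_comm, h2, mul_one]
  have h4 : rescaleArg (q ^ (-(a : ℤ))) (PowerSeries.C (q ^ (2 * c)) * PowerSeries.X ^ 2)
      = PowerSeries.C (q ^ (2 * (a + c))) * PowerSeries.X ^ 2 := by
    ext r
    simp only [rescaleArg, PowerSeries.coeff_mk, PowerSeries.coeff_C_mul, PowerSeries.coeff_X_pow,
      zpow_neg, inv_inv, zpow_natCast, smul_eq_mul]
    split_ifs with h
    · rw [h]; ring
    · simp
  rw [siteT, siteT, ← h4, ← h1 _ (by simp)]
  ext1 i j
  simp only [Matrix.map_apply, rescaleHom_apply, rescaleArg_map]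

end Rescale

/-! ### The Sklyanin bracket and the Sklyanin determinant -/

section Bracket

variable {K A ι : Type*} [Field K] [Ring A] [Algebra K A] [LinearOrder ι] [Fintype ι] {m : ℕ}

/-- The Sklyanin bracket over a list of sites, with all sites shifted by `c`. -/
def siteBracket (q : K) (S : Matrix ι ι (PowerSeries A)) (m c : ℕ) (l : List (Fin m)) :
    Matrix (Fin m → ι) (Fin m → ι) (PowerSeries A) :=
  listBracket (fun i => onSite i (siteS q S (c + i)))
    (fun i j => onPair i j (siteT K A ι q ((c + i) + (c + j)))) l

theorem siteT_eq (q : K) (c : ℕ) :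
    siteT K A ι q c = (pairOp (rBarMat q (PowerSeries.C (q ^ (2 * c)) * PowerSeries.X ^ 2))).map
      (PowerSeries.map (algebraMap K A)) := by
  rw [siteT, rBarT_eq_pairOp]
  simp

theorem isPairLike_pairOp_map (F : Matrix ι ι (PowerSeries K)) :
    IsPairLike ((pairOp F).map (PowerSeries.map (algebraMap K A))) := by
  intro a b c d h1 h2
  rw [Matrix.map_apply, pairOp_apply_eq_zero h1 h2, map_zero]

theorem isPairLike_siteT (q : K) (c : ℕ) : IsPairLike (siteT K A ι q c) := by
  rw [siteT_eq]
  exact isPairLike_pairOp_map _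

theorem onPair_siteT_comm (q : K) (c : ℕ) (a b : Fin m) :
    onPair b a (siteT K A ι q c) = onPair a b (siteT K A ι q c) := by
  rw [siteT_eq, onPair_map, onPair_map, onPair_pairOp_comm]

theorem commute_siteT (q : K) (c : ℕ) (x y : ι × ι) (f : PowerSeries A) :
    Commute (siteT K A ι q c x y) f :=
  commute_map_algebraMap _ f

theorem commute_one_sub_qSwapMap (q : K) (x y : ι × ι) (f : PowerSeries A) :
    Commute ((1 - qSwapMap (PowerSeries A) q : Matrix (ι × ι) (ι × ι) _) x y) f := by
  rw [one_sub_qSwapMap_eq]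
  exact commute_map_algebraMap _ f

theorem siteLocal (q : K) (S : Matrix ι ι (PowerSeries A)) (m c : ℕ) :
    SiteLocal (fun i : Fin m => onSite i (siteS q S (c + i)))
      (fun i j => onPair i j (siteT K A ι q ((c + i) + (c + j)))) where
  st _ _ _ hab hac hbc := commute_onSite_onPair hab hac hbc fun _ _ _ _ =>
    (commute_siteT _ _ _ _ _).symm
  tt _ _ _ _ hab hcd hac had hbc hbd := commute_onPair_onPair hab hcd hac had hbc hbd
    fun _ _ _ _ => commute_siteT _ _ _ _ _

/-- The spectral parameters stay attached to the sites, so only the order of the two factors is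
exchanged. The parameters of `k` and `k'` differ by `q²`, which is the case covered by
`reflection_core` and, for every third site, by `yangBaxter_siteT`. -/
theorem siteBracket_swap {q : K} (hq : q ≠ 0) (hq2 : q ^ 2 ≠ 1) {S : Matrix ι ι (PowerSeries A)}
    (h : reflLHS q S = reflRHS q S) (c : ℕ) {k k' : Fin m} (hk : (k' : ℕ) = k + 1)
    {l l' : List (Fin m)} (hl : (l ++ k :: k' :: l').Nodup) :
    onPair k k' (1 - qSwapMap (PowerSeries A) q) * siteBracket q S m c (l ++ k :: k' :: l')
      = siteBracket q S m c (l ++ k' :: k :: l') *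
          onPair k k' (1 - qSwapMap (PowerSeries A) q) := by
  have hne : k ≠ k' := ne_of_val_eq_succ hk
  have hl' := hl
  rw [List.nodup_append] at hl'
  obtain ⟨-, h2, h3⟩ := hl'
  simp only [List.nodup_cons, List.mem_cons, not_or] at h2 h3
  refine mul_listBracket_swap (siteLocal q S m c) ?_ ?_ ?_ ?_ hl ?_ ?_
  · rw [onPair_siteT_comm, add_comm (c + (k' : ℕ))]
  · intro d hd hd'
    exact (commute_onSite_onPair hd hd' hne fun _ _ _ _ =>
      (commute_one_sub_qSwapMap _ _ _ _).symm).symm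
  · intro d e hde hd hd' he he'
    exact commute_onPair_onPair hne hde hd.symm he.symm hd'.symm he'.symm
      fun _ _ _ _ => commute_one_sub_qSwapMap _ _ _ _
  · have := congrArg (onPair (m := m) k k') (reflection_core hq hq2 h (c + k))
    simp only [onPair_mul hne, onPair_kronecker_one hne, onPair_one_kronecker hne] at this
    rw [hk]
    exact this
  · intro i hi
    have hik : k ≠ i := fun hh => h3 i hi k (Or.inl rfl) hh.symm
    have hik' : k' ≠ i := fun hh => h3 i hi k' (Or.inr (Or.inl rfl)) hh.symm
    have := yangBaxter_siteT (A := A) (ι := ι) hq ((c + i) + (c + k)) hne hik hik'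
    rw [onPair_siteT_comm _ _ i k, onPair_siteT_comm _ _ i k'] at this
    rw [hk]
    exact this
  · intro j hj
    have hjk : k ≠ j := fun hh => h2.1.2 (hh ▸ hj)
    have hjk' : k' ≠ j := fun hh => h2.2.1 (hh ▸ hj)
    have := yangBaxter_siteT (A := A) (ι := ι) hq ((c + k) + (c + j)) hne hjk hjk'
    have e : (c + k : ℕ) + (c + j) + 1 = c + k' + (c + j) := by omega
    rw [e] at this
    exact this

theorem exists_finRange_split {k k' : Fin m} (hk : (k' : ℕ) = k + 1) :
    ∃ l l' : List (Fin m), List.finRange m = l ++ k :: k' :: l' := by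
  refine ⟨(List.finRange m).take k, (List.finRange m).drop (k + 2), ?_⟩
  have h1 : (k : ℕ) < (List.finRange m).length := by simp
  have h2 : (k : ℕ) + 1 < (List.finRange m).length := by simp [← hk]
  conv_lhs => rw [← List.take_append_drop k (List.finRange m), List.drop_eq_getElem_cons h1,
    List.drop_eq_getElem_cons h2]
  congr 2
  · simp
  · congr 1
    simp [Fin.ext_iff, hk]

theorem sklyaninBracket_eq (q : K) (S : Matrix ι ι (PowerSeries A)) (m : ℕ) :
    sklyaninBracket q m S = siteBracket q S m 0 (List.finRange m) := by
  rw [siteBracket, ← prod_map_filter_lt_eq_listBracket _ _ _ (List.pairwise_lt_finRange m)]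
  simp only [sklyaninBracket, siteS, siteT, zero_add]

theorem map_siteBracket_rescale {q : K} (hq : q ≠ 0) (S : Matrix ι ι (PowerSeries A))
    (m a : ℕ) (l : List (Fin m)) :
    (siteBracket q (S.map (rescaleArg (q ^ (-(a : ℤ))))) m 0 l).map
        (rescaleHom A (q ^ (-(a : ℤ))))
      = listBracket (fun i => onSite i (siteS q S (a + i)))
          (fun i j => onPair i j (siteT K A ι q (a + (i + j)))) l := by
  have h := listBracket_map_hom
    ((rescaleHom A (q ^ (-(a : ℤ)))).mapMatrix : Matrix (Fin m → ι) (Fin m → ι) _ →+* _).toMonoidHom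
    (fun i => onSite i (siteS q (S.map (rescaleArg (q ^ (-(a : ℤ))))) (0 + i)))
    (fun i j => onPair i j (siteT K A ι q ((0 + i) + (0 + j)))) l
  refine h.trans (listBracket_congr (fun i _ => ?_) (fun i _ j _ => ?_))
  · change (onSite i _).map _ = _
    rw [← onSite_map, zero_add, siteS_shift hq]
  · change (onPair i j _).map _ = _
    rw [← onPair_map, zero_add, zero_add, siteT_shift]

variable [CharZero K]

/-- The factor `m!` cancels the denominator of the antisymmetrizer and leaves its row `η`. -/
theorem sdet_eq (q : K) (n : ℕ) (S : Matrix (Fin n) (Fin n) (PowerSeries A)) :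
    sdet q S = Matrix.vecMul (fun J => algebraMap K (PowerSeries A) (qEta q n J))
      (siteBracket q S n 0 (List.finRange n)) id := by
  rw [sdet, sklyaninMinor, sklyaninBracket_eq, Matrix.mul_apply, Finset.smul_sum, Matrix.vecMul,
    dotProduct]
  refine Finset.sum_congr rfl fun J _ => ?_
  rw [← smul_mul_assoc]
  congr 1
  rw [Matrix.map_apply, qAntisymmetrizer, qEta, Matrix.smul_apply, smul_eq_mul,
    PowerSeries.algebraMap_apply, ← map_nsmul, ← map_nsmul, nsmul_eq_mul, ← mul_assoc,
    mul_inv_cancel₀ (Nat.cast_ne_zero.2 (Nat.factorial_ne_zero n)), one_mul]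

end Bracket

/-! ### Inverses and restrictions of the factors of the Sklyanin bracket -/

section Factors

variable {K A ι ι' : Type*} [Field K] [Ring A] [Algebra K A] [LinearOrder ι] [Fintype ι]
  [LinearOrder ι'] [Fintype ι']

theorem siteS_mul (q : K) (S V : Matrix ι ι (PowerSeries A)) (c : ℕ) :
    siteS q (S * V) c = siteS q S c * siteS q V c :=
  Matrix.map_mul (f := rescaleHom A (q ^ (-2 * (c : ℤ))))

theorem siteS_one (q : K) (c : ℕ) : siteS q (1 : Matrix ι ι (PowerSeries A)) c = 1 :=
  matrix_one_map (rescaleHom A (q ^ (-2 * (c : ℤ))))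

theorem siteT_submatrix (q : K) (c : ℕ) {f : ι' → ι} (hf : StrictMono f) :
    (siteT K A ι q c).submatrix (Prod.map f f) (Prod.map f f) = siteT K A ι' q c := by
  ext1 x y
  simp [siteT, rBarT, partialTranspose, rMatrix, hf.injective.eq_iff, hf.lt_iff_lt]

/-- The inverse of `siteT K A (Fin p) q c` if `q ^ (2 p) r = q ^ (2 c)`. -/
def siteTInv (K A : Type*) [Field K] [Ring A] [Algebra K A] (p : ℕ) (q r : K) :
    Matrix (Fin p × Fin p) (Fin p × Fin p) (PowerSeries A) :=
  (pairOp (rBarInvMat q (PowerSeries.C r * PowerSeries.X ^ 2))).map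
    (PowerSeries.map (algebraMap K A))

theorem siteT_mul_siteTInv {p c : ℕ} {q r : K} (hq : q ≠ 0) (hr : q ^ (2 * p) * r = q ^ (2 * c)) :
    siteT K A (Fin p) q c * siteTInv K A p q r = 1 := by
  rw [siteT_eq, siteTInv, ← Matrix.map_mul, pairOp_mul, ← hr, map_mul, mul_assoc,
    rBarMat_mul_rBarInvMat hq (by simp), pairOp_one, matrix_one_map]

theorem siteTInv_mul_siteT {p c : ℕ} {q r : K} (hq : q ≠ 0) (hr : q ^ (2 * p) * r = q ^ (2 * c)) :
    siteTInv K A p q r * siteT K A (Fin p) q c = 1 := by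
  rw [siteT_eq, siteTInv, ← Matrix.map_mul, pairOp_mul, ← hr, map_mul, mul_assoc,
    mul_eq_one_comm.1 (rBarMat_mul_rBarInvMat hq (by simp)), pairOp_one, matrix_one_map]

theorem isPairLike_siteTInv (p : ℕ) (q r : K) : IsPairLike (siteTInv K A p q r) :=
  isPairLike_pairOp_map _

/-- The parameter `r` is kept while the dimension drops from `n` to `b`: the left side restricts the
inverse of `R̄ᵗ` at `q^(2n) r u⁻²`, the right side inverts `R̄ᵗ` at `q^(2b) r u⁻²`. -/
theorem siteTInv_submatrix {n b : ℕ} {q : K} (hq : q ≠ 0) (r : K) {g : Fin b → Fin n} (c : ℕ)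
    (hg : ∀ i, (g i : ℕ) = c + i) :
    (siteTInv K A n q r).submatrix (Prod.map g g) (Prod.map g g) = siteTInv K A b q r := by
  have hinj : Function.Injective g := fun i j hij => by
    have := congrArg Fin.val hij
    rw [hg, hg] at this
    exact Fin.ext (by omega)
  rw [siteTInv, siteTInv, Matrix.submatrix_map, pairOp_submatrix hinj,
    rBarInvMat_submatrix hq _ c hg]

end Factors

/-! ### Restriction of `1 - P^q`, and tensors fixed by `R̄ᵗ`. -/

section Compress

variable {K A : Type*} [Field K] [Ring A] [Algebra K A] {ι ι' : Type*} [LinearOrder ι] [Fintype ι]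
  [LinearOrder ι'] [Fintype ι'] {m : ℕ}

/-- The operator `onPair k l (1 - P^q)` commutes with restriction along `g`. -/
theorem restrictMat_mul_onPair_one_sub (q : K) {g : ι' → ι} (hg : StrictMono g) (k l : Fin m) :
    restrictMat (PowerSeries A) m g * onPair k l (1 - qSwapMap (PowerSeries A) q)
      = onPair k l (1 - qSwapMap (PowerSeries A) q) * restrictMat (PowerSeries A) m g := by
  refine restrictMat_mul hg.injective (fun I L => ?_) (fun I J hJ => ?_)
  · rw [onPair_comp hg.injective]
    congr 1
    ext1 x y
    simp only [Matrix.submatrix_apply, Matrix.sub_apply, Matrix.one_apply, qSwapMap,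
      Matrix.map_apply, (hg.injective.prodMap hg.injective).eq_iff]
    exact congrArg (fun r => _ - algebraMap K _ r) (qSwap_apply_strictMono q hg _ _ _ _)
  · simp only [onPair]
    split_ifs with h
    · rw [Matrix.sub_apply, Matrix.one_apply_ne, qSwapMap, Matrix.map_apply, qSwap, if_neg,
        map_zero, sub_zero]
      · rintro ⟨h1, h2⟩
        refine hJ (exists_eq_comp fun i => ?_)
        by_cases hi : i = k
        · exact ⟨I l, by rw [hi]; exact h2⟩
        · by_cases hi' : i = l
          · exact ⟨I k, by rw [hi']; exact h1⟩
          · exact ⟨I i, h i hi hi'⟩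
      · intro hh
        rw [Prod.ext_iff] at hh
        refine hJ (exists_eq_comp fun i => ?_)
        by_cases hi : i = k
        · exact ⟨I k, by rw [hi]; exact hh.1⟩
        · by_cases hi' : i = l
          · exact ⟨I l, by rw [hi']; exact hh.2⟩
          · exact ⟨I i, h i hi hi'⟩
    · rfl

theorem onPair_one_sub_mul_restrictMat_transpose (q : K) {g : ι' → ι} (hg : StrictMono g)
    (k l : Fin m) :
    onPair k l (1 - qSwapMap (PowerSeries A) q) * (restrictMat (PowerSeries A) m g).transpose
      = (restrictMat (PowerSeries A) m g).transpose *
          onPair k l (1 - qSwapMap (PowerSeries A) q) := by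
  refine mul_restrictMat_transpose hg.injective (fun I L => ?_) (fun I J hJ => ?_)
  · rw [onPair_comp hg.injective]
    congr 1
    ext1 x y
    simp only [Matrix.submatrix_apply, Matrix.sub_apply, Matrix.one_apply, qSwapMap,
      Matrix.map_apply, (hg.injective.prodMap hg.injective).eq_iff]
    exact congrArg (fun r => _ - algebraMap K _ r) (qSwap_apply_strictMono q hg _ _ _ _)
  · simp only [onPair]
    split_ifs with h
    · rw [Matrix.sub_apply, Matrix.one_apply_ne, qSwapMap, Matrix.map_apply, qSwap, if_neg,
        map_zero, sub_zero]
      · rintro ⟨h1, h2⟩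
        refine hJ (exists_eq_comp fun i => ?_)
        by_cases hi : i = k
        · exact ⟨I l, by rw [hi]; exact h1.symm⟩
        · by_cases hi' : i = l
          · exact ⟨I k, by rw [hi']; exact h2.symm⟩
          · exact ⟨I i, (h i hi hi').symm⟩
      · intro hh
        rw [Prod.ext_iff] at hh
        refine hJ (exists_eq_comp fun i => ?_)
        by_cases hi : i = k
        · exact ⟨I k, by rw [hi]; exact hh.1.symm⟩
        · by_cases hi' : i = l
          · exact ⟨I l, by rw [hi']; exact hh.2.symm⟩
          · exact ⟨I i, (h i hi hi').symm⟩
    · rfl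

/-- A product of operators, all of which fix the basis vector `J`, fixes `J`. -/
theorem listCross_apply_of_fixes {B Ω κ : Type*} [Ring B] [Fintype Ω] [DecidableEq Ω] {J : Ω}
    {t : κ → κ → Matrix Ω Ω B} {l l' : List κ}
    (h : ∀ a ∈ l, ∀ b ∈ l', ∀ I, t a b I J = (1 : Matrix Ω Ω B) I J) (I : Ω) :
    listCross t l l' I J = (1 : Matrix Ω Ω B) I J := by
  have hmul : ∀ X Y : Matrix Ω Ω B, (∀ I, X I J = (1 : Matrix Ω Ω B) I J) →
      (∀ I, Y I J = (1 : Matrix Ω Ω B) I J) → ∀ I, (X * Y) I J = (1 : Matrix Ω Ω B) I J := by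
    intro X Y hX hY I
    rw [Matrix.mul_apply, Finset.sum_congr rfl fun L _ => by rw [hY L]]
    simpa [Matrix.one_apply] using hX I
  induction l generalizing I with
  | nil => rfl
  | cons a l ih =>
    refine hmul _ _ ?_ (fun I => ih (fun a ha => h a (List.mem_cons_of_mem _ ha)) I) I
    have h' := h a List.mem_cons_self
    clear ih h
    induction l' with
    | nil => exact fun _ => rfl
    | cons b l' ih' =>
      intro I
      rw [List.map_cons, List.prod_cons]
      exact hmul _ _ (h' b List.mem_cons_self)
        (ih' fun b hb => h' b (List.mem_cons_of_mem _ hb)) I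

/-- `R̄ᵗ` differs from the identity only on the span of the `e_x ⊗ e_x`. -/
theorem onPair_siteT_apply_of_ne (q : K) (c : ℕ) {i j : Fin m} {J : Fin m → ι} (hJ : J i ≠ J j)
    (I : Fin m → ι) :
    onPair i j (siteT K A ι q c) I J = (1 : Matrix (Fin m → ι) (Fin m → ι) (PowerSeries A)) I J := by
  rw [siteT_eq, onPair]
  simp only [Matrix.map_apply, pairOp, hJ, and_false, if_false, Prod.mk.injEq, Matrix.one_apply]
  by_cases h : I = J
  · simp [h]
  · rw [if_neg h]
    split_ifs with h1 h2
    · refine (h (funext fun k => ?_)).elim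
      by_cases hi : k = i
      · rw [hi]; exact h2.1
      · by_cases hj : k = j
        · rw [hj]; exact h2.2
        · exact h1 k hi hj
    · exact map_zero _
    · rfl

end Compress

/-! ### The factorization of the Sklyanin determinant -/

section Schur

variable {B : Type*} [Ring B] {a b n : ℕ} {f : Fin a → Fin n} {g : Fin b → Fin n}

theorem bijective_append (hn : n = a + b) (hf : Function.Injective f)
    (hg : Function.Injective g) (hfg : ∀ i j, f i ≠ g j) :
    Function.Bijective (Fin.append f g) := by
  subst hn
  refine Finite.injective_iff_bijective.1 (Fin.append_injective_iff.2 ⟨hf, hg, hfg⟩)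

theorem submatrix_mul_of_append {p r : ℕ} (h : Function.Bijective (Fin.append f g))
    (X Y : Matrix (Fin n) (Fin n) B) (u : Fin p → Fin n) (v : Fin r → Fin n) :
    (X * Y).submatrix u v = X.submatrix u f * Y.submatrix f v + X.submatrix u g * Y.submatrix g v := by
  ext i j
  rw [Matrix.submatrix_apply, Matrix.mul_apply, ← h.sum_comp, Fin.sum_univ_add]
  simp [Matrix.mul_apply]

/-- The Schur complement of a block is inverse to the complementary block of the inverse. -/
theorem submatrix_mul_schur (h : Function.Bijective (Fin.append f g))
    {S V : Matrix (Fin n) (Fin n) B} (hV : V * S = 1) (hf : IsUnit (S.submatrix f f)) :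
    V.submatrix g g * (S.submatrix g g
      - S.submatrix g f * Ring.inverse (S.submatrix f f) * S.submatrix f g) = 1 := by
  have h1 := submatrix_mul_of_append h V S g f
  have h2 := submatrix_mul_of_append h V S g g
  have hne : ∀ i j, g i ≠ f j := by
    intro i j hij
    have : Fin.append f g (Fin.natAdd a i) = Fin.append f g (Fin.castAdd b j) := by simpa using hij
    have := congrArg Fin.val (h.1 this)
    simp at this
    omega
  have hginj : Function.Injective g := fun i j hij => by
    have : Fin.append f g (Fin.natAdd a i) = Fin.append f g (Fin.natAdd a j) := by simpa using hij
    simpa using h.1 this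
  rw [hV] at h1 h2
  have e1 : (1 : Matrix (Fin n) (Fin n) B).submatrix g f = 0 := by
    ext i j
    simp [Matrix.one_apply_ne (hne i j)]
  rw [e1] at h1
  rw [Matrix.submatrix_one g hginj] at h2
  have h3 : V.submatrix g g * S.submatrix g f = -(V.submatrix g f * S.submatrix f f) :=
    eq_neg_of_add_eq_zero_right h1.symm
  rw [Matrix.mul_sub, ← Matrix.mul_assoc, ← Matrix.mul_assoc, h3, Matrix.neg_mul, Matrix.neg_mul,
    Matrix.mul_assoc (V.submatrix g f), Ring.mul_inverse_cancel _ hf, Matrix.mul_one, h2]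
  abel

end Schur

/-! ### Brackets acting on `η`: evaluation, restriction and inversion. -/

section Factorization

variable {K A : Type*} [Field K] [CharZero K] [Ring A] [Algebra K A]

/-- The row vector `η`, over `A`. -/
def qEtaVec (A : Type*) [Ring A] [Algebra K A] (q : K) (n : ℕ) : (Fin n → Fin n) → PowerSeries A :=
  fun J => algebraMap K (PowerSeries A) (qEta q n J)

theorem qEtaVec_id (q : K) (n : ℕ) : qEtaVec A q n id = 1 := by
  rw [qEtaVec, qEta_id, map_one]

theorem isQAntisymm_qEtaVec {q : K} (hq : q ≠ 0) (n : ℕ) : IsQAntisymm q (qEtaVec A q n) :=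
  (isQAntisymm_qEta hq n).algebraMap_comp

/-- An operator that preserves antisymmetry acts on `η` by a scalar. -/
theorem vecMul_qEtaVec {q : K} (hq : q ≠ 0) {n : ℕ}
    {X : Matrix (Fin n → Fin n) (Fin n → Fin n) (PowerSeries A)}
    (hX : ∀ k l : Fin n, (l : ℕ) = k + 1 → ∃ X' : Matrix (Fin n → Fin n) (Fin n → Fin n) _,
      onPair k l (1 - qSwapMap (PowerSeries A) q) * X
        = X' * onPair k l (1 - qSwapMap (PowerSeries A) q)) :
    Matrix.vecMul (qEtaVec A q n) X
      = fun J => Matrix.vecMul (qEtaVec A q n) X id * qEtaVec A q n J :=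
  funext fun J => ((isQAntisymm_qEtaVec hq n).vecMul hq hX).eq_mul_qEta hq J

/-- Any two adjacent sites are neighbours in the ordered product, so the exchange relation applies
to each of them, antisymmetry is preserved, and the scalar is read off at `id`. -/
theorem vecMul_qEtaVec_siteBracket {q : K} (hq : q ≠ 0) (hq2 : q ^ 2 ≠ 1) {n : ℕ}
    {S : Matrix (Fin n) (Fin n) (PowerSeries A)} (h : reflLHS q S = reflRHS q S) :
    Matrix.vecMul (qEtaVec A q n) (siteBracket q S n 0 (List.finRange n))
      = fun J => sdet q S * qEtaVec A q n J := by
  rw [vecMul_qEtaVec hq, sdet_eq]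
  · rfl
  · intro k l hkl
    obtain ⟨l₁, l₂, hl⟩ := exists_finRange_split hkl
    have hnd := List.nodup_finRange n
    rw [hl] at hnd ⊢
    exact ⟨_, siteBracket_swap hq hq2 h 0 hkl hnd⟩

theorem vecMul_smul_left {B Ω : Type*} [Ring B] [Fintype Ω] (s : B) (w : Ω → B)
    (X : Matrix Ω Ω B) (J : Ω) :
    Matrix.vecMul (fun I => s * w I) X J = s * Matrix.vecMul w X J := by
  simp [Matrix.vecMul, dotProduct, Finset.mul_sum, mul_assoc]

theorem commute_qEtaVec (q : K) (n : ℕ) (J : Fin n → Fin n) (x : PowerSeries A) :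
    Commute (qEtaVec A q n J) x :=
  Algebra.commutes _ _

variable {a b : ℕ} {f : Fin a → Fin (a + b)} {g : Fin b → Fin (a + b)} {q : K}

/-- A value of `x` outside the range of `f` is a value of `g`, so `(x, g)` repeats an index. -/
theorem qEtaVec_append_eq_zero_left (hq : q ≠ 0) (h : Function.Bijective (Fin.append f g))
    {x : Fin a → Fin (a + b)} (hx : ¬ ∃ I, x = f ∘ I) :
    qEtaVec A q (a + b) (Fin.append x g) = 0 := by
  refine (isQAntisymm_qEtaVec hq _).eq_zero_of_not_injective hq fun hinj => hx ?_
  refine exists_eq_comp fun k => ?_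
  obtain ⟨i, hi⟩ := h.2 (x k)
  induction i using Fin.addCases with
  | left i => exact ⟨i, by simpa using hi⟩
  | right i =>
    have : Fin.append x g (Fin.natAdd a i) = Fin.append x g (Fin.castAdd b k) := by simpa using hi
    have := congrArg Fin.val (hinj this)
    simp at this
    omega

theorem qEtaVec_append_eq_zero_right (hq : q ≠ 0) (h : Function.Bijective (Fin.append f g))
    {x : Fin b → Fin (a + b)} (hx : ¬ ∃ I, x = g ∘ I) :
    qEtaVec A q (a + b) (Fin.append f x) = 0 := by
  refine (isQAntisymm_qEtaVec hq _).eq_zero_of_not_injective hq fun hinj => hx ?_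
  refine exists_eq_comp fun k => ?_
  obtain ⟨i, hi⟩ := h.2 (x k)
  induction i using Fin.addCases with
  | right i => exact ⟨i, by simpa using hi⟩
  | left i =>
    have : Fin.append f x (Fin.castAdd b i) = Fin.append f x (Fin.natAdd a k) := by simpa using hi
    have := congrArg Fin.val (hinj this)
    simp at this
    omega

theorem extend_castAdd_append {α : Type*} (x f : Fin a → α) (g : Fin b → α) :
    Function.extend (Fin.castAdd b) x (Fin.append f g) = Fin.append x g := by
  funext i
  induction i using Fin.addCases with
  | left i => rw [(Fin.castAdd_injective a b).extend_apply, Fin.append_left]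
  | right i =>
    rw [Function.extend_apply', Fin.append_right, Fin.append_right]
    rintro ⟨j, hj⟩
    have := congrArg Fin.val hj
    simp at this
    omega

theorem extend_natAdd_append {α : Type*} (x g : Fin b → α) (f : Fin a → α) :
    Function.extend (Fin.natAdd a) x (Fin.append f g) = Fin.append f x := by
  funext i
  induction i using Fin.addCases with
  | right i => rw [(Fin.natAdd_injective b a).extend_apply, Fin.append_right]
  | left i =>
    rw [Function.extend_apply', Fin.append_left, Fin.append_left]
    rintro ⟨j, hj⟩
    have := congrArg Fin.val hj
    simp at this
    omega

/-- Evaluation at `(f, g)` of an operator on the first `a` sites. -/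
theorem vecMul_liftMat_castAdd (hq : q ≠ 0) (hf : StrictMono f)
    (h : Function.Bijective (Fin.append f g))
    (X : Matrix (Fin a → Fin (a + b)) (Fin a → Fin (a + b)) (PowerSeries A)) :
    Matrix.vecMul (qEtaVec A q (a + b))
        (liftMat (fun I => I ∘ Fin.castAdd b) (fun I x => Function.extend (Fin.castAdd b) x I) X)
        (Fin.append f g)
      = qEtaVec A q (a + b) (Fin.append f g) * Matrix.vecMul (qEtaVec A q a)
          (restrictMat (PowerSeries A) a f * X * (restrictMat (PowerSeries A) a f).transpose) id := by
  rw [(isLens_comp (Fin.castAdd_injective a b)).vecMul_liftMat, Matrix.vecMul, dotProduct,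
    Finset.mul_sum]
  -- The rows that contribute agree with `(f, g)` on the last `b` sites. Among these `(x, g)`, `η`
  -- vanishes unless `x = f ∘ I`, and there it splits off the entry of the small `η` at `I`.
  refine (Fintype.sum_of_injective (fun I : Fin a → Fin a => f ∘ I) hf.injective.comp_left _ _
    (fun x hx => ?_) fun I => ?_).symm
  · rw [extend_castAdd_append, qEtaVec_append_eq_zero_left hq h fun ⟨I, hI⟩ => hx ⟨I, hI.symm⟩,
      zero_mul]
  · rw [extend_castAdd_append, restrictMat_mul_mul_transpose_apply, ← mul_assoc]
    congr 1
    · exact (map_mul _ _ _).symm.trans (congrArg _ (qEta_append_left hq hf g I).symm)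
    · congr 1
      funext i
      simp

/-- Evaluation at `(f, g)` of an operator on the last `b` sites. -/
theorem vecMul_liftMat_natAdd (hq : q ≠ 0) (hg : StrictMono g)
    (h : Function.Bijective (Fin.append f g))
    (X : Matrix (Fin b → Fin (a + b)) (Fin b → Fin (a + b)) (PowerSeries A)) :
    Matrix.vecMul (qEtaVec A q (a + b))
        (liftMat (fun I => I ∘ Fin.natAdd a) (fun I x => Function.extend (Fin.natAdd a) x I) X)
        (Fin.append f g)
      = qEtaVec A q (a + b) (Fin.append f g) * Matrix.vecMul (qEtaVec A q b)
          (restrictMat (PowerSeries A) b g * X * (restrictMat (PowerSeries A) b g).transpose) id := by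
  rw [(isLens_comp (Fin.natAdd_injective b a)).vecMul_liftMat, Matrix.vecMul, dotProduct,
    Finset.mul_sum]
  refine (Fintype.sum_of_injective (fun I : Fin b → Fin b => g ∘ I) hg.injective.comp_left _ _
    (fun x hx => ?_) fun I => ?_).symm
  · rw [extend_natAdd_append, qEtaVec_append_eq_zero_right hq h fun ⟨I, hI⟩ => hx ⟨I, hI.symm⟩,
      zero_mul]
  · rw [extend_natAdd_append, restrictMat_mul_mul_transpose_apply, ← mul_assoc]
    congr 1
    · exact (map_mul _ _ _).symm.trans (congrArg _ (qEta_append_right hq f hg I).symm)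
    · congr 1
      funext i
      simp

/-- The bracket over the image of an injection of sites. -/
theorem siteBracket_map_list {ι : Type*} [LinearOrder ι] [Fintype ι] {m p : ℕ} {φ : Fin p → Fin m}
    (hφ : Function.Injective φ) (c : ℕ) (hc : ∀ i, (φ i : ℕ) = c + i)
    (S : Matrix ι ι (PowerSeries A)) (l : List (Fin p)) :
    siteBracket q S m 0 (l.map φ)
      = liftMat (fun I => I ∘ φ) (fun I x => Function.extend φ x I) (siteBracket q S p c l) := by
  have e := listBracket_map_hom
    ((isLens_comp (ι := ι) hφ).liftHom (PowerSeries A)).toMonoidHom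
    (fun i => onSite i (siteS q S (c + i)))
    (fun i j => onPair i j (siteT K A ι q ((c + i) + (c + j)))) l
  rw [siteBracket, listBracket_map_list]
  refine .trans ?_ e.symm
  refine listBracket_congr (fun i _ => ?_) (fun i _ j _ => ?_)
  · refine .trans ?_ (liftMat_comp_onSite hφ i _).symm
    rw [hc, zero_add]
  · refine .trans ?_ (liftMat_comp_onPair hφ i j _).symm
    rw [hc, hc, zero_add, zero_add]

/-- The coefficients of `R̄ᵗ` depend on the basis indices only through their order, so restriction
along any increasing `φ` gives the smaller `R̄ᵗ` at the same argument. -/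
theorem restrict_siteBracket {ι ι' : Type*} [LinearOrder ι] [Fintype ι] [LinearOrder ι']
    [Fintype ι'] {m c : ℕ} {φ : ι' → ι} (hφ : StrictMono φ) (S : Matrix ι ι (PowerSeries A))
    {l : List (Fin m)} (hl : l.Nodup) :
    restrictMat (PowerSeries A) m φ * siteBracket q S m c l * (restrictMat (PowerSeries A) m φ).transpose
      = siteBracket q (S.submatrix φ φ) m c l := by
  rw [siteBracket, (cornerData hφ.injective _ _ fun _ _ _ => isPairLike_siteT q _).mul_listBracket_mul
    hl]
  simp only [siteT_submatrix q _ hφ]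
  rfl

/-- The inverse of the bracket over the sites of `l`, for a matrix with inverse `V`. -/
def siteBracketInv (q : K) {p : ℕ} (V : Matrix (Fin p) (Fin p) (PowerSeries A)) (m c : ℕ)
    (r : ℕ → K) (l : List (Fin m)) :
    Matrix (Fin m → Fin p) (Fin m → Fin p) (PowerSeries A) :=
  listBracketRev (fun i => onSite i (siteS q V (c + i)))
    (fun i j => onPair i j (siteTInv K A p q (r (i + j)))) l

theorem onSite_siteS_mul {p m : ℕ} {S V : Matrix (Fin p) (Fin p) (PowerSeries A)} (h : S * V = 1)
    (i : Fin m) (c : ℕ) : onSite i (siteS q S c) * onSite i (siteS q V c) = 1 := by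
  rw [← onSite_mul, ← siteS_mul, h, siteS_one, onSite_one]

theorem siteBracket_mul_siteBracketInv (hq : q ≠ 0) {p m c : ℕ} {r : ℕ → K}
    (hr : ∀ i, q ^ (2 * p) * r i = q ^ (2 * (2 * c + i)))
    {S V : Matrix (Fin p) (Fin p) (PowerSeries A)} (h : S * V = 1) {l : List (Fin m)}
    (hl : l.Nodup) : siteBracket q S m c l * siteBracketInv q V m c r l = 1 := by
  refine listBracket_mul_listBracketRev hl (fun i _ => onSite_siteS_mul h i _)
    (fun i _ j _ hij => ?_)
  rw [← onPair_mul hij, siteT_mul_siteTInv hq, onPair_one hij]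
  rw [hr]
  congr 2
  ring

theorem siteBracketInv_mul_siteBracket (hq : q ≠ 0) {p m c : ℕ} {r : ℕ → K}
    (hr : ∀ i, q ^ (2 * p) * r i = q ^ (2 * (2 * c + i)))
    {S V : Matrix (Fin p) (Fin p) (PowerSeries A)} (h : V * S = 1) {l : List (Fin m)}
    (hl : l.Nodup) : siteBracketInv q V m c r l * siteBracket q S m c l = 1 := by
  refine listBracketRev_mul_listBracket hl (fun i _ => onSite_siteS_mul h i _)
    (fun i _ j _ hij => ?_)
  rw [← onPair_mul hij, siteTInv_mul_siteT hq, onPair_one hij]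
  rw [hr]
  congr 2
  ring

/-- Here the distances between indices matter too, so `φ` is required to enumerate an interval. The
`r` is unchanged, but in dimension `p` it belongs to another argument of `R̄ᵗ`. -/
theorem restrict_siteBracketInv (hq : q ≠ 0) {n p m c : ℕ} {φ : Fin p → Fin n} (d : ℕ)
    (hφ : StrictMono φ) (hd : ∀ i, (φ i : ℕ) = d + i) (r : ℕ → K)
    (V : Matrix (Fin n) (Fin n) (PowerSeries A)) {l : List (Fin m)} (hl : l.Nodup) :
    restrictMat (PowerSeries A) m φ * siteBracketInv q V m c r l * (restrictMat (PowerSeries A) m φ).transpose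
      = siteBracketInv q (V.submatrix φ φ) m c r l := by
  rw [siteBracketInv, (cornerData hφ.injective _ _
    fun _ _ _ => isPairLike_siteTInv _ q _).mul_listBracketRev_mul hl]
  simp only [siteTInv_submatrix hq _ d hd]
  rfl

/-- The inverse of the bracket satisfies the exchange relation as well. -/
theorem siteBracketInv_swap (hq : q ≠ 0) (hq2 : q ^ 2 ≠ 1) {n m c : ℕ} {r : ℕ → K}
    (hr : ∀ i, q ^ (2 * n) * r i = q ^ (2 * (2 * c + i)))
    {S V : Matrix (Fin n) (Fin n) (PowerSeries A)} (h : reflLHS q S = reflRHS q S)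
    (hSV : S * V = 1) (hVS : V * S = 1) {k k' : Fin m} (hk : (k' : ℕ) = k + 1) :
    ∃ Y, onPair k k' (1 - qSwapMap (PowerSeries A) q) *
        siteBracketInv q V m c r (List.finRange m)
      = Y * onPair k k' (1 - qSwapMap (PowerSeries A) q) := by
  obtain ⟨l₁, l₂, hl⟩ := exists_finRange_split hk
  have hnd := List.nodup_finRange m
  have hnd' : (l₁ ++ k' :: k :: l₂).Nodup := by
    rw [hl] at hnd
    exact ((List.Perm.swap k' k l₂).append_left l₁).nodup hnd
  -- With `X'` the bracket in the exchanged order, `G X = X' G` becomes `G X⁻¹ = X'⁻¹ G`.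
  refine ⟨siteBracketInv q V m c r (l₁ ++ k' :: k :: l₂), ?_⟩
  have h1 := siteBracket_mul_siteBracketInv hq hr hSV hnd
  have h2 := siteBracketInv_mul_siteBracket hq hr hVS hnd'
  rw [hl] at hnd h1 ⊢
  have h3 := siteBracket_swap hq hq2 h c hk hnd
  set G : Matrix (Fin m → Fin n) (Fin m → Fin n) (PowerSeries A) :=
    onPair k k' (1 - qSwapMap (PowerSeries A) q)
  calc G * siteBracketInv q V m c r (l₁ ++ k :: k' :: l₂)
      = siteBracketInv q V m c r (l₁ ++ k' :: k :: l₂) *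
          (siteBracket q S m c (l₁ ++ k' :: k :: l₂) * G) *
          siteBracketInv q V m c r (l₁ ++ k :: k' :: l₂) := by
        rw [← mul_assoc, h2, one_mul]
    _ = _ := by rw [← h3, mul_assoc, mul_assoc, h1, mul_one]

theorem mul_conj_eq {B Ω Ω' : Type*} [Ring B] [Fintype Ω] [Fintype Ω'] {R : Matrix Ω' Ω B}
    {R' : Matrix Ω Ω' B} {G X Y : Matrix Ω Ω B} {G' : Matrix Ω' Ω' B} (h₁ : R * G = G' * R)
    (h₂ : G * R' = R' * G') (h : G * X = Y * G) : G' * (R * X * R') = R * Y * R' * G' := by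
  rw [← Matrix.mul_assoc, ← Matrix.mul_assoc, ← h₁, Matrix.mul_assoc R, h, Matrix.mul_assoc R,
    Matrix.mul_assoc Y, h₂, Matrix.mul_assoc R, Matrix.mul_assoc R, Matrix.mul_assoc Y]

/-- `1 - P` commutes with restriction along an increasing map, so the exchange relation of the
inverse bracket descends to its block. This replaces a reflection equation for the Schur complement.
-/
theorem restrict_siteBracketInv_swap (hq : q ≠ 0) (hq2 : q ^ 2 ≠ 1) {n p m c : ℕ} {r : ℕ → K}
    (hr : ∀ i, q ^ (2 * n) * r i = q ^ (2 * (2 * c + i)))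
    {S V : Matrix (Fin n) (Fin n) (PowerSeries A)} (h : reflLHS q S = reflRHS q S)
    (hSV : S * V = 1) (hVS : V * S = 1) {φ : Fin p → Fin n} (hφ : StrictMono φ) (d : ℕ)
    (hd : ∀ i, (φ i : ℕ) = d + i) {k k' : Fin m} (hk : (k' : ℕ) = k + 1) :
    ∃ Y, onPair k k' (1 - qSwapMap (PowerSeries A) q) *
        siteBracketInv q (V.submatrix φ φ) m c r (List.finRange m)
      = Y * onPair k k' (1 - qSwapMap (PowerSeries A) q) := by
  obtain ⟨Y, hY⟩ := siteBracketInv_swap hq hq2 hr h hSV hVS hk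
  refine ⟨restrictMat (PowerSeries A) m φ * Y * (restrictMat (PowerSeries A) m φ).transpose, ?_⟩
  have e1 : restrictMat (PowerSeries A) m φ * onPair k k' (1 - qSwapMap (PowerSeries A) q)
      = onPair k k' (1 - qSwapMap (PowerSeries A) q) * restrictMat (PowerSeries A) m φ :=
    restrictMat_mul_onPair_one_sub q hφ k k'
  have e2 : onPair k k' (1 - qSwapMap (PowerSeries A) q) *
        (restrictMat (PowerSeries A) m φ).transpose
      = (restrictMat (PowerSeries A) m φ).transpose *
        onPair k k' (1 - qSwapMap (PowerSeries A) q) :=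
    onPair_one_sub_mul_restrictMat_transpose q hφ k k'
  rw [← restrict_siteBracketInv hq d hφ hd r V (List.nodup_finRange m)]
  exact mul_conj_eq e1 e2 hY

theorem finRange_add (a b : ℕ) :
    List.finRange (a + b)
      = (List.finRange a).map (Fin.castAdd b) ++ (List.finRange b).map (Fin.natAdd a) := by
  refine List.ext_getElem (by simp) fun i h1 h2 => ?_
  rw [List.getElem_append]
  split_ifs with h
  · simp
  · simp only [List.length_map, List.length_finRange, not_lt] at h
    simp [h]

end Factorization

/-! ### The factorization for two complementary sets of indices. -/

section Factorization

variable {K A : Type*} [Field K] [CharZero K] [Ring A] [Algebra K A]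
variable {a b : ℕ} {f : Fin a → Fin (a + b)} {g : Fin b → Fin (a + b)} {q : K}

/-- The scalars by which the inverse of a bracket and a rescaled bracket act on `η` are inverse to
each other. -/
theorem siteBracketInv_scalar_mul_sdet (hq : q ≠ 0) {r : ℕ → K}
    (hr : ∀ i, q ^ (2 * b) * r i = q ^ (2 * (a + i)))
    {V Z : Matrix (Fin b) (Fin b) (PowerSeries A)} (hVZ : V * Z = 1) {s : PowerSeries A}
    (hs : Matrix.vecMul (qEtaVec A q b) (siteBracketInv q V b a r (List.finRange b))
      = fun J => s * qEtaVec A q b J) :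
    s * rescaleArg (q ^ (-(a : ℤ))) (sdet q (Z.map (rescaleArg (q ^ (-(a : ℤ)))))) = 1 := by
  set W := (siteBracket q (Z.map (rescaleArg (q ^ (-(a : ℤ))))) b 0 (List.finRange b)).map
    (rescaleHom A (q ^ (-(a : ℤ)))) with hWdef
  -- The reversed product against the bracket collapses from the middle outwards; this uses only `V
  -- * Z = 1`, not the opposite product.
  have hYW : siteBracketInv q V b a r (List.finRange b) * W = 1 := by
    rw [hWdef, map_siteBracket_rescale hq]
    have hs : ∀ i ∈ List.finRange b, onSite i (siteS q V (a + i)) * onSite i (siteS q Z (a + i)) = 1 :=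
      fun i _ => onSite_siteS_mul hVZ i _
    have ht : ∀ i ∈ List.finRange b, ∀ j ∈ List.finRange b, i ≠ j →
        onPair i j (siteTInv K A b q (r (i + j))) *
          onPair i j (siteT K A (Fin b) q (a + (i + j))) = 1 := fun i _ j _ hij => by
      rw [← onPair_mul hij, siteTInv_mul_siteT hq (hr _), onPair_one hij]
    exact listBracketRev_mul_listBracket (List.nodup_finRange b) hs ht
  have hW : rescaleArg (q ^ (-(a : ℤ))) (sdet q (Z.map (rescaleArg (q ^ (-(a : ℤ))))))
      = Matrix.vecMul (qEtaVec A q b) W id := by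
    rw [sdet_eq, ← rescaleHom_apply, Matrix.vecMul, Matrix.vecMul, dotProduct, dotProduct,
      map_sum]
    simp only [map_mul, rescaleHom_algebraMap]
    rfl
  rw [hW, ← vecMul_smul_left, ← hs, Matrix.vecMul_vecMul, hYW, Matrix.vecMul_one, qEtaVec_id]

/-- The Sklyanin determinant of a matrix of solutions of the reflection equation is the product of
the Sklyanin determinants of a diagonal block and of its Schur complement. -/
theorem sdet_eq_mul_sdet_schur {n : ℕ} (hn : n = a + b) (hq : q ≠ 0) (hq2 : q ^ 2 ≠ 1)
    {S : Matrix (Fin n) (Fin n) (PowerSeries A)} (h : reflLHS q S = reflRHS q S)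
    (hS : IsUnit S) {f : Fin a → Fin n} {g : Fin b → Fin n} (hf : StrictMono f)
    (hg : StrictMono g) (hfg : ∀ i j, f i ≠ g j) (d : ℕ) (hd : ∀ i, (g i : ℕ) = d + i)
    (hu : IsUnit (S.submatrix f f)) :
    sdet q S = sdet q (S.submatrix f f) * rescaleArg (q ^ (-(a : ℤ)))
      (sdet q ((S.submatrix g g - S.submatrix g f * Ring.inverse (S.submatrix f f) *
        S.submatrix f g).map (rescaleArg (q ^ (-(a : ℤ)))))) := by
  have hbij := bijective_append hn hf.injective hg.injective hfg
  subst hn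
  obtain ⟨V, hSV, hVS⟩ := isUnit_iff_exists.1 hS
  have hVZ := submatrix_mul_schur hbij hVS hu
  set Z := S.submatrix g g - S.submatrix g f * Ring.inverse (S.submatrix f f) * S.submatrix f g
  -- The same number read in two dimensions: by `hr1` it describes the inverse of the `(a +
  -- b)`-dimensional `R̄ᵗ` with exponent `2a + i`, as in `⟨S⟩` over the last `b` sites, and by `hr2`
  -- that of the `b`-dimensional `R̄ᵗ` with exponent `a + i`, as in the rescaled bracket of the
  -- Schur complement.
  set r : ℕ → K := fun i => q ^ (2 * (2 * a + i)) * (q ^ (2 * (a + b)))⁻¹ with hr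
  have hr1 : ∀ i, q ^ (2 * (a + b)) * r i = q ^ (2 * (2 * a + i)) := fun i => by
    rw [hr, mul_comm, mul_assoc, inv_mul_cancel₀ (pow_ne_zero _ hq), mul_one]
  have hr2 : ∀ i, q ^ (2 * b) * r i = q ^ (2 * (a + i)) := fun i => by
    refine mul_left_cancel₀ (pow_ne_zero (2 * a) hq) ?_
    rw [← mul_assoc, ← pow_add, ← mul_add, hr1, ← pow_add]
    congr 1
    ring
  set g₀ := Matrix.vecMul (qEtaVec A q b)
    (siteBracketInv q (V.submatrix g g) b a r (List.finRange b)) id with hg0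
  have hY := vecMul_qEtaVec hq
    (X := siteBracketInv q (V.submatrix g g) b a r (List.finRange b))
    fun k l hkl => restrict_siteBracketInv_swap hq hq2 hr1 h hSV hVS hg d hd hkl
  rw [← hg0] at hY
  have hinv := siteBracketInv_scalar_mul_sdet hq hr2 hVZ hY
  -- evaluation of `η X₁ C = sdet S · η X₂⁻¹` at `(f, g)`
  have hX := vecMul_qEtaVec_siteBracket hq hq2 h
  have hnd := List.nodup_finRange (a + b)
  rw [finRange_add] at hnd hX
  have happ := listBracket_append (siteLocal q S (a + b) 0) hnd
  change siteBracket q S (a + b) 0 _ = siteBracket q S (a + b) 0 _ * _ * siteBracket q S (a + b) 0 _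
    at happ
  rw [siteBracket_map_list (Fin.natAdd_injective b a) a (fun _ => rfl),
    siteBracket_map_list (Fin.castAdd_injective a b) 0 (fun _ => by simp)] at happ
  set C := listCross (fun i j : Fin (a + b) => onPair i j (siteT K A (Fin (a + b)) q
    ((0 + i) + (0 + j)))) ((List.finRange a).map (Fin.castAdd b))
    ((List.finRange b).map (Fin.natAdd a))
  set J := Fin.append f g
  have hlens := isLens_comp (ι := Fin (a + b)) (Fin.natAdd_injective b a)
  have h1 : siteBracket q S b a (List.finRange b) * siteBracketInv q V b a r (List.finRange b) = 1 :=
    siteBracket_mul_siteBracketInv hq hr1 hSV (List.nodup_finRange b)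
  have h2 := congrArg (fun w => Matrix.vecMul w (liftMat (fun I => I ∘ Fin.natAdd a)
    (fun I x => Function.extend (Fin.natAdd a) x I)
    (siteBracketInv q V b a r (List.finRange b))) J) hX
  beta_reduce at h2
  rw [happ, Matrix.vecMul_vecMul, Matrix.mul_assoc, ← hlens.liftMat_mul, h1, hlens.liftMat_one,
    Matrix.mul_one, vecMul_smul_left, vecMul_liftMat_natAdd hq hg hbij,
    restrict_siteBracketInv hq d hg hd r V (List.nodup_finRange b), ← hg0] at h2
  -- In the column `J = (f, g)` a site of the first group and a site of the second carry different
  -- basis vectors, so every factor of `C` fixes `J`.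
  have hC : ∀ I, C I J = (1 : Matrix _ _ (PowerSeries A)) I J := by
    refine listCross_apply_of_fixes fun i hi j hj => onPair_siteT_apply_of_ne _ _ ?_
    obtain ⟨i, -, rfl⟩ := List.mem_map.1 hi
    obtain ⟨j, -, rfl⟩ := List.mem_map.1 hj
    simpa [J] using hfg i j
  have h3 : ∀ w : (Fin (a + b) → Fin (a + b)) → PowerSeries A, Matrix.vecMul w C J = w J := by
    intro w
    rw [Matrix.vecMul, dotProduct, Finset.sum_congr rfl fun I _ => by rw [hC I]]
    simp [Matrix.one_apply]
  rw [← Matrix.vecMul_vecMul, h3, vecMul_liftMat_castAdd hq hf hbij,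
    restrict_siteBracket hf S (List.nodup_finRange a)] at h2
  have h4 : Matrix.vecMul (qEtaVec A q a) (siteBracket q (S.submatrix f f) a 0 (List.finRange a)) id
      = sdet q (S.submatrix f f) := (sdet_eq q a _).symm
  have hJ : IsUnit (qEtaVec A q (a + b) J) :=
    (qEta_ne_zero hq hbij).isUnit.map (algebraMap K (PowerSeries A))
  -- The entry of `η` at `J` is central and invertible; cancelling it leaves `sdet S_ff = sdet S *
  -- g₀`, with the factors in the order needed to multiply by the right inverse of `g₀`.
  rw [h4, ← mul_assoc, ← (commute_qEtaVec q _ J (sdet q S)).eq, mul_assoc, hJ.mul_right_inj] at h2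
  rw [h2, mul_assoc, hinv, mul_one]

end Factorization

/-! ### The reflection equation in the twisted q-Yangians -/

section Functoriality

variable {K A A' ι : Type*} [Field K] [Ring A] [Algebra K A] [Ring A'] [Algebra K A']
  [LinearOrder ι] [Fintype ι]

theorem inVar_map (φ : A →+* A') (k : Fin 2) (f : PowerSeries A) :
    inVar k (PowerSeries.map φ f) = MvPowerSeries.map φ (inVar k f) := by
  ext d
  rw [MvPowerSeries.coeff_map]
  change ite _ _ _ = φ (ite _ _ _)
  split_ifs <;> simp

theorem mvMap_algebraMap (φ : A →ₐ[K] A') (F : MvPowerSeries (Fin 2) K) :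
    MvPowerSeries.map (algebraMap K A') F
      = MvPowerSeries.map (φ : A →+* A') (MvPowerSeries.map (algebraMap K A) F) := by
  ext d
  simp

theorem reflR_map (q : K) (φ : A →ₐ[K] A') :
    (reflR A' q : Matrix (ι × ι) (ι × ι) _)
      = (reflR A q).map (MvPowerSeries.map (φ : A →+* A')) := by
  ext1 x y
  exact mvMap_algebraMap φ _

theorem reflRt_map (q : K) (φ : A →ₐ[K] A') :
    (reflRt A' q : Matrix (ι × ι) (ι × ι) _)
      = (reflRt A q).map (MvPowerSeries.map (φ : A →+* A')) := by
  ext1 x y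
  exact mvMap_algebraMap φ _

theorem reflS1_map (φ : A →+* A') (S : Matrix ι ι (PowerSeries A)) :
    reflS1 (S.map (PowerSeries.map φ)) = (reflS1 S).map (MvPowerSeries.map φ) := by
  rw [reflS1, reflS1, kronecker_map, matrix_one_map]
  congr 1
  ext1 i j
  exact inVar_map φ 0 _

theorem reflS2_map (φ : A →+* A') (S : Matrix ι ι (PowerSeries A)) :
    reflS2 (S.map (PowerSeries.map φ)) = (reflS2 S).map (MvPowerSeries.map φ) := by
  rw [reflS2, reflS2, kronecker_map, matrix_one_map]
  congr 1
  ext1 i j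
  exact inVar_map φ 1 _

theorem reflLHS_map (q : K) (φ : A →ₐ[K] A') (S : Matrix ι ι (PowerSeries A)) :
    reflLHS q (S.map (PowerSeries.map (φ : A →+* A')))
      = (reflLHS q S).map (MvPowerSeries.map (φ : A →+* A')) := by
  rw [reflLHS, reflLHS, Matrix.map_mul, Matrix.map_mul, Matrix.map_mul, reflR_map q φ,
    reflRt_map q φ, reflS1_map, reflS2_map]

theorem reflRHS_map (q : K) (φ : A →ₐ[K] A') (S : Matrix ι ι (PowerSeries A)) :
    reflRHS q (S.map (PowerSeries.map (φ : A →+* A')))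
      = (reflRHS q S).map (MvPowerSeries.map (φ : A →+* A')) := by
  rw [reflRHS, reflRHS, Matrix.map_mul, Matrix.map_mul, Matrix.map_mul, reflR_map q φ,
    reflRt_map q φ, reflS1_map, reflS2_map]

end Functoriality

/-! ### The generator matrices: reflection equation, and invertibility in the orthogonal case. -/

section Quotients

variable {K : Type*} [Field K] {n : ℕ} (q : K)

theorem reflection_orthS : reflLHS q (orthS K n q) = reflRHS q (orthS K n q) := by
  have h : orthS K n q
      = (orthFreeS K n).map (PowerSeries.map (RingQuot.mkAlgHom K (OrthRel K n q) :
        FreeAlgebra K (OrthGen n) →+* OrthYangian K n q)) := by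
    ext i j r
    simp only [orthS, orthFreeS, Matrix.map_apply, PowerSeries.coeff_mk, PowerSeries.coeff_map]
    rfl
  rw [h, reflLHS_map, reflRHS_map]
  ext a b d
  rw [Matrix.map_apply, Matrix.map_apply, MvPowerSeries.coeff_map, MvPowerSeries.coeff_map]
  exact RingQuot.mkAlgHom_rel K (OrthRel.reflection a b d)

theorem reflection_spS : reflLHS q (spS K n q) = reflRHS q (spS K n q) := by
  have h : spS K n q
      = (spFreeS K n).map (PowerSeries.map (RingQuot.mkAlgHom K (SpRel K n q) :
        FreeAlgebra K (SpGen n) →+* SpYangian K n q)) := by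
    ext i j r
    simp only [spS, spFreeS, Matrix.map_apply, PowerSeries.coeff_mk, PowerSeries.coeff_map]
    rfl
  rw [h, reflLHS_map, reflRHS_map]
  ext a b d
  rw [Matrix.map_apply, Matrix.map_apply, MvPowerSeries.coeff_map, MvPowerSeries.coeff_map]
  exact RingQuot.mkAlgHom_rel K (SpRel.reflection a b d)

/-- The constant term is lower triangular with ones on the diagonal, and an increasing choice of
indices preserves this. -/
theorem isUnit_orthS_submatrix {p : ℕ} {φ : Fin p → Fin n} (hφ : StrictMono φ) :
    IsUnit ((orthS K n q).submatrix φ φ) := by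
  refine isUnit_of_isUnit_constantCoeff (isUnit_of_lowerTriangular (fun i j hij => ?_) fun i => ?_)
  · have := RingQuot.mkAlgHom_rel K (OrthRel.upper (K := K) (q := q) (φ i) (φ j) (hφ hij))
    rw [map_zero] at this
    simpa [orthS] using this
  · have := RingQuot.mkAlgHom_rel K (OrthRel.diag (K := K) (q := q) (φ i))
    rw [map_one] at this
    have e : ((orthS K n q).submatrix φ φ).map (PowerSeries.coeff 0) i i = 1 := by
      simpa [orthS] using this
    rw [e]
    exact isUnit_one

end Quotients

/-! ### Invertibility in the symplectic case -/

section ConstantTerm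

variable {K A ι : Type*} [Field K] [Ring A] [Algebra K A] [LinearOrder ι] [Fintype ι]

/-- The reflection equation for the constant terms. -/
theorem reflection_constantTerm {q : K} {S : Matrix ι ι (PowerSeries A)}
    (h : reflLHS q S = reflRHS q S) :
    let T := S.map (PowerSeries.coeff 0)
    let R := (rMatrix q (1 : K) 0).map (algebraMap K A)
    let R' := (partialTranspose (rMatrix q (0 : K) 1)).map (algebraMap K A)
    R * (Matrix.kronecker T 1 * (R' * Matrix.kronecker 1 T))
      = Matrix.kronecker 1 T * (R' * (Matrix.kronecker T 1 * R)) := by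
  intro T R R'
  -- The substitution `u⁻¹ ↦ 0`, `v⁻¹ ↦ u⁻¹` turns the R-matrix into `X` times `R(1, 0)`. This `X`
  -- must be cancelled before constant terms are taken.
  set σ := specialize (K := K) A 0 1
  set μ := PowerSeries.map (algebraMap K A)
  have hsmul : ∀ (b : K) x, specialize K (0 : K) 1 (b • x) = b • specialize K (0 : K) 1 x :=
    fun b x => specialize_smul 0 1 b x
  have hmap : ∀ X : Matrix (ι × ι) (ι × ι) (MvPowerSeries (Fin 2) K),
      (X.map (MvPowerSeries.map (algebraMap K A))).map σ
        = (X.map (specialize K (0 : K) 1)).map μ := by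
    intro X
    ext1 i j
    exact specialize_map _ _ _
  have hR : (reflR A q : Matrix (ι × ι) (ι × ι) _).map σ
      = (PowerSeries.X : PowerSeries A) • ((rMatrix q (1 : PowerSeries K) 0).map μ) := by
    have e := rMatrix_smul (ι := ι) q (PowerSeries.X : PowerSeries K) 1 0
    rw [mul_one, mul_zero] at e
    rw [reflR, hmap, rMatrix_map _ _ _ _ hsmul, specialize_X_zero, specialize_X_one,
      map_zero, zero_mul, map_one, one_mul, e, smul_map_matrix, PowerSeries.map_X]
  have hRt : (reflRt A q : Matrix (ι × ι) (ι × ι) _).map σ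
      = (partialTranspose (rMatrix q (0 : PowerSeries K) 1)).map μ := by
    rw [reflRt, hmap, partialTranspose_map, rMatrix_map _ _ _ _ hsmul, map_mul, map_one,
      specialize_X_zero, map_zero, zero_mul, zero_mul]
  have main := congrArg (fun X => X.map σ) h
  simp only [reflLHS, reflRHS, Matrix.map_mul, hR, hRt] at main
  have hX : ∀ b : PowerSeries A, Commute PowerSeries.X b := fun b => (PowerSeries.commute_X b).symm
  rw [smul_mul_of_commute hX, Matrix.smul_mul, Matrix.smul_mul, Matrix.smul_mul] at main
  have main' : (rMatrix q (1 : PowerSeries K) 0).map μ * (reflS1 S).map σ *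
        (partialTranspose (rMatrix q (0 : PowerSeries K) 1)).map μ * (reflS2 S).map σ
      = (reflS2 S).map σ * (partialTranspose (rMatrix q (0 : PowerSeries K) 1)).map μ *
        (reflS1 S).map σ * (rMatrix q (1 : PowerSeries K) 0).map μ := by
    ext1 i j
    exact PowerSeries.X_mul_cancel (congrFun (congrFun main i) j)
  have main₀ := congrArg (fun X => X.map (PowerSeries.constantCoeff (R := A))) main'
  have hc : ∀ X : Matrix (ι × ι) (ι × ι) (PowerSeries K),
      (X.map μ).map (PowerSeries.constantCoeff (R := A))
        = (X.map (PowerSeries.constantCoeff (R := K))).map (algebraMap K A) := by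
    intro X
    ext1 i j
    simp only [μ, Matrix.map_apply, ← PowerSeries.coeff_zero_eq_constantCoeff_apply,
      PowerSeries.coeff_map]
  have hcs : ∀ (b : K) x, PowerSeries.constantCoeff (R := K) (b • x)
      = b • PowerSeries.constantCoeff (R := K) x := fun b x => by simp
  have hT0 : ((reflS1 S).map σ).map (PowerSeries.constantCoeff (R := A)) = Matrix.kronecker T 1 := by
    rw [reflS1, kronecker_map, kronecker_map, matrix_one_map, matrix_one_map]
    congr 1
    ext1 i j
    simp [σ, specialize_inVar_zero, rescaleArg, T]
  have hT1 : ((reflS2 S).map σ).map (PowerSeries.constantCoeff (R := A)) = Matrix.kronecker 1 T := by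
    rw [reflS2, kronecker_map, kronecker_map, matrix_one_map, matrix_one_map]
    congr 1
    ext1 i j
    simp [σ, specialize_inVar_one, rescaleArg, T]
  simp only [Matrix.map_mul, hc, hT0, hT1, partialTranspose_map] at main₀
  rw [rMatrix_map _ _ _ _ hcs, rMatrix_map _ _ _ _ hcs, map_zero, map_one] at main₀
  simpa only [Matrix.mul_assoc, R, R', partialTranspose_map] using main₀

/-- The entry of the reflection equation for the constant terms that relates `s_ii` and `s_ij`,
`i < j`. -/
theorem constantTerm_qcomm {q : K} (hq : q ≠ 0) {S : Matrix ι ι (PowerSeries A)}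
    (h : reflLHS q S = reflRHS q S) {i j : ι} (hij : i < j) :
    PowerSeries.coeff 0 (S i j) * PowerSeries.coeff 0 (S i i)
      = q ^ 2 • (PowerSeries.coeff 0 (S i i) * PowerSeries.coeff 0 (S i j)) := by
  set T := S.map (PowerSeries.coeff 0) with hT
  set R : Matrix (ι × ι) (ι × ι) A := (rMatrix q (1 : K) 0).map (algebraMap K A) with hR
  set R' : Matrix (ι × ι) (ι × ι) A :=
    (partialTranspose (rMatrix q (0 : K) 1)).map (algebraMap K A) with hR'
  set U : Matrix (ι × ι) (ι × ι) A := Matrix.kronecker T 1 with hUT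
  set W : Matrix (ι × ι) (ι × ι) A := Matrix.kronecker 1 T with hWT
  -- At these arguments `R` and `R'` are triangular, so the entry involves only `s_ii` and `s_ij`:
  -- it reads `-s_ii s_ij = -s_ij s_ii + (q² - 1) s_ii s_ij` for the constant terms.
  have h0 : (R * (U * (R' * W))) (i, i) (i, j)
      = (W * (R' * (U * R))) (i, i) (i, j) :=
    congrFun (congrFun (reflection_constantTerm h) (i, i)) (i, j)
  have hne := hij.ne
  have hne' := hij.ne'
  have hRa : ∀ a b c d, R (a, b) (c, d) = algebraMap K A (if a = c ∧ b = d then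
      (if a = b then q⁻¹ else 1) else if a = d ∧ b = c then
      (if c < a then q⁻¹ - q else 0) else 0) := by
    intro a b c d
    simp [hR, rMatrix]
  have hRa' : ∀ a b c d, R' (a, b) (c, d) = algebraMap K A (if c = a ∧ b = d then
      (if c = b then -q else -1) else if c = d ∧ b = a then
      (if a < c then 0 else q⁻¹ - q) else 0) := by
    intro a b c d
    simp [hR', rMatrix, partialTranspose]
  clear_value R R'
  have hU : ∀ (Z : Matrix (ι × ι) (ι × ι) A) (k m : ι) (y : ι × ι),
      (U * Z) (k, m) y = ∑ l, T k l * Z (l, m) y := by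
    intro Z k m y
    simp [hUT, Matrix.mul_apply, Fintype.sum_prod_type, Matrix.one_apply]
  have hV : ∀ (Z : Matrix (ι × ι) (ι × ι) A) (k m : ι) (y : ι × ι),
      (W * Z) (k, m) y = ∑ l, T m l * Z (k, l) y := by
    intro Z k m y
    simp [hWT, Matrix.mul_apply, Fintype.sum_prod_type_right, Matrix.one_apply]
  have hU' : ∀ (k m : ι), (U * R) (k, m) (i, j)
      = if m = j then T k i else if m = i then T k j * algebraMap K A (q⁻¹ - q) else 0 := by
    intro k m
    rw [hU]
    simp only [hRa]
    by_cases hm : m = j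
    · rw [if_pos hm, Finset.sum_eq_single i]
      · simp [hm, hne]
      · intro l _ hl
        simp [hl, hm, hne']
      · simp
    · rw [if_neg hm]
      by_cases hm' : m = i
      · rw [if_pos hm', Finset.sum_eq_single j]
        · simp [hm', hne, hij]
        · intro l _ hl
          simp [hl, hm', hne]
        · simp
      · rw [if_neg hm', Finset.sum_eq_zero]
        intro l _
        simp [hm, hm']
  have hW : ∀ a b c d, W (a, b) (c, d) = if a = c then T b d else 0 := by
    intro a b c d
    simp [hWT, Matrix.one_apply]
  have hL : ∀ l, (R' * W) (l, i) (i, j)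
      = if l = i then algebraMap K A (-q) * T i j else 0 := by
    intro l
    rw [Matrix.mul_apply, Finset.sum_eq_single (i, i)]
    · rw [hRa', hW]
      by_cases hl : l = i
      · simp [hl]
      · simp [hl, Ne.symm hl]
    · rintro ⟨x, y⟩ - hxy
      rw [hRa', hW]
      by_cases hx : x = i
      · have hy : y ≠ i := fun hy => hxy (by rw [hx, hy])
        simp [hx, Ne.symm hy]
      · simp [hx]
    · simp
  have hRR : ∀ l, (R' * (U * R)) (i, l) (i, j)
      = if l = j then -T i i else if l = i then
          algebraMap K A (-q) * (T i j * algebraMap K A (q⁻¹ - q)) else 0 := by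
    intro l
    rw [Matrix.mul_apply, Finset.sum_eq_single (i, l)]
    · rw [hRa', hU']
      by_cases hl : l = j
      · simp [hl, hne]
      · by_cases hl' : l = i
        · simp [hl', hne]
        · simp [hl, hl']
    · rintro ⟨x, y⟩ - hxy
      rw [hRa', hU', if_neg fun hh => hxy (by rw [hh.1, hh.2])]
      by_cases hl : l = i
      · by_cases hy : x = y
        · subst hy
          by_cases hx : x = j
          · simp [hl, hx, hij]
          · have hx' : x ≠ i := fun hh => hxy (by rw [hh, hl])
            simp [hx, hx']
        · simp [hy]
      · simp [hl]
    · simp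
  have hLHS : (R * (U * (R' * W))) (i, i) (i, j)
      = algebraMap K A q⁻¹ * (T i i * (algebraMap K A (-q) * T i j)) := by
    rw [Matrix.mul_apply, Finset.sum_eq_single (i, i)]
    · rw [hRa, hU]
      simp only [hL]
      simp
    · rintro ⟨x, y⟩ - hxy
      rw [hRa, if_neg fun hh => hxy (by rw [← hh.1, ← hh.2]),
        if_neg fun hh => hxy (Prod.ext hh.2.symm hh.1.symm),
        map_zero, zero_mul]
    · simp
  have hRHS : (W * (R' * (U * R))) (i, i) (i, j)
      = T i j * -T i i + T i i * (algebraMap K A (-q) * (T i j * algebraMap K A (q⁻¹ - q))) := by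
    rw [hV]
    simp only [hRR]
    rw [Finset.sum_eq_add j i hne']
    · simp [hne]
    · rintro l - ⟨h1, h2⟩
      simp [h1, h2]
    · simp
    · simp
  rw [hLHS, hRHS] at h0
  change T i j * T i i = q ^ 2 • (T i i * T i j)
  simp only [Algebra.algebraMap_eq_smul_one, smul_mul_assoc, one_mul, mul_smul_comm, mul_one,
    smul_smul, mul_neg] at h0
  have e1 : -q * q⁻¹ = -1 := by field_simp
  have e2 : -((q⁻¹ - q) * q) = q ^ 2 - 1 := by field_simp; ring
  rw [e1, e2, sub_smul, one_smul, neg_smul, one_smul] at h0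
  generalize T i i * T i j = x at h0 ⊢
  generalize T i j * T i i = y at h0 ⊢
  have := congrArg (fun z => z + x + y) h0
  simp only [neg_add_cancel, zero_add] at this
  rw [this]
  abel

end ConstantTerm

/-! ### Invertibility through `2 × 2` blocks. -/

section BlockTriangular

variable {A : Type*} [Ring A]

/-- Gaussian elimination with the upper right entry `b` as pivot. -/
theorem isUnit_fin_two_of_schur {a b c d e : A} (hb : b * e = 1) (hb' : e * b = 1)
    (hs : IsUnit (c - d * e * a)) : IsUnit (!![a, b; c, d] : Matrix (Fin 2) (Fin 2) A) := by
  obtain ⟨s', hs1, hs2⟩ := isUnit_iff_exists.1 hs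
  have h1 : ∀ x : A, IsUnit (!![1, 0; x, 1] : Matrix (Fin 2) (Fin 2) A) := fun x =>
    isUnit_iff_exists.2 ⟨!![1, 0; -x, 1], by simp [Matrix.one_fin_two],
      by simp [Matrix.one_fin_two]⟩
  have h2 : IsUnit (!![0, b; c - d * e * a, 0] : Matrix (Fin 2) (Fin 2) A) :=
    isUnit_iff_exists.2 ⟨!![0, s'; e, 0], by
      simp [Matrix.one_fin_two, hb, hs1], by
      simp [Matrix.one_fin_two, hb', hs2]⟩
  have : (!![a, b; c, d] : Matrix (Fin 2) (Fin 2) A)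
      = !![1, 0; d * e, 1] * !![0, b; c - d * e * a, 0] * !![1, 0; e * a, 1] := by
    simp [mul_assoc, hb']
    simp [← mul_assoc, hb]
  rw [this]
  exact ((h1 _).mul h2).mul (h1 _)

/-- A block lower triangular matrix with invertible `2 × 2` diagonal blocks is invertible. -/
theorem isUnit_of_blockLowerTriangular {k : ℕ} {T : Matrix (Fin (k * 2)) (Fin (k * 2)) A}
    (h : ∀ i j : Fin k, i < j → ∀ x y : Fin 2, T (finProdFinEquiv (i, x)) (finProdFinEquiv (j, y)) = 0)
    (hd : ∀ i : Fin k, IsUnit (Matrix.of fun x y : Fin 2 =>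
      T (finProdFinEquiv (i, x)) (finProdFinEquiv (i, y)))) : IsUnit T := by
  -- Over the noncommutative ring of `2 × 2` matrices `T` is lower triangular in the ordinary sense.
  set T' : Matrix (Fin k) (Fin k) (Matrix (Fin 2) (Fin 2) A) := Matrix.of fun i j => Matrix.of fun x y =>
    T (finProdFinEquiv (i, x)) (finProdFinEquiv (j, y)) with hT'
  have hu : IsUnit T' := isUnit_of_lowerTriangular
    (fun i j hij => by ext x y; exact h i j hij x y) hd
  have h2 := (hu.map (Matrix.compRingEquiv (Fin k) (Fin 2) A)).map
    (Matrix.reindexRingEquiv A finProdFinEquiv)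
  convert h2
  ext x y
  change T x y = T (finProdFinEquiv (finProdFinEquiv.symm x)) (finProdFinEquiv (finProdFinEquiv.symm y))
  rw [Equiv.apply_symm_apply, Equiv.apply_symm_apply]

end BlockTriangular

/-! ### Diagonal blocks of the symplectic generator matrix. -/

section SpUnits

variable {K : Type*} [Field K] {n : ℕ} {q : K}

/-- With `e = b⁻¹`, the q-commutation gives `a e = q² e a`, and the block relation gives `q² c = d a
e - q³ e`; hence `c - d e a = -q e`, a unit. -/
theorem schur_of_qcomm {A : Type*} [Ring A] [Algebra K A] (hq : q ≠ 0) {a b c d e : A}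
    (hbe : b * e = 1) (heb : e * b = 1) (hba : b * a = q ^ 2 • (a * b))
    (h : d * a - q ^ 2 • (c * b) = algebraMap K A (q ^ 3)) :
    IsUnit (c - d * e * a) := by
  have hq2 : q ^ 2 ≠ 0 := pow_ne_zero _ hq
  have h1 : a * e = q ^ 2 • (e * a) := by
    calc a * e = e * (b * a) * e := by rw [← mul_assoc, heb, one_mul]
      _ = q ^ 2 • (e * a) := by
        rw [hba, mul_smul_comm, smul_mul_assoc, mul_assoc, mul_assoc, hbe, mul_one]
  have h2 : q ^ 2 • c = d * a * e - q ^ 3 • e := by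
    have := congrArg (fun x => x * e) h
    simp only [sub_mul, smul_mul_assoc, mul_assoc, hbe, mul_one,
      Algebra.algebraMap_eq_smul_one, one_mul] at this
    rw [← this, mul_assoc]
    abel
  have h3 : c - d * e * a = (-q) • e := by
    have : q ^ 2 • (c - d * e * a) = q ^ 2 • ((-q) • e) := by
      rw [smul_sub, h2, mul_assoc, h1, mul_smul_comm, smul_smul, mul_assoc]
      rw [show q ^ 2 * -q = -q ^ 3 by ring, neg_smul]
      abel
    exact (smul_right_injective A hq2) this
  rw [h3]
  refine isUnit_iff_exists.2 ⟨(-q)⁻¹ • b, ?_, ?_⟩ <;>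
  rw [smul_mul_smul_comm]
  · rw [mul_inv_cancel₀ (neg_ne_zero.2 hq), heb, one_smul]
  · rw [inv_mul_cancel₀ (neg_ne_zero.2 hq), hbe, one_smul]

/-- The block begins at an even offset and has even size, so it is made of whole pairs `(i, i')`.
Above these pairs the constant term vanishes, and the pairs themselves are settled by
`constantTerm_qcomm` and the block relation. -/
theorem isUnit_spS_submatrix (hq : q ≠ 0) {k : ℕ} {p : ℕ} (hp : p = k * 2) {φ : Fin p → Fin n}
    {d : ℕ} (hd : Even d) (hφ : ∀ i, (φ i : ℕ) = d + i) :
    IsUnit ((spS K n q).submatrix φ φ) := by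
  subst hp
  refine isUnit_of_isUnit_constantCoeff (isUnit_of_blockLowerTriangular
    (fun i j hij x y => ?_) fun i => ?_)
  · have hlt : (i : ℕ) < j := hij
    have := RingQuot.mkAlgHom_rel K (SpRel.upper (K := K) (q := q) (φ (finProdFinEquiv (i, x)))
      (φ (finProdFinEquiv (j, y))) (by
        rw [Fin.lt_def, hφ, hφ]
        simp only [finProdFinEquiv_apply_val]
        omega) (by
        rintro ⟨he, h⟩
        rw [hφ] at he h
        rw [hφ] at h
        simp only [finProdFinEquiv_apply_val] at he h
        rw [Nat.even_iff] at hd he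
        omega))
    rw [map_zero] at this
    simpa [spS] using this
  · set I := φ (finProdFinEquiv (i, 0)) with hI
    set J := φ (finProdFinEquiv (i, 1)) with hJ
    have hIv : (I : ℕ) = d + 2 * i := by rw [hI, hφ]; simp [finProdFinEquiv_apply_val]
    have hJv : (J : ℕ) = I + 1 := by
      rw [hIv, hJ, hφ]
      simp only [finProdFinEquiv_apply_val, Fin.val_one]
      omega
    have hIe : Even (I : ℕ) := by
      rw [Nat.even_iff] at hd ⊢
      omega
    set ψ := RingQuot.mkAlgHom K (SpRel K n q) with hψ
    have hcoeff : ∀ x y, PowerSeries.coeff 0 (spS K n q x y)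
        = ψ (FreeAlgebra.ι K (SpGen.s x y 0)) := fun x y => by simp [spS, hψ]
    have r1 := RingQuot.mkAlgHom_rel K (SpRel.mul_inv (K := K) (q := q) I J hIe hJv)
    have r2 := RingQuot.mkAlgHom_rel K (SpRel.inv_mul (K := K) (q := q) I J hIe hJv)
    have r3 := RingQuot.mkAlgHom_rel K (SpRel.block (K := K) (q := q) I J hIe hJv)
    rw [← hψ, map_mul, map_one] at r1 r2
    rw [← hψ, map_sub, map_smul, map_mul, map_mul, AlgHom.commutes] at r3
    have hlt : I < J := by rw [Fin.lt_def]; omega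
    have r4 := constantTerm_qcomm hq (reflection_spS (n := n) q) hlt
    rw [hcoeff, hcoeff] at r4
    have hu := isUnit_fin_two_of_schur r1 r2 (schur_of_qcomm hq r1 r2 r4 r3)
    refine (congrArg IsUnit (Matrix.ext fun x y => ?_)).mpr hu
    fin_cases x <;> fin_cases y <;> exact hcoeff _ _

end SpUnits

end TwistedQYangian

end

theorem mainTheorem2 {K : Type*} [Field K] [CharZero K] (q : K) (hq0 : q ≠ 0)
    (hq : ∀ k : ℕ, 0 < k → q ^ k ≠ 1) (N M : ℕ) :
    -- the orthogonal case
    (IsUnit (block11 (orthS K (N + M) q)) ∧ IsUnit (block22 (orthS K (N + M) q)) ∧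
      sdet q (orthS K (N + M) q) =
        sdet q (block11 (orthS K (N + M) q)) *
          rescaleArg (q ^ (-(N : ℤ)))
            (sdet q ((schur22 (orthS K (N + M) q)).map (rescaleArg (q ^ (-(N : ℤ)))))) ∧
      sdet q (orthS K (N + M) q) =
        sdet q (block22 (orthS K (N + M) q)) *
          rescaleArg (q ^ (-(M : ℤ)))
            (sdet q ((schur11 (orthS K (N + M) q)).map (rescaleArg (q ^ (-(M : ℤ))))))) ∧
    -- the symplectic case
    (Even N → Even M →
      IsUnit (block11 (spS K (N + M) q)) ∧ IsUnit (block22 (spS K (N + M) q)) ∧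
      sdet q (spS K (N + M) q) =
        sdet q (block11 (spS K (N + M) q)) *
          rescaleArg (q ^ (-(N : ℤ)))
            (sdet q ((schur22 (spS K (N + M) q)).map (rescaleArg (q ^ (-(N : ℤ)))))) ∧
      sdet q (spS K (N + M) q) =
        sdet q (block22 (spS K (N + M) q)) *
          rescaleArg (q ^ (-(M : ℤ)))
            (sdet q ((schur11 (spS K (N + M) q)).map (rescaleArg (q ^ (-(M : ℤ))))))) := by
  have hq2 : q ^ 2 ≠ 1 := hq 2 two_pos
  have hc : StrictMono (Fin.castAdd M : Fin N → Fin (N + M)) := Fin.strictMono_castAdd M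
  have hn : StrictMono (Fin.natAdd N : Fin M → Fin (N + M)) := Fin.strictMono_natAdd N
  have hcn : ∀ (i : Fin N) (j : Fin M), Fin.castAdd M i ≠ Fin.natAdd N j := fun i j h => by
    have := congrArg Fin.val h
    simp only [Fin.val_castAdd, Fin.val_natAdd] at this
    omega
  refine ⟨?_, fun hN hM => ?_⟩
  · have hS : IsUnit (orthS K (N + M) q) := isUnit_orthS_submatrix q strictMono_id
    have h1 : IsUnit (block11 (orthS K (N + M) q)) := isUnit_orthS_submatrix q hc
    have h2 : IsUnit (block22 (orthS K (N + M) q)) := isUnit_orthS_submatrix q hn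
    exact ⟨h1, h2,
      sdet_eq_mul_sdet_schur rfl hq0 hq2 (reflection_orthS q) hS hc hn hcn N (fun _ => rfl) h1,
      -- The second formula is the first with `f` listing the last `M` indices and `g` the first
      -- `N`, an interval with offset `0`; `f` and `g` need not come in increasing order relative to
      -- each other.
      sdet_eq_mul_sdet_schur (Nat.add_comm N M) hq0 hq2 (reflection_orthS q) hS hn hc
        (fun i j h => hcn j i h.symm) 0 (fun _ => by simp) h2⟩
  · obtain ⟨k, hk⟩ := even_iff_two_dvd.1 hN
    obtain ⟨l, hl⟩ := even_iff_two_dvd.1 hM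
    have hS : IsUnit (spS K (N + M) q) :=
      isUnit_spS_submatrix (k := k + l) (φ := id) hq0 (by omega) Even.zero (fun _ => by simp)
    have h1 : IsUnit (block11 (spS K (N + M) q)) :=
      isUnit_spS_submatrix (k := k) hq0 (by omega) Even.zero (fun _ => by simp)
    have h2 : IsUnit (block22 (spS K (N + M) q)) :=
      isUnit_spS_submatrix (k := l) hq0 (by omega) hN (fun _ => rfl)
    exact ⟨h1, h2,
      sdet_eq_mul_sdet_schur rfl hq0 hq2 (reflection_spS q) hS hc hn hcn N (fun _ => rfl) h1,
      sdet_eq_mul_sdet_schur (Nat.add_comm N M) hq0 hq2 (reflection_spS q) hS hn hc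
        (fun i j h => hcn j i h.symm) 0 (fun _ => by simp) h2⟩
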